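/- Let $a\le b$ be real numbers and let $f,g\in C^1(\mathbb R)$ satisfy $f(a)=g(a)$ and $f(b)=g(b)$. Let $H$ be the Heaviside function, $\mathbb R^+=(0,\infty)$ and $\operatorname{sgn}(0)=0$, and consider the Cauchy problem $$\partial_t u+\partial_x\big(H(x)f(u)+H(-x)g(u)\big)=0\ \text{ in }\mathbb R^+\times\mathbb R,\qquad u|_{t=0}=u_0,\qquad(1)$$ where $u_0$ is measurable and $a\le u_0\le b$ almost everywhere. A function $u\in L^\infty(\mathbb R^+\times\mathbb R)$ is a weak solution of (1) if for every $\varphi\in C_c^\infty(\mathbb R\times\mathbb R)$ $$\int_{\mathbb R^+\times\mathbb R}\Big(u\,\partial_t\varphi+\big(H(x)f(u)+H(-x)g(u)\big)\partial_x\varphi\Big)\,dx\,dt+\int_{\mathbb R}u_0(x)\varphi(0,x)\,dx=0 .$$ A weak solution $u$ of (1) is entropy admissible if $u(t,x)\in[a,b]$ for almost every $(t,x)$ and there is a measurable function $p:\mathbb R^+\to[a,b]$ such that for every $\xi\in\mathbb R$ $$\partial_t|u-\xi|+\partial_x\Big\{\operatorname{sgn}(u-\xi)\big[H(x)(f(u)-f(\xi))+H(-x)(g(u)-g(\xi))\big]\Big\}+\operatorname{sgn}(p(t)-\xi)\,(f(\xi)-g(\xi))\,\delta(x)\le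 0$$ in $\mathcal D'(\mathbb R^+\times\mathbb R)$. The function $u$ has left and right strong traces at $x=0$ if there are functions $u^-,u^+\in L^\infty_{\rm loc}(\mathbb R^+)$ such that for every $\varphi\in C_c(\mathbb R^+)$ $$\operatorname*{ess\,lim}_{x\to0^\pm}\int_{\mathbb R^+}|u(t,x)-u^\pm(t)|\,\varphi(t)\,dt=0 .$$ Then there is a constant $C>0$, depending only on $f$, $g$ and the interval $[a,b]$, such that the following holds for all $R,T>0$. If $u$ and $v$ are entropy admissible solutions of (1) with initial data $u_0$ and $v_0$ respectively, where $u_0,v_0$ are measurable with values in $[a,b]$ almost everywhere, and both $u$ and $v$ have left and right strong traces at $x=0$, then $$\int_0^T\int_{B(0,R)}|u(t,x)-v(t,x)|\,dx\,dt\le T\int_{B(0,R+CT)}|u_0(x)-v_0(x)|\,dx .$$ -/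

import Mathlib

open MeasureTheory Set Filter Topology
open scoped ContDiff

noncomputable section

namespace DiscontinuousFlux

/-- The open half plane `ℝ⁺ × ℝ`; points are written `(t, x)`. -/
def halfPlane : Set (ℝ × ℝ) := Ioi (0 : ℝ) ×ˢ (univ : Set ℝ)

/-- The Heaviside function (its value at `0` plays no role below). -/
def heaviside (x : ℝ) : ℝ := if 0 < x then 1 else 0

/-- The discontinuous flux `H(x) f(s) + H(-x) g(s)`. -/
def flux (f g : ℝ → ℝ) (x s : ℝ) : ℝ := heaviside x * f s + heaviside (-x) * g s

/-- Partial derivative in the time variable. -/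
def partialT (φ : ℝ × ℝ → ℝ) (z : ℝ × ℝ) : ℝ := fderiv ℝ φ z (1, 0)

/-- Partial derivative in the space variable. -/
def partialX (φ : ℝ × ℝ → ℝ) (z : ℝ × ℝ) : ℝ := fderiv ℝ φ z (0, 1)

/-- Initial data: measurable functions with values in `[a, b]` almost everywhere. -/
structure IsInitialDatum (a b : ℝ) (u₀ : ℝ → ℝ) : Prop where
  aestronglyMeasurable : AEStronglyMeasurable u₀ volume
  mem_Icc : ∀ᵐ x : ℝ, u₀ x ∈ Icc a b

/-- `u ∈ L^∞(ℝ⁺ × ℝ)` is a weak solution of the Cauchy problem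
`∂ₜu + ∂ₓ(H(x) f(u) + H(-x) g(u)) = 0`, `u(0, ·) = u₀`. The test functions need not vanish at
`t = 0`; this is how the initial condition is encoded. -/
structure IsWeakSolution (f g : ℝ → ℝ) (u₀ : ℝ → ℝ) (u : ℝ × ℝ → ℝ) : Prop where
  memLp_top : MemLp u ⊤ (volume.restrict halfPlane)
  integral_eq_zero : ∀ φ : ℝ × ℝ → ℝ, ContDiff ℝ ∞ φ → HasCompactSupport φ →
    (∫ z in halfPlane, (u z * partialT φ z + flux f g z.2 (u z) * partialX φ z))
      + ∫ x : ℝ, u₀ x * φ (0, x) = 0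

/-- The entropy inequality with level `ξ` and interface function `p`:
`∂ₜ|u - ξ| + ∂ₓ{sgn(u - ξ)[H(x)(f(u) - f(ξ)) + H(-x)(g(u) - g(ξ))]}
  + sgn(p(t) - ξ)(f(ξ) - g(ξ)) δ(x) ≤ 0` in the sense of distributions on `ℝ⁺ × ℝ`.
Here `Real.sign 0 = 0`. -/
def EntropyInequality (f g : ℝ → ℝ) (p : ℝ → ℝ) (ξ : ℝ) (u : ℝ × ℝ → ℝ) : Prop :=
  ∀ φ : ℝ × ℝ → ℝ, ContDiff ℝ ∞ φ → HasCompactSupport φ → tsupport φ ⊆ halfPlane →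
    (∀ z, 0 ≤ φ z) →
    - (∫ z in halfPlane, (|u z - ξ| * partialT φ z
          + Real.sign (u z - ξ) * (flux f g z.2 (u z) - flux f g z.2 ξ) * partialX φ z))
      + ∫ t in Ioi (0 : ℝ), Real.sign (p t - ξ) * (f ξ - g ξ) * φ (t, 0) ≤ 0

/-- Entropy admissible solutions of the Cauchy problem with initial datum `u₀`. -/
structure IsEntropyAdmissible (a b : ℝ) (f g : ℝ → ℝ) (u₀ : ℝ → ℝ) (u : ℝ × ℝ → ℝ) : Prop
    extends IsWeakSolution f g u₀ u where
  mem_Icc : ∀ᵐ z ∂(volume.restrict halfPlane), u z ∈ Icc a b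
  exists_interface : ∃ p : ℝ → ℝ, AEMeasurable p (volume.restrict (Ioi (0 : ℝ))) ∧
    (∀ t, 0 < t → p t ∈ Icc a b) ∧ ∀ ξ : ℝ, EntropyInequality f g p ξ u

/-- `w` is the strong trace of `u` at `x = 0` from the side described by the filter `l`
(`𝓝[>] 0` or `𝓝[<] 0`). As `u` is only determined up to null sets, the limit is an essential
limit: null sets of values of `x` are disregarded. -/
structure IsStrongTrace (l : Filter ℝ) (u : ℝ × ℝ → ℝ) (w : ℝ → ℝ) : Prop where
  memLp_top_loc : ∀ K : Set ℝ, IsCompact K → K ⊆ Ioi (0 : ℝ) → MemLp w ⊤ (volume.restrict K)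
  tendsto : ∀ φ : ℝ → ℝ, Continuous φ → HasCompactSupport φ → tsupport φ ⊆ Ioi (0 : ℝ) →
    Tendsto (fun x : ℝ => ∫ t in Ioi (0 : ℝ), |u (t, x) - w t| * φ t)
      (l ⊓ ae (volume : Measure ℝ)) (𝓝 0)

/-- `u` has a left and a right strong trace at `x = 0`. -/
def HasStrongTraces (u : ℝ × ℝ → ℝ) : Prop :=
  (∃ w : ℝ → ℝ, IsStrongTrace (𝓝[<] (0 : ℝ)) u w) ∧
    ∃ w : ℝ → ℝ, IsStrongTrace (𝓝[>] (0 : ℝ)) u w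

end DiscontinuousFlux

end

open MeasureTheory Set Filter Topology
open scoped ContDiff
set_option linter.unusedSectionVars false

/-! The difficulty lies at `t = 0`: the initial datum enters only through the weak formulation,
while the entropy inequalities are tested strictly inside the half plane. Kružkov's last step,
pushing a cone of test functions down to the initial line, would need strong convergence of `u(t,
·)` to `u₀`. The proof replaces it by a transport argument for a potential.

Write `F(x, ·)` for the discontinuous flux, `ρ = |u - v|`, and `Q` for the Kružkov flux of the pair
`(u, v)`. Doubling of variables on each side of the interface gives `∂ₜρ + ∂ₓQ ≤ 0` for `x ≠ 0`
(`kato_of_kruzkovOn`). At the interface the strong traces turn the entropy inequality into algebraic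
conditions on `(u⁻, u⁺, p)`. These give Rankine–Hugoniot and, by comparing two admissible pairs,
outgoing flux of `ρ` no larger than incoming flux (`InterfaceAdmissible.kflux_le`). Hence `∂ₜρ + ∂ₓQ
≤ 0` on the whole open half plane (`RegularSolution.kato`).

The weak formulations say that `(u - v, F(x, u) - F(x, v))`, continued to `t ≤ 0` by `(u₀ - v₀, 0)`,
is divergence free in the plane. It therefore has a Lipschitz potential `D` with `D_x = u - v` and
`D_t = -(F(x, u) - F(x, v))` (`exists_potential`). Since `D` is continuous up to `t = 0`, the
initial condition becomes the pointwise statement that `D(0, ·)` is a primitive of `u₀ - v₀`.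
Moreover `ρ D_t + Q D_x = 0`: the field `(ρ, Q)` transports `D`.

Testing Kato's inequality with a cone weight times `((D - m)₊)²` makes all derivatives of `D`
cancel, and yields a maximum principle on backward cones (`le_of_le_on_base`). Applied to `D` and
`-D`, it shows that every value `D(t, x)` is already taken at time `s < t` within distance `C (t -
s)` of `x`. Ordered finite families of points can then be followed back to time zero along level
sets without losing their order (`exists_monotone_zero`). So the variation of `D(t, ·)` on `[-R, R]`
is at most that of `D(0, ·)` on `[-R - Ct, R + Ct]`. These variations control the two `L¹` norms,
and integration in `t` finishes the proof. -/

namespace DiscontinuousFlux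

/-! ### Mollification and Lebesgue points -/

section Mollifier

variable {E : Type*} [NormedAddCommGroup E] [NormedSpace ℝ E] [HasContDiffBump E]

/-- The bump function with radii `1 / (n + 1)` and `2 / (n + 1)`. -/
noncomputable def bump (E : Type*) [NormedAddCommGroup E] [NormedSpace ℝ E] (n : ℕ) :
    ContDiffBump (0 : E) :=
  ⟨1 / ((n : ℝ) + 1), 2 / ((n : ℝ) + 1), by positivity, by gcongr; norm_num⟩

variable [FiniteDimensional ℝ E] [MeasureSpace E] [BorelSpace E]
  [(volume : Measure E).IsAddHaarMeasure]

/-- A standard mollifier. -/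
noncomputable def mollifier (n : ℕ) (z : E) : ℝ := (bump E n).normed volume z

/-- Convolution with a standard mollifier. -/
noncomputable def mollify (n : ℕ) (g : E → ℝ) (z : E) : ℝ := ∫ y, mollifier n (z - y) * g y

lemma tendsto_bump_rOut : Tendsto (fun n => (bump E n).rOut) atTop (𝓝 0) := by
  have := (tendsto_one_div_add_atTop_nhds_zero_nat (𝕜 := ℝ)).const_mul 2
  simpa [bump, div_eq_mul_inv] using this

lemma mollifier_nonneg (n : ℕ) (z : E) : 0 ≤ mollifier n z := ContDiffBump.nonneg_normed _ _

lemma contDiff_mollifier (n : ℕ) : ContDiff ℝ ∞ (mollifier (E := E) n) :=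
  ContDiffBump.contDiff_normed (n := ⊤) _

lemma continuous_mollifier (n : ℕ) : Continuous (mollifier (E := E) n) :=
  (contDiff_mollifier n).continuous

lemma hasCompactSupport_mollifier (n : ℕ) : HasCompactSupport (mollifier (E := E) n) :=
  ContDiffBump.hasCompactSupport_normed _

lemma tsupport_mollifier (n : ℕ) :
    tsupport (mollifier (E := E) n) = Metric.closedBall 0 (bump E n).rOut :=
  ContDiffBump.tsupport_normed_eq _

lemma integral_mollifier (n : ℕ) : ∫ z : E, mollifier n z = 1 := ContDiffBump.integral_normed _

lemma integral_mollifier_sub (n : ℕ) (z : E) : ∫ y : E, mollifier n (z - y) = 1 := by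
  rw [← integral_mollifier (E := E) n]
  exact integral_sub_left_eq_self _ _ _

lemma integrable_mollifier_sub (n : ℕ) (z : E) : Integrable (fun y : E => mollifier n (z - y)) := by
  have : Integrable (mollifier (E := E) n) := ContDiffBump.integrable_normed _
  exact this.comp_sub_left z

lemma mollify_eq_convolution (n : ℕ) (g : E → ℝ) :
    mollify n g = convolution (mollifier n) g (ContinuousLinearMap.lsmul ℝ ℝ) volume := by
  ext z
  simp [mollify, convolution_eq_swap]

lemma ae_tendsto_mollify {g : E → ℝ} (hg : LocallyIntegrable g volume) :
    ∀ᵐ z, Tendsto (fun n => mollify n g z) atTop (𝓝 (g z)) := by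
  have := ContDiffBump.ae_convolution_tendsto_right_of_locallyIntegrable (μ := (volume : Measure E))
    (φ := fun n => bump E n) (l := atTop) (K := 2) tendsto_bump_rOut
    (Eventually.of_forall fun n => by simp [bump, div_eq_mul_inv]) hg
  simp_rw [mollify_eq_convolution]
  exact this

lemma tendsto_mollify_of_continuous {g : E → ℝ} (hg : Continuous g) (z : E) :
    Tendsto (fun n => mollify n g z) atTop (𝓝 (g z)) := by
  simp_rw [mollify_eq_convolution]
  exact ContDiffBump.convolution_tendsto_right_of_continuous tendsto_bump_rOut hg z

/-- Almost every point is a Lebesgue point with respect to the mollifiers. -/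
lemma ae_tendsto_integral_mollifier_mul_abs_sub {g : E → ℝ} (hg : LocallyIntegrable g volume) :
    ∀ᵐ z, Tendsto (fun n => ∫ y, mollifier n (z - y) * |g y - g z|) atTop (𝓝 0) := by
  -- Rational levels keep the exceptional set null; the level `g z`, which varies with the point, is
  -- then approximated by a rational.
  have key : ∀ᵐ z, ∀ q : ℚ, Tendsto (fun n => mollify n (fun y => |g y - q|) z) atTop
      (𝓝 (|g z - q|)) := by
    rw [ae_all_iff]
    intro q
    exact ae_tendsto_mollify (fun x => ((hg.sub (locallyIntegrable_const (q : ℝ))) x).norm)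
  filter_upwards [key] with z hz
  have hint : ∀ n (c : ℝ), Integrable (fun y : E => mollifier n (z - y) * |g y - c|) := by
    intro n c
    have hl : LocallyIntegrable (fun y => |g y - c|) volume :=
      fun x => ((hg.sub (locallyIntegrable_const (c : ℝ))) x).norm
    exact hl.integrable_smul_left_of_hasCompactSupport
      ((continuous_mollifier n).comp (continuous_const.sub continuous_id))
      ((hasCompactSupport_mollifier n).comp_homeomorph (Homeomorph.subLeft z))
  rw [Metric.tendsto_atTop]
  intro ε hε
  obtain ⟨q, hq1, hq2⟩ := exists_rat_btwn (show g z < g z + ε / 4 by linarith)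
  have hq : |g z - q| < ε / 4 := by rw [abs_lt]; constructor <;> linarith
  obtain ⟨N, hN⟩ := (Metric.tendsto_atTop.1 (hz q)) (ε / 4) (by linarith)
  refine ⟨N, fun n hn => ?_⟩
  have h1 := hN n hn
  rw [Real.dist_eq] at h1 ⊢
  have h2 : ∫ y, mollifier n (z - y) * |g y - g z| ≤
      mollify n (fun y => |g y - q|) z + |g z - q| := by
    have : mollify n (fun y => |g y - q|) z + |g z - q| =
        ∫ y, (mollifier n (z - y) * |g y - q| + mollifier n (z - y) * |g z - q|) := by
      rw [integral_add (hint n q) ((integrable_mollifier_sub n z).mul_const _), integral_mul_const,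
        integral_mollifier_sub, one_mul]
      rfl
    rw [this]
    refine integral_mono (hint n _) ((hint n q).add ((integrable_mollifier_sub n z).mul_const _)) ?_
    intro y
    have := abs_sub_le (g y) q (g z)
    rw [abs_sub_comm (q : ℝ)] at this
    have h0 := mollifier_nonneg n (z - y)
    simp only
    nlinarith
  have h3 : 0 ≤ ∫ y, mollifier n (z - y) * |g y - g z| :=
    integral_nonneg fun y => mul_nonneg (mollifier_nonneg _ _) (abs_nonneg _)
  rw [sub_zero, abs_of_nonneg h3]
  rw [abs_lt] at h1
  linarith

lemma contDiff_mollify (n : ℕ) {g : E → ℝ} (hg : LocallyIntegrable g volume) :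
    ContDiff ℝ ∞ (mollify n g) := by
  rw [mollify_eq_convolution]
  exact (hasCompactSupport_mollifier n).contDiff_convolution_left (n := ⊤) _
    (contDiff_mollifier n) hg

lemma mollify_nonneg (n : ℕ) {g : E → ℝ} (hg : ∀ z, 0 ≤ g z) (z : E) : 0 ≤ mollify n g z :=
  integral_nonneg fun _ => mul_nonneg (mollifier_nonneg _ _) (hg _)

lemma abs_mollify_le (n : ℕ) {g : E → ℝ} {K : ℝ} (hg : ∀ z, |g z| ≤ K) (z : E) :
    |mollify n g z| ≤ K := by
  have : ‖mollify n g z‖ ≤ ∫ y, mollifier n (z - y) * K := by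
    refine norm_integral_le_of_norm_le ((integrable_mollifier_sub n z).mul_const _)
      (Eventually.of_forall fun y => ?_)
    rw [norm_mul, Real.norm_of_nonneg (mollifier_nonneg _ _)]
    exact mul_le_mul_of_nonneg_left (hg y) (mollifier_nonneg _ _)
  rwa [integral_mul_const, integral_mollifier_sub, one_mul] at this

lemma mollify_eq_zero_of_notMem {g : E → ℝ} {δ : ℝ} {n : ℕ} (hn : (bump E n).rOut ≤ δ) {z : E}
    (hz : z ∉ Metric.cthickening δ (tsupport g)) : mollify n g z = 0 := by
  have : ∀ y, mollifier n (z - y) * g y = 0 := by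
    intro y
    by_cases hy : y ∈ tsupport g
    · have : mollifier n (z - y) = 0 := by
        apply image_eq_zero_of_notMem_tsupport
        rw [tsupport_mollifier]
        intro h
        apply hz
        rw [mem_closedBall_zero_iff] at h
        exact Metric.mem_cthickening_of_dist_le z y δ _ hy (by rw [dist_eq_norm]; linarith)
      rw [this, zero_mul]
    · rw [image_eq_zero_of_notMem_tsupport hy, mul_zero]
  simp [mollify, this]

lemma tsupport_mollify_subset {g : E → ℝ} {δ : ℝ} {n : ℕ} (hn : (bump E n).rOut ≤ δ) :
    tsupport (mollify n g) ⊆ Metric.cthickening δ (tsupport g) := by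
  refine closure_minimal ?_ Metric.isClosed_cthickening
  intro z hz
  by_contra h
  exact hz (mollify_eq_zero_of_notMem hn h)

lemma fderiv_mollify_apply (n : ℕ) {g : E → ℝ} (hg : LocallyIntegrable g volume) (z v : E) :
    fderiv ℝ (mollify n g) z v = ∫ y, fderiv ℝ (mollifier n) (z - y) v * g y := by
  have hd := (hasCompactSupport_mollifier (E := E) n).hasFDerivAt_convolution_left
    (ContinuousLinearMap.lsmul ℝ ℝ) ((contDiff_mollifier n).of_le (by simp)) hg z
  rw [mollify_eq_convolution, hd.fderiv, convolution_eq_swap, ContinuousLinearMap.integral_apply]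
  · simp
  · have hc := ((hasCompactSupport_mollifier (E := E) n).fderiv (𝕜 := ℝ))
    have := hc.convolutionExists_left
      ((ContinuousLinearMap.lsmul ℝ ℝ : ℝ →L[ℝ] ℝ →L[ℝ] ℝ).precompL E)
      ((contDiff_mollifier (E := E) n).continuous_fderiv (by simp)) hg z
    exact this.integrable_swap

/-- Integration by parts with a merely Lipschitz factor: Rademacher's theorem supplies the gradient
almost everywhere. Consequently mollification commutes with differentiation and keeps the Lipschitz
bound on the gradient. -/
lemma integral_fderiv_mollifier_mul (n : ℕ) {g : E → ℝ} {C : NNReal} (hg : LipschitzWith C g)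
    (z v : E) :
    ∫ y, fderiv ℝ (mollifier n) (z - y) v * g y = ∫ y, mollifier n (z - y) * fderiv ℝ g y v := by
  have hc : HasCompactSupport (fun y : E => mollifier n (z - y)) :=
    (hasCompactSupport_mollifier n).comp_homeomorph (Homeomorph.subLeft z)
  have hcd : ContDiff ℝ 1 (fun y : E => mollifier n (z - y)) :=
    ((contDiff_mollifier n).of_le (by simp)).comp (contDiff_const.sub contDiff_id)
  obtain ⟨D, hD⟩ := hcd.lipschitzWith_of_hasCompactSupport hc one_ne_zero
  have := hg.integral_lineDeriv_mul_eq (μ := (volume : Measure E)) hD hc v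
  have e1 : ∀ y, lineDeriv ℝ (fun y : E => mollifier n (z - y)) y (-v) =
      fderiv ℝ (mollifier n) (z - y) v := by
    intro y
    rw [(hcd.differentiable one_ne_zero y).lineDeriv_eq_fderiv]
    have h1 : HasFDerivAt (fun y : E => mollifier n (z - y))
      ((fderiv ℝ (mollifier n) (z - y)).comp (-(ContinuousLinearMap.id ℝ E))) y := by
      refine HasFDerivAt.comp y ?_ ((hasFDerivAt_id y).const_sub z)
      exact ((contDiff_mollifier n).differentiable (by simp) _).hasFDerivAt
    rw [h1.fderiv]
    simp
  simp_rw [e1] at this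
  rw [← this]
  refine integral_congr_ae ?_
  filter_upwards [hg.ae_differentiableAt (μ := (volume : Measure E))] with y hy
  rw [hy.lineDeriv_eq_fderiv, mul_comm]

lemma fderiv_mollify_apply_of_lipschitz (n : ℕ) {g : E → ℝ} {C : NNReal} (hg : LipschitzWith C g)
    (z v : E) :
    fderiv ℝ (mollify n g) z v = mollify n (fun y => fderiv ℝ g y v) z := by
  rw [fderiv_mollify_apply n hg.continuous.locallyIntegrable, integral_fderiv_mollifier_mul n hg]
  rfl

lemma abs_fderiv_apply_le {g : E → ℝ} {C : NNReal} (hg : LipschitzWith C g) (z v : E) :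
    |fderiv ℝ g z v| ≤ C * ‖v‖ :=
  ((fderiv ℝ g z).le_opNorm v).trans
    (mul_le_mul_of_nonneg_right (norm_fderiv_le_of_lipschitz ℝ hg) (norm_nonneg v))

lemma locallyIntegrable_of_abs_le {g : E → ℝ} (hg : AEStronglyMeasurable g volume) {K : ℝ}
    (hK : ∀ z, |g z| ≤ K) : LocallyIntegrable g volume :=
  (memLp_top_of_bound hg K (Eventually.of_forall hK)).locallyIntegrable le_top

lemma locallyIntegrable_fderiv_apply {g : E → ℝ} {C : NNReal} (hg : LipschitzWith C g) (v : E) :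
    LocallyIntegrable (fun y => fderiv ℝ g y v) volume :=
  locallyIntegrable_of_abs_le (measurable_fderiv_apply_const ℝ g v).aestronglyMeasurable
    (fun z => abs_fderiv_apply_le hg z v)

/-- A function whose integrals against all nonnegative mollifiers are nonnegative is nonnegative. -/
lemma ae_nonneg_of_mollify_nonneg {Ω : Set E} (hΩ : IsOpen Ω) {g : E → ℝ}
    (hg : LocallyIntegrable g volume)
    (h : ∀ φ : E → ℝ, ContDiff ℝ ∞ φ → HasCompactSupport φ → tsupport φ ⊆ Ω → (∀ z, 0 ≤ φ z) →
      0 ≤ ∫ z, φ z * g z) : ∀ᵐ z, z ∈ Ω → 0 ≤ g z := by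
  filter_upwards [ae_tendsto_mollify hg] with z hz hzΩ
  refine ge_of_tendsto hz ?_
  obtain ⟨δ, hδ, hb⟩ := Metric.isOpen_iff.1 hΩ z hzΩ
  filter_upwards [(tendsto_bump_rOut (E := E)).eventually (gt_mem_nhds hδ)] with n hn
  refine h (fun y => mollifier n (z - y)) ?_ ?_ ?_ fun _ => mollifier_nonneg _ _
  · exact (contDiff_mollifier n).comp (contDiff_const.sub contDiff_id)
  · exact (hasCompactSupport_mollifier n).comp_homeomorph (Homeomorph.subLeft z)
  · refine subset_trans (closure_minimal ?_ Metric.isClosed_closedBall)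
      (subset_trans (Metric.closedBall_subset_ball hn) hb)
    intro y hy
    have : z - y ∈ tsupport (mollifier (E := E) n) := subset_tsupport _ hy
    rw [tsupport_mollifier, mem_closedBall_zero_iff] at this
    rwa [Metric.mem_closedBall, dist_comm, dist_eq_norm]

end Mollifier

/-! ### From smooth to Lipschitz test functions -/

lemma fderiv_eq_zero_of_notMem_tsupport {φ : ℝ × ℝ → ℝ} {K : Set (ℝ × ℝ)} (h : tsupport φ ⊆ K)
    {z : ℝ × ℝ} (hz : z ∉ K) : fderiv ℝ φ z = 0 := by
  by_contra h0
  exact hz (h (support_fderiv_subset ℝ h0))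

/-- An integral inequality tested with smooth functions extends to Lipschitz test functions. -/
theorem nonneg_of_lipschitz_test {Ω : Set (ℝ × ℝ)} (hΩ : IsOpen Ω) {A B : ℝ × ℝ → ℝ} {S : ℝ → ℝ}
    {K : ℝ} (hA : AEStronglyMeasurable A volume) (hB : AEStronglyMeasurable B volume)
    (hS : AEStronglyMeasurable S volume) (hAK : ∀ z, |A z| ≤ K) (hBK : ∀ z, |B z| ≤ K)
    (hSK : ∀ t, |S t| ≤ K)
    (h : ∀ φ : ℝ × ℝ → ℝ, ContDiff ℝ ∞ φ → HasCompactSupport φ → tsupport φ ⊆ Ω →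
      (∀ z, 0 ≤ φ z) →
      0 ≤ (∫ z, (A z * partialT φ z + B z * partialX φ z)) + ∫ t, S t * φ (t, 0))
    {φ : ℝ × ℝ → ℝ} {C : NNReal} (hφ : LipschitzWith C φ) (hc : HasCompactSupport φ)
    (hsub : tsupport φ ⊆ Ω) (h0 : ∀ z, 0 ≤ φ z) :
    0 ≤ (∫ z, (A z * partialT φ z + B z * partialX φ z)) + ∫ t, S t * φ (t, 0) := by
  obtain ⟨δ, hδ, hδΩ⟩ := hc.isCompact.exists_cthickening_subset_open hΩ hsub
  set K' := Metric.cthickening δ (tsupport φ) with hK'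
  have hK'c : IsCompact K' := hc.isCompact.cthickening
  have hn : ∀ᶠ n in atTop, (bump (ℝ × ℝ) n).rOut ≤ δ :=
    (tendsto_bump_rOut.eventually (gt_mem_nhds hδ)).mono fun n h => h.le
  have hli := hφ.continuous.locallyIntegrable (μ := (volume : Measure (ℝ × ℝ)))
  obtain ⟨M, hM⟩ := hφ.continuous.bounded_above_of_compact_support hc
  have hK0 : 0 ≤ K := (abs_nonneg _).trans (hSK 0)
  -- The gradients of the mollified test functions are mollified gradients: uniformly bounded,
  -- supported in the fixed compact `K'`, and convergent almost everywhere. Dominated convergence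
  -- applies although `A` and `B` are only bounded.
  have T1 : Tendsto (fun n => ∫ z, (A z * partialT (mollify n φ) z + B z * partialX (mollify n φ) z))
      atTop (𝓝 (∫ z, (A z * partialT φ z + B z * partialX φ z))) := by
    refine tendsto_integral_filter_of_dominated_convergence
      (K'.indicator fun _ => K * (C * ‖((1, 0) : ℝ × ℝ)‖) + K * (C * ‖((0, 1) : ℝ × ℝ)‖)) ?_ ?_ ?_ ?_
    · refine Eventually.of_forall fun n => ?_
      exact (hA.mul (measurable_fderiv_apply_const ℝ _ _).aestronglyMeasurable).add
        (hB.mul (measurable_fderiv_apply_const ℝ _ _).aestronglyMeasurable)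
    · filter_upwards [hn] with n hn
      refine Eventually.of_forall fun z => ?_
      by_cases hz : z ∈ K'
      · rw [indicator_of_mem hz]
        refine (norm_add_le _ _).trans (add_le_add ?_ ?_) <;> rw [norm_mul]
        · refine mul_le_mul (hAK z) ?_ (norm_nonneg _) hK0
          rw [partialT, fderiv_mollify_apply_of_lipschitz n hφ]
          exact abs_mollify_le n (fun z => abs_fderiv_apply_le hφ z _) z
        · refine mul_le_mul (hBK z) ?_ (norm_nonneg _) hK0
          rw [partialX, fderiv_mollify_apply_of_lipschitz n hφ]
          exact abs_mollify_le n (fun z => abs_fderiv_apply_le hφ z _) z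
      · simp [partialT, partialX, fderiv_eq_zero_of_notMem_tsupport (tsupport_mollify_subset hn) hz,
          indicator_of_notMem hz]
    · exact (integrable_indicator_iff hK'c.measurableSet).2
        (integrableOn_const (hs := hK'c.measure_lt_top.ne))
    · filter_upwards [ae_tendsto_mollify (locallyIntegrable_fderiv_apply hφ ((1, 0) : ℝ × ℝ)),
        ae_tendsto_mollify (locallyIntegrable_fderiv_apply hφ ((0, 1) : ℝ × ℝ))] with z h1 h2
      simp only [partialT, partialX, fderiv_mollify_apply_of_lipschitz _ hφ]
      exact (h1.const_mul _).add (h2.const_mul _)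
  have T2 : Tendsto (fun n => ∫ t, S t * mollify n φ (t, 0)) atTop (𝓝 (∫ t, S t * φ (t, 0))) := by
    have hfst : IsCompact (Prod.fst '' K') := hK'c.image continuous_fst
    refine tendsto_integral_filter_of_dominated_convergence
      ((Prod.fst '' K').indicator fun _ => K * M) ?_ ?_ ?_ ?_
    · refine Eventually.of_forall fun n => hS.mul ?_
      exact ((contDiff_mollify n hli).continuous.comp
        (continuous_id.prodMk continuous_const)).aestronglyMeasurable
    · filter_upwards [hn] with n hn
      refine Eventually.of_forall fun t => ?_
      by_cases ht : (t, (0 : ℝ)) ∈ K'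
      · rw [indicator_of_mem (mem_image_of_mem Prod.fst ht), norm_mul]
        exact mul_le_mul (hSK t) (abs_mollify_le n hM _) (norm_nonneg _) hK0
      · rw [mollify_eq_zero_of_notMem hn ht, mul_zero, norm_zero]
        exact indicator_nonneg (fun _ _ => mul_nonneg hK0 ((norm_nonneg _).trans (hM 0))) _
    · exact (integrable_indicator_iff hfst.measurableSet).2
        (integrableOn_const (hs := hfst.measure_lt_top.ne))
    · exact Eventually.of_forall fun t =>
        (tendsto_mollify_of_continuous hφ.continuous _).const_mul _
  refine ge_of_tendsto (T1.add T2) ?_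
  filter_upwards [hn] with n hn
  have hs := tsupport_mollify_subset (g := φ) hn
  exact h _ (contDiff_mollify n hli) (hK'c.of_isClosed_subset (isClosed_tsupport _) hs)
    (hs.trans hδΩ) (mollify_nonneg n h0)

/-! ### Kružkov fluxes and doubling of variables -/

/-- The Kružkov flux `sgn(s - k) (f(s) - f(k))`. -/
def kflux (f : ℝ → ℝ) (s k : ℝ) : ℝ := f (max s k) - f (min s k)

lemma kflux_eq_sign_mul (f : ℝ → ℝ) (s k : ℝ) :
    kflux f s k = Real.sign (s - k) * (f s - f k) := by
  rcases lt_trichotomy s k with h | h | h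
  · rw [Real.sign_of_neg (by linarith), kflux, max_eq_right h.le, min_eq_left h.le]; ring
  · simp [h, kflux]
  · rw [Real.sign_of_pos (by linarith), kflux, max_eq_left h.le, min_eq_right h.le]; ring

lemma kflux_comm (f : ℝ → ℝ) (s k : ℝ) : kflux f s k = kflux f k s := by
  simp [kflux, max_comm, min_comm]

lemma kflux_mul_sub (f : ℝ → ℝ) (s k : ℝ) : kflux f s k * (s - k) = |s - k| * (f s - f k) := by
  rcases le_total s k with h | h
  · rw [kflux, max_eq_right h, min_eq_left h, abs_of_nonpos (by linarith)]; ring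
  · rw [kflux, max_eq_left h, min_eq_right h, abs_of_nonneg (by linarith)]; ring

section Lip

variable {f : ℝ → ℝ} {L : NNReal} (hf : LipschitzWith L f)
include hf

lemma abs_kflux_le (s k : ℝ) : |kflux f s k| ≤ L * |s - k| := by
  have := hf.dist_le_mul (max s k) (min s k)
  rwa [Real.dist_eq, Real.dist_eq, max_sub_min_eq_abs', abs_abs] at this

/-- The expression through `max` and `min` hides the jump of the sign: each of the two terms is
`L`-Lipschitz in the level. -/
lemma lipschitzWith_kflux (s : ℝ) : LipschitzWith (L + L) (fun k => kflux f s k) := by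
  have h1 := hf.comp ((LipschitzWith.id (α := ℝ)).const_max s)
  have h2 := hf.comp ((LipschitzWith.id (α := ℝ)).const_min s)
  simpa [kflux] using h1.sub h2

lemma abs_kflux_sub_le (s k s' k' : ℝ) :
    |kflux f s k - kflux f s' k'| ≤ 2 * L * (|s - s'| + |k - k'|) := by
  have h1 := (lipschitzWith_kflux hf s).dist_le_mul k k'
  have h2 := (lipschitzWith_kflux hf k').dist_le_mul s s'
  simp only [Real.dist_eq, NNReal.coe_add] at h1 h2
  rw [kflux_comm f k', kflux_comm f k'] at h2
  have := abs_sub_le (kflux f s k) (kflux f s k') (kflux f s' k')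
  linarith

lemma continuous_kflux : Continuous fun p : ℝ × ℝ => kflux f p.1 p.2 :=
  (hf.continuous.comp (continuous_fst.max continuous_snd)).sub
    (hf.continuous.comp (continuous_fst.min continuous_snd))

end Lip

/-- Kružkov's entropy inequalities with levels in `[a, b]` on the open set `Ω`. -/
def KruzkovOn (Ω : Set (ℝ × ℝ)) (f : ℝ → ℝ) (a b : ℝ) (u : ℝ × ℝ → ℝ) : Prop :=
  ∀ k ∈ Icc a b, ∀ φ : ℝ × ℝ → ℝ, ContDiff ℝ ∞ φ → HasCompactSupport φ → tsupport φ ⊆ Ω →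
    (∀ z, 0 ≤ φ z) → 0 ≤ ∫ z, (|u z - k| * partialT φ z + kflux f (u z) k * partialX φ z)

lemma integrable_mollifier_mul {E : Type*} [NormedAddCommGroup E] [NormedSpace ℝ E]
    [HasContDiffBump E] [FiniteDimensional ℝ E] [MeasureSpace E] [BorelSpace E]
    [(volume : Measure E).IsAddHaarMeasure] (n : ℕ) (z : E) {g : E → ℝ}
    (hg : LocallyIntegrable g volume) : Integrable (fun y => mollifier n (z - y) * g y) :=
  hg.integrable_smul_left_of_hasCompactSupport
    ((continuous_mollifier n).comp (continuous_const.sub continuous_id))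
    ((hasCompactSupport_mollifier n).comp_homeomorph (Homeomorph.subLeft z))

lemma abs_le_of_mem_Icc {a b s : ℝ} (h : s ∈ Icc a b) : |s| ≤ max |a| |b| :=
  abs_le_max_abs_abs h.1 h.2

lemma abs_sub_le_of_mem_Icc {a b s k : ℝ} (h : s ∈ Icc a b) (h' : k ∈ Icc a b) :
    |s - k| ≤ b - a := by
  rw [abs_le]; constructor <;> linarith [h.1, h.2, h'.1, h'.2]

lemma locallyIntegrable_of_mem_Icc {E : Type*} [NormedAddCommGroup E] [NormedSpace ℝ E]
    [FiniteDimensional ℝ E] [MeasureSpace E] [BorelSpace E]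
    [(volume : Measure E).IsAddHaarMeasure] {v : E → ℝ} {a b : ℝ} (hv : Measurable v)
    (hvab : ∀ z, v z ∈ Icc a b) : LocallyIntegrable v volume :=
  (memLp_top_of_bound hv.aestronglyMeasurable (max |a| |b|)
    (Eventually.of_forall fun z => abs_le_of_mem_Icc (hvab z))).locallyIntegrable le_top

/-- The null set does not depend on `h`. This matters in the doubling argument, where `h` is the
entropy or its flux with the level `u z` frozen and so changes with the point. A Lebesgue point of
`v` serves all Lipschitz `h` at once. -/
lemma ae_tendsto_integral_mollifier_mul_comp {v : ℝ × ℝ → ℝ} {a b : ℝ} (hv : Measurable v)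
    (hvab : ∀ z, v z ∈ Icc a b) :
    ∀ᵐ z, ∀ (h : ℝ → ℝ) (M : NNReal), LipschitzWith M h →
      Tendsto (fun n => ∫ y, mollifier n (z - y) * h (v y)) atTop (𝓝 (h (v z))) := by
  have hvl := locallyIntegrable_of_mem_Icc hv hvab
  filter_upwards [ae_tendsto_integral_mollifier_mul_abs_sub hvl] with z hz h M hh
  rw [tendsto_iff_dist_tendsto_zero]
  refine squeeze_zero (fun _ => dist_nonneg) (fun n => ?_) (by simpa using hz.const_mul (M : ℝ))
  have hhv : Measurable fun y => h (v y) := hh.continuous.measurable.comp hv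
  obtain ⟨B, hB⟩ := isCompact_Icc.exists_bound_of_continuousOn
    (hh.continuous.continuousOn (s := Icc a b))
  have hl : LocallyIntegrable (fun y => h (v y)) volume :=
    locallyIntegrable_of_abs_le hhv.aestronglyMeasurable fun y => hB _ (hvab y)
  have hl2 : LocallyIntegrable (fun y => |v y - v z|) volume :=
    fun x => ((hvl.sub (locallyIntegrable_const (v z))) x).norm
  have e : (∫ y, mollifier n (z - y) * h (v y)) - h (v z) =
      ∫ y, (mollifier n (z - y) * h (v y) - mollifier n (z - y) * h (v z)) := by
    rw [integral_sub (integrable_mollifier_mul n z hl)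
      ((integrable_mollifier_sub n z).mul_const _), integral_mul_const, integral_mollifier_sub,
      one_mul]
  rw [Real.dist_eq, e, ← integral_const_mul, ← Real.norm_eq_abs]
  refine norm_integral_le_of_norm_le ((integrable_mollifier_mul n z hl2).const_mul _)
    (Eventually.of_forall fun y => ?_)
  have := hh.dist_le_mul (v y) (v z)
  simp only [Real.dist_eq] at this
  rw [← mul_sub, norm_mul, Real.norm_of_nonneg (mollifier_nonneg _ _), Real.norm_eq_abs]
  nlinarith [mollifier_nonneg n (z - y)]

lemma integrable_bounded_mul_of_compactSupport {E : Type*} [TopologicalSpace E] [MeasureSpace E]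
    [OpensMeasurableSpace E] [T2Space E] [SecondCountableTopology E]
    [IsFiniteMeasureOnCompacts (volume : Measure E)]
    {F c : E → ℝ} {M : ℝ} (hF : Measurable F) (hFM : ∀ z, |F z| ≤ M) (hc : Continuous c)
    (hcs : HasCompactSupport c) : Integrable (fun z => F z * c z) :=
  (hc.integrable_of_hasCompactSupport hcs).bdd_mul hF.aestronglyMeasurable
    (Eventually.of_forall hFM)

lemma hasCompactSupport_fderiv_apply {φ : ℝ × ℝ → ℝ} (hc : HasCompactSupport φ) (v : ℝ × ℝ) :
    HasCompactSupport fun z => fderiv ℝ φ z v :=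
  hc.fderiv_apply (𝕜 := ℝ) v

lemma continuous_fderiv_apply_const {φ : ℝ × ℝ → ℝ} (hφ : ContDiff ℝ ∞ φ) (v : ℝ × ℝ) :
    Continuous fun z => fderiv ℝ φ z v :=
  (hφ.continuous_fderiv (by simp)).clm_apply continuous_const

lemma hasCompactSupport_prod_kernel {c₁ c₂ : ℝ × ℝ → ℝ} (h₁ : HasCompactSupport c₁)
    (h₂ : HasCompactSupport c₂) :
    HasCompactSupport fun p : (ℝ × ℝ) × (ℝ × ℝ) => c₁ p.1 * c₂ (p.1 - p.2) := by
  refine HasCompactSupport.intro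
    (K := (fun q : (ℝ × ℝ) × (ℝ × ℝ) => (q.1, q.1 - q.2)) '' (tsupport c₁ ×ˢ tsupport c₂)) ?_ ?_
  · exact (h₁.isCompact.prod h₂.isCompact).image
      (continuous_fst.prodMk (continuous_fst.sub continuous_snd))
  · intro p hp
    by_contra h
    refine hp ⟨(p.1, p.1 - p.2), ⟨subset_tsupport _ (left_ne_zero_of_mul h),
      subset_tsupport _ (right_ne_zero_of_mul h)⟩, by simp⟩

lemma fderiv_mul_apply_eq {φ ψ : ℝ × ℝ → ℝ} {z : ℝ × ℝ} (hφ : DifferentiableAt ℝ φ z)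
    (hψ : DifferentiableAt ℝ ψ z) (v : ℝ × ℝ) :
    fderiv ℝ (fun z => φ z * ψ z) z v = φ z * fderiv ℝ ψ z v + fderiv ℝ φ z v * ψ z := by
  have h := (hφ.hasFDerivAt.mul hψ.hasFDerivAt).fderiv
  have h' : fderiv ℝ (fun z => φ z * ψ z) z = φ z • fderiv ℝ ψ z + ψ z • fderiv ℝ φ z := h
  rw [h']
  simp [mul_comm]

lemma fderiv_comp_const_sub_apply {φ : ℝ × ℝ → ℝ} {z y : ℝ × ℝ} 
    (hφ : DifferentiableAt ℝ φ (z - y)) (v : ℝ × ℝ) :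
    fderiv ℝ (fun y => φ (z - y)) y v = -fderiv ℝ φ (z - y) v := by
  have h := (hφ.hasFDerivAt.comp y ((hasFDerivAt_id y).const_sub z)).fderiv
  have h' : fderiv ℝ (fun y => φ (z - y)) y =
    (fderiv ℝ φ (z - y)).comp (-ContinuousLinearMap.id ℝ (ℝ × ℝ)) := h
  rw [h']
  simp

/-- The doubled test function is `ψ(z) J(z - y)`. Use the inequality for `u` in `z` with level `v
y`, and the one for `v` in `y` with level `u z`. As `J` depends on `z - y` only, the terms
containing derivatives of `J` cancel in the sum, and only derivatives of `ψ` remain. -/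
lemma kato_mollified {Ω : Set (ℝ × ℝ)} {f : ℝ → ℝ} {L : NNReal}
    (hf : LipschitzWith L f) {a b : ℝ} {u v : ℝ × ℝ → ℝ} (hu : Measurable u) (hv : Measurable v)
    (huab : ∀ z, u z ∈ Icc a b) (hvab : ∀ z, v z ∈ Icc a b)
    (hKu : KruzkovOn Ω f a b u) (hKv : KruzkovOn Ω f a b v)
    {ψ : ℝ × ℝ → ℝ} (hψ : ContDiff ℝ ∞ ψ) (hψc : HasCompactSupport ψ) {δ : ℝ} (hδΩ : Metric.cthickening δ (tsupport ψ) ⊆ Ω)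
    {n : ℕ} (hn : (bump (ℝ × ℝ) n).rOut ≤ δ)
    (hψ0 : ∀ z, 0 ≤ ψ z) :
    0 ≤ ∫ z, ((∫ y, mollifier n (z - y) * |u z - v y|) * partialT ψ z +
      (∫ y, mollifier n (z - y) * kflux f (u z) (v y)) * partialX ψ z) := by
  set Φ₁ : (ℝ × ℝ) × (ℝ × ℝ) → ℝ := fun p => |u p.1 - v p.2| with hΦ₁
  set Φ₂ : (ℝ × ℝ) × (ℝ × ℝ) → ℝ := fun p => kflux f (u p.1) (v p.2) with hΦ₂
  have mu : Measurable fun p : (ℝ × ℝ) × (ℝ × ℝ) => u p.1 := hu.comp measurable_fst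
  have mv : Measurable fun p : (ℝ × ℝ) × (ℝ × ℝ) => v p.2 := hv.comp measurable_snd
  have mΦ₁ : Measurable Φ₁ := (mu.sub mv).abs
  have mΦ₂ : Measurable Φ₂ := (continuous_kflux hf).measurable.comp (mu.prodMk mv)
  have bΦ₁ : ∀ p, |Φ₁ p| ≤ b - a := fun p => by
    rw [hΦ₁, abs_abs]; exact abs_sub_le_of_mem_Icc (huab _) (hvab _)
  have bΦ₂ : ∀ p, |Φ₂ p| ≤ L * (b - a) := fun p =>
    (abs_kflux_le hf _ _).trans
      (mul_le_mul_of_nonneg_left (abs_sub_le_of_mem_Icc (huab _) (hvab _)) L.2)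
  have hψT : Continuous (partialT ψ) := continuous_fderiv_apply_const hψ _
  have hψX : Continuous (partialX ψ) := continuous_fderiv_apply_const hψ _
  have hψTc : HasCompactSupport (partialT ψ) := hasCompactSupport_fderiv_apply hψc _
  have hψXc : HasCompactSupport (partialX ψ) := hasCompactSupport_fderiv_apply hψc _
  have hψs : tsupport ψ ⊆ Ω := (Metric.self_subset_cthickening _).trans hδΩ
  set J : ℝ × ℝ → ℝ := mollifier n with hJ
  have cJ : ContDiff ℝ ∞ J := contDiff_mollifier n
  have sJ : HasCompactSupport J := hasCompactSupport_mollifier n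
  have cJT : Continuous (partialT J) := continuous_fderiv_apply_const cJ _
  have cJX : Continuous (partialX J) := continuous_fderiv_apply_const cJ _
  have sJT : HasCompactSupport (partialT J) := hasCompactSupport_fderiv_apply sJ _
  have sJX : HasCompactSupport (partialX J) := hasCompactSupport_fderiv_apply sJ _
  have hker : ∀ {c₁ c₂ : ℝ × ℝ → ℝ}, Continuous c₁ → Continuous c₂ →
      Continuous fun p : (ℝ × ℝ) × (ℝ × ℝ) => c₁ p.1 * c₂ (p.1 - p.2) := fun h₁ h₂ =>
    (h₁.comp continuous_fst).mul (h₂.comp (continuous_fst.sub continuous_snd))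
  have i1 := integrable_bounded_mul_of_compactSupport mΦ₁ bΦ₁ (hker hψT cJ.continuous)
    (hasCompactSupport_prod_kernel hψTc sJ)
  have i2 := integrable_bounded_mul_of_compactSupport mΦ₁ bΦ₁ (hker hψ.continuous cJT)
    (hasCompactSupport_prod_kernel hψc sJT)
  have i3 := integrable_bounded_mul_of_compactSupport mΦ₂ bΦ₂ (hker hψX cJ.continuous)
    (hasCompactSupport_prod_kernel hψXc sJ)
  have i4 := integrable_bounded_mul_of_compactSupport mΦ₂ bΦ₂ (hker hψ.continuous cJX)
    (hasCompactSupport_prod_kernel hψc sJX)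
  have I1 : ∀ y, 0 ≤ ∫ z, ((Φ₁ (z, y) * (partialT ψ z * J (z - y)) +
      Φ₁ (z, y) * (ψ z * partialT J (z - y))) +
      (Φ₂ (z, y) * (partialX ψ z * J (z - y)) +
      Φ₂ (z, y) * (ψ z * partialX J (z - y)))) := by
    intro y
    have cJy : ContDiff ℝ ∞ fun z => J (z - y) := cJ.comp (contDiff_id.sub contDiff_const)
    have := hKu (v y) (hvab y) (fun z => ψ z * J (z - y)) (hψ.mul cJy)
      hψc.mul_right ((tsupport_mul_subset_left).trans hψs)
      (fun z => mul_nonneg (hψ0 z) (mollifier_nonneg _ _))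
    convert this using 3 with z
    have hψd := (hψ.differentiable (by simp)) z
    have hJd := (cJy.differentiable (by simp)) z
    simp only [partialT, partialX, fderiv_mul_apply_eq hψd hJd, fderiv_comp_sub, hΦ₁, hΦ₂]
    ring
  have I2 : ∀ z, 0 ≤ ∫ y, -(Φ₁ (z, y) * (ψ z * partialT J (z - y)) +
      Φ₂ (z, y) * (ψ z * partialX J (z - y))) := by
    intro z
    -- In `y` the test function lives in the ball of radius at most `δ` about `z`; this ball lies in
    -- `Ω` because `z` belongs to the support of `ψ`.
    by_cases hz : z ∈ tsupport ψ
    swap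
    · simp [image_eq_zero_of_notMem_tsupport hz]
    have cJz : ContDiff ℝ ∞ fun y => J (z - y) := cJ.comp (contDiff_const.sub contDiff_id)
    have := hKv (u z) (huab z) (fun y => ψ z * J (z - y)) (contDiff_const.mul cJz)
      (HasCompactSupport.mul_left (sJ.comp_homeomorph (Homeomorph.subLeft z))) ?_
      (fun y => mul_nonneg (hψ0 z) (mollifier_nonneg _ _))
    · convert this using 3 with y
      have hJd := (cJz.differentiable (by simp)) y
      have hJd' := (cJ.differentiable (by simp)) (z - y)
      simp only [partialT, partialX, fderiv_mul_apply_eq (differentiableAt_const (ψ z)) hJd,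
        fderiv_comp_const_sub_apply hJd', hΦ₁, hΦ₂, fderiv_fun_const, Pi.zero_apply, zero_apply]
      rw [abs_sub_comm, kflux_comm]
      ring
    · refine (closure_minimal ?_ Metric.isClosed_closedBall).trans
        ((Metric.closedBall_subset_cthickening hz δ).trans hδΩ)
      intro y hy
      have : z - y ∈ tsupport J := subset_tsupport _ (right_ne_zero_of_mul hy)
      rw [hJ, tsupport_mollifier, mem_closedBall_zero_iff] at this
      rw [Metric.mem_closedBall, dist_comm, dist_eq_norm]
      exact this.trans hn
  have iA := (i1.add i2).add (i3.add i4)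
  have iB := (i2.add i4).neg
  have s1 := integral_prod_symm _ iA
  have s2 := integral_prod _ iB
  have s3 := integral_prod _ (i1.add i3)
  have e : (∫ z, ((∫ y, mollifier n (z - y) * |u z - v y|) * partialT ψ z +
      (∫ y, mollifier n (z - y) * kflux f (u z) (v y)) * partialX ψ z)) =
      (∫ p, ((fun p => Φ₁ p * (partialT ψ p.1 * J (p.1 - p.2))) +
        fun p => Φ₂ p * (partialX ψ p.1 * J (p.1 - p.2))) p) := by
    refine Eq.trans ?_ s3.symm
    refine integral_congr_ae ?_
    filter_upwards [i1.prod_right_ae, i3.prod_right_ae] with z h1 h3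
    simp only [Pi.add_apply]
    rw [integral_add h1 h3, ← integral_mul_const, ← integral_mul_const]
    congr 1 <;>
    · refine integral_congr_ae (Eventually.of_forall fun y => ?_)
      simp only [hΦ₁, hΦ₂, hJ, partialT, partialX]
      ring
  -- The terms with derivatives of `J` are added and subtracted, so that the integral splits into
  -- the two nonnegative pieces `I1` and `I2`.
  have e2 : (∫ p, ((fun p => Φ₁ p * (partialT ψ p.1 * J (p.1 - p.2))) +
        fun p => Φ₂ p * (partialX ψ p.1 * J (p.1 - p.2))) p) =
        (∫ p, (((fun p => Φ₁ p * (partialT ψ p.1 * J (p.1 - p.2))) +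
          fun p => Φ₁ p * (ψ p.1 * partialT J (p.1 - p.2))) +
          ((fun p => Φ₂ p * (partialX ψ p.1 * J (p.1 - p.2))) +
          fun p => Φ₂ p * (ψ p.1 * partialX J (p.1 - p.2)))) p) +
        ∫ p, (-((fun p => Φ₁ p * (ψ p.1 * partialT J (p.1 - p.2))) +
          fun p => Φ₂ p * (ψ p.1 * partialX J (p.1 - p.2)))) p := by
    rw [← integral_add iA iB]
    refine integral_congr_ae (Eventually.of_forall fun p => ?_)
    simp only [Pi.add_apply, Pi.neg_apply]
    ring
  rw [e, e2]
  refine add_nonneg ?_ ?_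
  · exact s1.symm ▸ integral_nonneg fun y => I1 y
  · exact s2.symm ▸ integral_nonneg fun z => I2 z

/-- Kato's inequality, by doubling of variables. -/
theorem kato_of_kruzkovOn {Ω : Set (ℝ × ℝ)} (hΩ : IsOpen Ω) {f : ℝ → ℝ} {L : NNReal}
    (hf : LipschitzWith L f) {a b : ℝ} {u v : ℝ × ℝ → ℝ} (hu : Measurable u) (hv : Measurable v)
    (huab : ∀ z, u z ∈ Icc a b) (hvab : ∀ z, v z ∈ Icc a b)
    (hKu : KruzkovOn Ω f a b u) (hKv : KruzkovOn Ω f a b v)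
    {ψ : ℝ × ℝ → ℝ} (hψ : ContDiff ℝ ∞ ψ) (hψc : HasCompactSupport ψ) (hψs : tsupport ψ ⊆ Ω)
    (hψ0 : ∀ z, 0 ≤ ψ z) :
    0 ≤ ∫ z, (|u z - v z| * partialT ψ z + kflux f (u z) (v z) * partialX ψ z) := by
  obtain ⟨δ, hδ, hδΩ⟩ := hψc.isCompact.exists_cthickening_subset_open hΩ hψs
  have hn : ∀ᶠ n in atTop, (bump (ℝ × ℝ) n).rOut ≤ δ :=
    (tendsto_bump_rOut.eventually (gt_mem_nhds hδ)).mono fun n h => h.le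
  set Φ₁ : (ℝ × ℝ) × (ℝ × ℝ) → ℝ := fun p => |u p.1 - v p.2| with hΦ₁
  set Φ₂ : (ℝ × ℝ) × (ℝ × ℝ) → ℝ := fun p => kflux f (u p.1) (v p.2) with hΦ₂
  have mu : Measurable fun p : (ℝ × ℝ) × (ℝ × ℝ) => u p.1 := hu.comp measurable_fst
  have mv : Measurable fun p : (ℝ × ℝ) × (ℝ × ℝ) => v p.2 := hv.comp measurable_snd
  have mΦ₁ : Measurable Φ₁ := (mu.sub mv).abs
  have mΦ₂ : Measurable Φ₂ := (continuous_kflux hf).measurable.comp (mu.prodMk mv)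
  have bΦ₁ : ∀ p, |Φ₁ p| ≤ b - a := fun p => by
    rw [hΦ₁, abs_abs]; exact abs_sub_le_of_mem_Icc (huab _) (hvab _)
  have bΦ₂ : ∀ p, |Φ₂ p| ≤ L * (b - a) := fun p =>
    (abs_kflux_le hf _ _).trans
      (mul_le_mul_of_nonneg_left (abs_sub_le_of_mem_Icc (huab _) (hvab _)) L.2)
  have hψT : Continuous (partialT ψ) := continuous_fderiv_apply_const hψ _
  have hψX : Continuous (partialX ψ) := continuous_fderiv_apply_const hψ _
  have hψTc : HasCompactSupport (partialT ψ) := hasCompactSupport_fderiv_apply hψc _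
  have hψXc : HasCompactSupport (partialX ψ) := hasCompactSupport_fderiv_apply hψc _
  refine ge_of_tendsto (f := fun n => ∫ z, ((∫ y, mollifier n (z - y) * |u z - v y|) *
    partialT ψ z + (∫ y, mollifier n (z - y) * kflux f (u z) (v y)) * partialX ψ z)) ?_
    (hn.mono fun n hn => kato_mollified hf hu hv huab hvab hKu hKv hψ hψc hδΩ hn hψ0)
  refine tendsto_integral_of_dominated_convergence
    (fun z => (b - a) * ‖partialT ψ z‖ + L * (b - a) * ‖partialX ψ z‖) ?_ ?_ ?_ ?_
  · intro n
    have mJ : Measurable fun p : (ℝ × ℝ) × (ℝ × ℝ) => mollifier n (p.1 - p.2) :=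
      ((continuous_mollifier n).comp (continuous_fst.sub continuous_snd)).measurable
    refine AEStronglyMeasurable.add (AEStronglyMeasurable.mul ?_ hψT.aestronglyMeasurable)
      (AEStronglyMeasurable.mul ?_ hψX.aestronglyMeasurable)
    · exact (mJ.mul mΦ₁).stronglyMeasurable.integral_prod_right.aestronglyMeasurable
    · exact (mJ.mul mΦ₂).stronglyMeasurable.integral_prod_right.aestronglyMeasurable
  · exact ((hψT.integrable_of_hasCompactSupport hψTc).norm.const_mul _).add
      ((hψX.integrable_of_hasCompactSupport hψXc).norm.const_mul _)
  · intro n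
    refine Eventually.of_forall fun z => ?_
    refine (norm_add_le _ _).trans (add_le_add ?_ ?_) <;> rw [norm_mul] <;>
      refine mul_le_mul_of_nonneg_right ?_ (norm_nonneg _)
    · exact abs_mollify_le n (g := fun y => |u z - v y|) (fun y => bΦ₁ (z, y)) z
    · exact abs_mollify_le n (g := fun y => kflux f (u z) (v y)) (fun y => bΦ₂ (z, y)) z
  · filter_upwards [ae_tendsto_integral_mollifier_mul_comp hv hvab] with z hz
    refine ((hz (fun k => |u z - k|) 1 ?_).mul_const _).add
      ((hz _ _ (lipschitzWith_kflux hf (u z))).mul_const _)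
    refine LipschitzWith.of_dist_le_mul fun x y => ?_
    simp only [Real.dist_eq, NNReal.coe_one, one_mul]
    refine (abs_abs_sub_abs_le_abs_sub _ _).trans ?_
    rw [sub_sub_sub_cancel_left, abs_sub_comm]

/-! ### Lipschitz cut-offs at the interface -/

/-- A locally Lipschitz function with compact support is Lipschitz. -/
lemma exists_lipschitzWith_of_hasCompactSupport {E : Type*} [NormedAddCommGroup E] [ProperSpace E]
    {φ : E → ℝ} (hφ : LocallyLipschitz φ) (hc : HasCompactSupport φ) :
    ∃ C, LipschitzWith C φ := by
  obtain ⟨M, hM⟩ := hφ.continuous.bounded_above_of_compact_support hc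
  set B := Metric.cthickening 1 (tsupport φ)
  have hB : IsCompact B := hc.isCompact.cthickening
  obtain ⟨C, hC⟩ := LocallyLipschitzOn.exists_lipschitzOnWith_of_compact hB
    (hφ.locallyLipschitzOn (s := B))
  -- Within distance one of the support the constant on the compact neighbourhood works. Farther
  -- away `φ y = 0` and `dist x y ≥ 1`, so the supremum of `|φ|` serves as a constant.
  have key : ∀ x ∈ tsupport φ, ∀ y, dist (φ x) (φ y) ≤ max C M.toNNReal * dist x y := by
    intro x hx y
    by_cases hy : y ∈ B
    · refine (hC.dist_le_mul x (Metric.self_subset_cthickening _ hx) y hy).trans ?_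
      exact mul_le_mul_of_nonneg_right (by exact_mod_cast le_max_left _ _) dist_nonneg
    · have h1 : 1 ≤ dist x y := by
        by_contra h
        exact hy (Metric.mem_cthickening_of_dist_le y x 1 _ hx (by rw [dist_comm]; linarith))
      have h2 : φ y = 0 := image_eq_zero_of_notMem_tsupport fun h =>
        hy (Metric.self_subset_cthickening _ h)
      rw [h2, dist_zero_right]
      calc ‖φ x‖ ≤ M := hM x
        _ ≤ M.toNNReal := Real.le_coe_toNNReal M
        _ ≤ (max C M.toNNReal : NNReal) * 1 := by
          rw [mul_one]; exact_mod_cast le_max_right _ _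
        _ ≤ _ := mul_le_mul_of_nonneg_left h1 (NNReal.coe_nonneg _)
  refine ⟨max C M.toNNReal, LipschitzWith.of_dist_le_mul fun x y => ?_⟩
  by_cases hx : x ∈ tsupport φ
  · exact key x hx y
  by_cases hy : y ∈ tsupport φ
  · rw [dist_comm, dist_comm x]; exact key y hy x
  · rw [image_eq_zero_of_notMem_tsupport hx, image_eq_zero_of_notMem_tsupport hy, dist_self]
    positivity

lemma locallyLipschitz_mul {E : Type*} [PseudoEMetricSpace E] {φ ψ : E → ℝ}
    (hφ : LocallyLipschitz φ) (hψ : LocallyLipschitz ψ) : LocallyLipschitz fun z => φ z * ψ z := by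
  have h : LocallyLipschitz fun p : ℝ × ℝ => p.1 * p.2 :=
    (contDiff_fst.mul contDiff_snd : ContDiff ℝ 1 fun p : ℝ × ℝ => p.1 * p.2).locallyLipschitz
  exact h.comp (hφ.prodMk hψ)

lemma exists_lipschitzWith_mul {φ ψ : ℝ × ℝ → ℝ} (hφ : LocallyLipschitz φ)
    (hψ : LocallyLipschitz ψ) (hc : HasCompactSupport φ) :
    ∃ C, LipschitzWith C fun z => φ z * ψ z :=
  exists_lipschitzWith_of_hasCompactSupport (locallyLipschitz_mul hφ hψ) hc.mul_right

/-- Cut-off in space: `0` for `σ x ≤ h` and `1` for `σ x ≥ 2h`. -/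
noncomputable def cut (σ h : ℝ) (z : ℝ × ℝ) : ℝ := max 0 (min 1 (σ * z.2 / h - 1))

lemma cut_nonneg (σ h : ℝ) (z : ℝ × ℝ) : 0 ≤ cut σ h z := le_max_left _ _

lemma cut_le_one (σ h : ℝ) (z : ℝ × ℝ) : cut σ h z ≤ 1 := max_le zero_le_one (min_le_left _ _)

lemma cut_eq_zero {σ h : ℝ} (hh : 0 < h) {z : ℝ × ℝ} (hz : σ * z.2 ≤ h) : cut σ h z = 0 := by
  have : σ * z.2 / h ≤ 1 := (div_le_one hh).2 hz
  exact max_eq_left ((min_le_right _ _).trans (by linarith))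

lemma cut_eq_one {σ h : ℝ} (hh : 0 < h) {z : ℝ × ℝ} (hz : 2 * h ≤ σ * z.2) : cut σ h z = 1 := by
  have : 2 ≤ σ * z.2 / h := (le_div_iff₀ hh).2 hz
  rw [cut, min_eq_left (by linarith), max_eq_right zero_le_one]

lemma cut_eq_of_mem {σ h : ℝ} (hh : 0 < h) {z : ℝ × ℝ} (hz : h ≤ σ * z.2)
    (hz' : σ * z.2 ≤ 2 * h) : cut σ h z = σ * z.2 / h - 1 := by
  have h1 : 1 ≤ σ * z.2 / h := (le_div_iff₀ hh).2 (by linarith)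
  have h2 : σ * z.2 / h ≤ 2 := (div_le_iff₀ hh).2 hz'
  rw [cut, min_eq_right (by linarith), max_eq_right (by linarith)]

lemma locallyLipschitz_cut (σ h : ℝ) : LocallyLipschitz (cut σ h) := by
  have : LocallyLipschitz fun z : ℝ × ℝ => σ * z.2 / h - 1 :=
    (((contDiff_const.mul contDiff_snd).div_const h).sub contDiff_const :
      ContDiff ℝ 1 fun z : ℝ × ℝ => σ * z.2 / h - 1).locallyLipschitz
  exact ((LocallyLipschitz.const 1).min this).const_max 0

/-- The strip `h < σ x < 2h`. -/
def strip (σ h : ℝ) : Set (ℝ × ℝ) := {z | h < σ * z.2 ∧ σ * z.2 < 2 * h}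

lemma isOpen_strip (σ h : ℝ) : IsOpen (strip σ h) :=
  have hcont : Continuous fun z : ℝ × ℝ => σ * z.2 := by fun_prop
  (isOpen_lt continuous_const hcont).inter (isOpen_lt hcont continuous_const)

lemma hasFDerivAt_cut {σ h : ℝ} (hh : 0 < h) {z : ℝ × ℝ} (h1 : σ * z.2 ≠ h)
    (h2 : σ * z.2 ≠ 2 * h) :
    HasFDerivAt (cut σ h)
      ((strip σ h).indicator (fun _ => σ / h) z • ContinuousLinearMap.snd ℝ ℝ ℝ) z := by
  have hcont : Continuous fun z : ℝ × ℝ => σ * z.2 := by fun_prop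
  rcases lt_or_gt_of_ne h1 with h1 | h1
  · rw [indicator_of_notMem (fun h => h1.not_gt h.1), zero_smul]
    refine (hasFDerivAt_const (0 : ℝ) z).congr_of_eventuallyEq ?_
    filter_upwards [(isOpen_lt hcont continuous_const).mem_nhds h1] with y hy
    exact cut_eq_zero hh (le_of_lt hy)
  rcases lt_or_gt_of_ne h2 with h2 | h2
  · rw [indicator_of_mem (show z ∈ strip σ h from ⟨h1, h2⟩)]
    have : HasFDerivAt (fun z : ℝ × ℝ => σ / h * z.2 - 1) ((σ / h) • ContinuousLinearMap.snd ℝ ℝ ℝ)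
      z := (hasFDerivAt_snd.const_mul (σ / h)).sub_const 1
    refine this.congr_of_eventuallyEq ?_
    filter_upwards [(isOpen_strip σ h).mem_nhds ⟨h1, h2⟩] with y hy
    rw [cut_eq_of_mem hh hy.1.le hy.2.le]; ring
  · rw [indicator_of_notMem (fun h => h2.not_gt h.2), zero_smul]
    refine (hasFDerivAt_const (1 : ℝ) z).congr_of_eventuallyEq ?_
    filter_upwards [(isOpen_lt continuous_const hcont).mem_nhds h2] with y hy
    exact cut_eq_one hh (le_of_lt hy)

lemma ae_snd_mul_ne {σ : ℝ} (hσ : σ ≠ 0) (c : ℝ) : ∀ᵐ z : ℝ × ℝ, σ * z.2 ≠ c := by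
  have h : ∀ᵐ x : ℝ, x ≠ c / σ := by simp [ae_iff, measure_singleton]
  have := (Measure.quasiMeasurePreserving_snd (μ := (volume : Measure ℝ))
    (ν := (volume : Measure ℝ))).ae h
  filter_upwards [this] with z hz h'
  exact hz (by field_simp; linarith)

/-! ### One-sided traces and averages over thin strips -/

/-- Points approaching `0` from the side `σ x > 0`, up to null sets. -/
noncomputable def side (σ : ℝ) : Filter ℝ := 𝓝[{x | 0 < σ * x}] 0 ⊓ ae volume

/-- `P₀` is the trace of `P` from the side `σ x > 0` in the `L¹_loc` sense. -/
def TraceAt (σ : ℝ) (P : ℝ × ℝ → ℝ) (P₀ : ℝ → ℝ) : Prop :=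
  ∀ θ : ℝ → ℝ, Continuous θ → HasCompactSupport θ → tsupport θ ⊆ Ioi 0 → (∀ t, 0 ≤ θ t) →
    Tendsto (fun x => ∫ t, |P (t, x) - P₀ t| * θ t) (side σ) (𝓝 0)

/-- Traces are tested with weights depending on time only; this provides such a weight above a given
test function of `(t, x)`. -/
lemma exists_dominating {φ : ℝ × ℝ → ℝ} (hφ : Continuous φ) (hc : HasCompactSupport φ)
    (hs : tsupport φ ⊆ halfPlane) : ∃ θ : ℝ → ℝ, Continuous θ ∧ HasCompactSupport θ ∧
      tsupport θ ⊆ Ioi 0 ∧ (∀ t, 0 ≤ θ t) ∧ ∀ t x, |φ (t, x)| ≤ θ t := by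
  obtain ⟨M, hM⟩ := hφ.bounded_above_of_compact_support hc
  have hM0 : 0 ≤ M := (norm_nonneg _).trans (hM 0)
  obtain ⟨θ, h1, h2, h3, h4⟩ := exists_continuousMap_one_of_isCompact_subset_isOpen
    (hc.isCompact.image continuous_fst) (isOpen_Ioi (a := (0 : ℝ)))
    (by rintro _ ⟨z, hz, rfl⟩; exact (hs hz).1)
  have hcθ : HasCompactSupport θ := h2
  refine ⟨fun t => M * θ t, continuous_const.mul θ.continuous, hcθ.mul_left,
    (tsupport_mul_subset_right).trans h3, fun t => mul_nonneg hM0 (h4 t).1, fun t x => ?_⟩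
  by_cases h : (t, x) ∈ tsupport φ
  · have : θ t = 1 := h1 (mem_image_of_mem Prod.fst h)
    simpa only [this, mul_one, Real.norm_eq_abs] using hM (t, x)
  · rw [image_eq_zero_of_notMem_tsupport h, abs_zero]
    exact mul_nonneg hM0 (h4 t).1

/-- The section at `x` of the strip `h < σ x < 2h`. -/
def stripX (σ h : ℝ) : Set ℝ := {x | h < σ * x ∧ σ * x < 2 * h}

lemma stripX_eq {σ : ℝ} (hσ : σ = 1 ∨ σ = -1) (h : ℝ) :
    stripX σ h = Ioo h (2 * h) ∨ stripX σ h = Ioo (-(2 * h)) (-h) := by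
  rcases hσ with rfl | rfl
  · left; ext x; simp [stripX]
  · right; ext x; simp only [stripX, mem_ofPred_eq, mem_Ioo]
    constructor <;> rintro ⟨h1, h2⟩ <;> constructor <;> linarith

lemma measurableSet_stripX {σ : ℝ} (hσ : σ = 1 ∨ σ = -1) (h : ℝ) : MeasurableSet (stripX σ h) := by
  rcases stripX_eq hσ h with e | e <;> rw [e] <;> exact measurableSet_Ioo

lemma volume_stripX {σ : ℝ} (hσ : σ = 1 ∨ σ = -1) (h : ℝ) :
    volume (stripX σ h) = ENNReal.ofReal h := by
  rcases stripX_eq hσ h with e | e <;> rw [e, Real.volume_Ioo] <;> congr 1 <;> ring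

lemma integrable_slice {φ : ℝ × ℝ → ℝ} (hφ : Continuous φ) {θ : ℝ → ℝ} (hθ : Continuous θ)
    (hθc : HasCompactSupport θ) (hd : ∀ t x, |φ (t, x)| ≤ θ t) (x : ℝ) :
    Integrable fun t => φ (t, x) :=
  (hθ.integrable_of_hasCompactSupport hθc).mono'
    (hφ.comp (continuous_id.prodMk continuous_const)).aestronglyMeasurable
    (Eventually.of_forall fun t => hd t x)

/-- Split `P φ(t, x) - P₀ φ(t, 0)` as `(P - P₀) φ(t, x) + P₀ (φ(t, x) - φ(t, 0))`: the trace
controls the first part, continuity of `φ` the second. -/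
lemma tendsto_integral_side {σ : ℝ} {P : ℝ × ℝ → ℝ} {P₀ : ℝ → ℝ} {K : ℝ} (hP : Measurable P)
    (hPK : ∀ z, |P z| ≤ K) (hP₀ : Measurable P₀) (hP₀K : ∀ t, |P₀ t| ≤ K) (htr : TraceAt σ P P₀)
    {φ : ℝ × ℝ → ℝ} (hφ : Continuous φ) (hc : HasCompactSupport φ) (hs : tsupport φ ⊆ halfPlane) :
    Tendsto (fun x => ∫ t, P (t, x) * φ (t, x)) (side σ) (𝓝 (∫ t, P₀ t * φ (t, 0))) := by
  obtain ⟨θ, hθ, hθc, hθs, hθ0, hd⟩ := exists_dominating hφ hc hs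
  have iθ := hθ.integrable_of_hasCompactSupport (μ := volume) hθc
  have iφ := integrable_slice hφ hθ hθc hd
  have hPx : ∀ x, Measurable fun t => P (t, x) := fun x => hP.comp (measurable_id.prodMk measurable_const)
  have T1 := htr θ hθ hθc hθs hθ0
  have T2 : Tendsto (fun x => ∫ t, |φ (t, x) - φ (t, 0)|) (side σ) (𝓝 0) := by
    have hle : side σ ≤ 𝓝 0 := inf_le_left.trans nhdsWithin_le_nhds
    refine Tendsto.mono_left ?_ hle
    have : Tendsto (fun x => ∫ t, |φ (t, x) - φ (t, 0)|) (𝓝 0)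
        (𝓝 (∫ t, |φ (t, 0) - φ (t, 0)|)) := by
      refine tendsto_integral_filter_of_dominated_convergence (fun t => θ t + θ t) ?_ ?_
        (iθ.add iθ) ?_
      · exact Eventually.of_forall fun x => ((iφ x).sub (iφ 0)).norm.aestronglyMeasurable
      · refine Eventually.of_forall fun x => Eventually.of_forall fun t => ?_
        rw [Real.norm_eq_abs, abs_abs]
        exact (abs_sub _ _).trans (add_le_add (hd _ _) (hd _ _))
      · refine Eventually.of_forall fun t => ?_
        have : Continuous fun x => |φ (t, x) - φ (t, 0)| := by fun_prop
        exact this.tendsto 0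
    simpa using this
  rw [tendsto_iff_dist_tendsto_zero]
  refine squeeze_zero (fun _ => dist_nonneg) (fun x => ?_)
    (by simpa using T1.add (T2.const_mul K))
  have i1 : Integrable fun t => P (t, x) * φ (t, x) :=
    (iφ x).bdd_mul (hPx x).aestronglyMeasurable (Eventually.of_forall fun t => hPK _)
  have i2 : Integrable fun t => P₀ t * φ (t, 0) :=
    (iφ 0).bdd_mul hP₀.aestronglyMeasurable (Eventually.of_forall fun t => hP₀K _)
  have i3 : Integrable fun t => |P (t, x) - P₀ t| * θ t := by
    refine iθ.bdd_mul (c := K + K) ((hPx x).sub hP₀).abs.aestronglyMeasurable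
      (Eventually.of_forall fun t => ?_)
    rw [Real.norm_eq_abs, abs_abs]
    exact (abs_sub _ _).trans (add_le_add (hPK _) (hP₀K _))
  have i4 : Integrable fun t => K * |φ (t, x) - φ (t, 0)| :=
    ((iφ x).sub (iφ 0)).norm.const_mul K
  rw [Real.dist_eq, ← integral_sub i1 i2, ← integral_const_mul, ← integral_add i3 i4,
    ← Real.norm_eq_abs]
  refine norm_integral_le_of_norm_le (i3.add i4) (Eventually.of_forall fun t => ?_)
  have e : P (t, x) * φ (t, x) - P₀ t * φ (t, 0) =
    (P (t, x) - P₀ t) * φ (t, x) + P₀ t * (φ (t, x) - φ (t, 0)) := by ring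
  rw [e]
  refine (norm_add_le _ _).trans (add_le_add ?_ ?_) <;> rw [norm_mul]
  · exact mul_le_mul_of_nonneg_left (hd _ _) (norm_nonneg _)
  · exact mul_le_mul_of_nonneg_right (hP₀K _) (norm_nonneg _)

/-- Averages over thin strips converge to the trace. -/
theorem tendsto_average_strip {σ : ℝ} (hσ : σ = 1 ∨ σ = -1) {P : ℝ × ℝ → ℝ} {P₀ : ℝ → ℝ} {K : ℝ}
    (hP : Measurable P) (hPK : ∀ z, |P z| ≤ K) (hP₀ : Measurable P₀) (hP₀K : ∀ t, |P₀ t| ≤ K)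
    (htr : TraceAt σ P P₀) {φ : ℝ × ℝ → ℝ} (hφ : Continuous φ) (hc : HasCompactSupport φ)
    (hs : tsupport φ ⊆ halfPlane) :
    Tendsto (fun h => ∫ z, (strip σ h).indicator (fun _ => σ / h) z * (P z * φ z)) (𝓝[>] 0)
      (𝓝 (σ * ∫ t, P₀ t * φ (t, 0))) := by
  have T := tendsto_integral_side hP hPK hP₀ hP₀K htr hφ hc hs
  set I : ℝ → ℝ := fun x => ∫ t, P (t, x) * φ (t, x) with hI
  set I₀ := ∫ t, P₀ t * φ (t, 0) with hI₀
  have iPφ : Integrable fun z => P z * φ z := integrable_bounded_mul_of_compactSupport hP hPK hφ hc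
  have iI : Integrable I := iPφ.integral_prod_right
  have hσ1 : |σ| = 1 := by rcases hσ with rfl | rfl <;> simp
  have hind : ∀ h, Integrable ((stripX σ h).indicator fun _ => σ / h) := fun h =>
    (integrable_indicator_iff (measurableSet_stripX hσ h)).2
      (integrableOn_const (hs := by rw [volume_stripX hσ]; exact ENNReal.ofReal_ne_top))
  have e1 : ∀ h, ∫ z, (strip σ h).indicator (fun _ => σ / h) z * (P z * φ z) =
      ∫ x, (stripX σ h).indicator (fun _ => σ / h) x * I x := by
    intro h
    have hm : Measurable ((strip σ h).indicator fun _ => σ / h) :=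
      measurable_const.indicator (isOpen_strip σ h).measurableSet
    have : Integrable fun z => (strip σ h).indicator (fun _ => σ / h) z * (P z * φ z) := by
      refine iPφ.bdd_mul (c := |σ / h|) hm.aestronglyMeasurable (Eventually.of_forall fun z => ?_)
      exact norm_indicator_le_norm_self _ z
    rw [Measure.volume_eq_prod, integral_prod_symm _ this]
    refine integral_congr_ae (Eventually.of_forall fun x => ?_)
    simp only [hI]
    rw [← integral_const_mul]
    rfl
  -- The strip has width `h`, so the weight `σ / h` has total mass `σ`; subtracting `σ * I₀` from
  -- the average is subtracting `I₀` under the integral.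
  have e2 : ∀ h, 0 < h → ∫ x, (stripX σ h).indicator (fun _ => σ / h) x = σ := by
    intro h hh
    rw [integral_indicator (measurableSet_stripX hσ h), setIntegral_const, measureReal_def,
      volume_stripX hσ, ENNReal.toReal_ofReal hh.le, smul_eq_mul]
    field_simp
  rw [Metric.tendsto_nhdsWithin_nhds]
  intro ε hε
  have T' := T.eventually (Metric.ball_mem_nhds I₀ (half_pos hε))
  obtain ⟨s, hs, t, ht, hst⟩ := eventually_inf.1 T'
  obtain ⟨δ, hδ, hsub⟩ := Metric.mem_nhdsWithin_iff.1 hs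
  refine ⟨δ / 2, half_pos hδ, fun h hh hhδ => ?_⟩
  have hh : 0 < h := hh
  rw [Real.dist_eq, sub_zero, abs_of_pos hh] at hhδ
  have hae : ∀ᵐ x : ℝ, x ∈ stripX σ h → |I x - I₀| ≤ ε / 2 := by
    filter_upwards [ht] with x hx hxs
    have hxs1 : 0 < σ * x := hh.trans hxs.1
    refine (hst x ⟨hsub ⟨?_, hxs1⟩, hx⟩).le
    rw [mem_ball_zero_iff, Real.norm_eq_abs, ← one_mul |x|, ← hσ1, ← abs_mul, abs_of_pos hxs1]
    linarith [hxs.2]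
  have iind : Integrable fun x => (stripX σ h).indicator (fun _ => σ / h) x * I x := by
    refine iI.bdd_mul (c := |σ / h|) (hind h).aestronglyMeasurable (Eventually.of_forall fun z => ?_)
    exact norm_indicator_le_norm_self _ z
  have e3 : (∫ x, (stripX σ h).indicator (fun _ => σ / h) x * I x) - σ * I₀ =
      ∫ x, (stripX σ h).indicator (fun _ => σ / h) x * (I x - I₀) := by
    simp_rw [mul_sub]
    rw [integral_sub iind ((hind h).mul_const _), integral_mul_const, e2 h hh]
  have e4 : ∫ x, σ * (stripX σ h).indicator (fun _ => σ / h) x * (ε / 2) = ε / 2 := by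
    rw [integral_mul_const, integral_const_mul, e2 h hh]
    rcases hσ with rfl | rfl <;> ring
  rw [e1, Real.dist_eq, e3]
  refine lt_of_le_of_lt ?_ (half_lt_self hε)
  rw [← e4, ← Real.norm_eq_abs]
  refine norm_integral_le_of_norm_le (((hind h).const_mul _).mul_const _) ?_
  filter_upwards [hae] with x hx
  by_cases hxs : x ∈ stripX σ h
  · rw [indicator_of_mem hxs, norm_mul, norm_div, Real.norm_eq_abs σ, hσ1,
      Real.norm_of_nonneg hh.le]
    have : σ * (σ / h) = 1 / h := by rcases hσ with rfl | rfl <;> ring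
    rw [this]
    exact mul_le_mul_of_nonneg_left (hx hxs) (by positivity)
  · simp [indicator_of_notMem hxs]

/-- The corners of the cut-off lie on two horizontal or vertical null lines `σ x = h` and `σ x =
2h`. Elsewhere the product rule produces the extra strip term in the `x` derivative, which becomes
the boundary term as `h → 0`. -/
lemma ae_partial_mul_cut {σ h : ℝ} (hσ : σ ≠ 0) (hh : 0 < h) {φ : ℝ × ℝ → ℝ} {C : NNReal}
    (hφ : LipschitzWith C φ) : ∀ᵐ z : ℝ × ℝ, DifferentiableAt ℝ φ z ∧
      DifferentiableAt ℝ (fun z => φ z * cut σ h z) z ∧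
      partialT (fun z => φ z * cut σ h z) z = cut σ h z * partialT φ z ∧
      partialX (fun z => φ z * cut σ h z) z = cut σ h z * partialX φ z +
        (strip σ h).indicator (fun _ => σ / h) z * φ z := by
  filter_upwards [ae_snd_mul_ne hσ h, ae_snd_mul_ne hσ (2 * h),
    hφ.ae_differentiableAt (μ := (volume : Measure (ℝ × ℝ)))] with z h1 h2 hd
  have hc := hasFDerivAt_cut hh h1 h2
  refine ⟨hd, hd.mul hc.differentiableAt, ?_, ?_⟩
  · rw [partialT, fderiv_mul_apply_eq hd hc.differentiableAt, hc.fderiv, partialT]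
    simp [mul_comm]
  · rw [partialX, fderiv_mul_apply_eq hd hc.differentiableAt, hc.fderiv, partialX]
    simp [mul_comm]
    ring

lemma integrable_mul_partial {A : ℝ × ℝ → ℝ} {K : ℝ} (hA : Measurable A) (hAK : ∀ z, |A z| ≤ K)
    {φ : ℝ × ℝ → ℝ} {C : NNReal} (hφ : LipschitzWith C φ) (hc : HasCompactSupport φ) (v : ℝ × ℝ) :
    Integrable fun z => A z * fderiv ℝ φ z v := by
  refine Integrable.bdd_mul (c := K) ?_ hA.aestronglyMeasurable (Eventually.of_forall hAK)
  have hK := hc.isCompact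
  have : Integrable ((tsupport φ).indicator fun _ => (C : ℝ) * ‖v‖) :=
    (integrable_indicator_iff hK.measurableSet).2
        (integrableOn_const (hs := hK.measure_lt_top.ne))
  refine this.mono' (measurable_fderiv_apply_const ℝ φ v).aestronglyMeasurable
    (Eventually.of_forall fun z => ?_)
  by_cases hz : z ∈ tsupport φ
  · rw [indicator_of_mem hz]
    exact abs_fderiv_apply_le hφ z v
  · simp [fderiv_eq_zero_of_notMem_tsupport subset_rfl hz, indicator_of_notMem hz]

lemma integrable_strip_mul {σ h : ℝ} {B : ℝ × ℝ → ℝ} {K : ℝ} (hB : Measurable B)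
    (hBK : ∀ z, |B z| ≤ K) {φ : ℝ × ℝ → ℝ} (hφ : Continuous φ) (hc : HasCompactSupport φ) :
    Integrable fun z => (strip σ h).indicator (fun _ => σ / h) z * (B z * φ z) := by
  have hm : Measurable ((strip σ h).indicator fun _ => σ / h) :=
    measurable_const.indicator (isOpen_strip σ h).measurableSet
  refine (integrable_bounded_mul_of_compactSupport hB hBK hφ hc).bdd_mul (c := |σ / h|)
    hm.aestronglyMeasurable (Eventually.of_forall fun z => ?_)
  exact norm_indicator_le_norm_self _ z

lemma continuous_cut (σ h : ℝ) : Continuous (cut σ h) := (locallyLipschitz_cut σ h).continuous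

lemma tendsto_cut {σ : ℝ} {z : ℝ × ℝ} :
    Tendsto (fun h => cut σ h z) (𝓝[>] 0) (𝓝 ({z : ℝ × ℝ | 0 < σ * z.2}.indicator 1 z)) := by
  by_cases hz : 0 < σ * z.2
  · rw [indicator_of_mem (show z ∈ {z : ℝ × ℝ | 0 < σ * z.2} from hz)]
    refine tendsto_const_nhds.congr' ?_
    filter_upwards [self_mem_nhdsWithin, mem_nhdsWithin_of_mem_nhds
      (gt_mem_nhds (half_pos hz))] with h hh hh2
    exact (cut_eq_one hh (by linarith)).symm
  · rw [indicator_of_notMem (show z ∉ {z : ℝ × ℝ | 0 < σ * z.2} from hz)]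
    refine tendsto_const_nhds.congr' ?_
    filter_upwards [self_mem_nhdsWithin] with h hh
    exact (cut_eq_zero hh ((not_lt.1 hz).trans (le_of_lt hh))).symm

lemma tendsto_integral_cut_mul {σ : ℝ} {G : ℝ × ℝ → ℝ} (hG : Integrable G) :
    Tendsto (fun h => ∫ z, cut σ h z * G z) (𝓝[>] 0) (𝓝 (∫ z in {z | 0 < σ * z.2}, G z)) := by
  have hm : MeasurableSet {z : ℝ × ℝ | 0 < σ * z.2} :=
    measurableSet_lt measurable_const (measurable_const.mul measurable_snd)
  rw [← integral_indicator hm]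
  refine tendsto_integral_filter_of_dominated_convergence (fun z => ‖G z‖) ?_ ?_ hG.norm ?_
  · exact Eventually.of_forall fun h =>
      (continuous_cut σ h).aestronglyMeasurable.mul hG.aestronglyMeasurable
  · refine Eventually.of_forall fun h => Eventually.of_forall fun z => ?_
    rw [norm_mul, Real.norm_of_nonneg (cut_nonneg _ _ _)]
    exact mul_le_of_le_one_left (norm_nonneg _) (cut_le_one _ _ _)
  · refine Eventually.of_forall fun z => ?_
    have := (tendsto_cut (σ := σ) (z := z)).mul_const (G z)
    convert this using 2
    by_cases hz : z ∈ {z : ℝ × ℝ | 0 < σ * z.2} <;> simp [hz]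

/-- An entropy inequality away from the interface, with the boundary term expressed by traces. -/
theorem half_inequality {σ : ℝ} (hσ : σ = 1 ∨ σ = -1) {A B : ℝ × ℝ → ℝ} {B₀ : ℝ → ℝ} {K : ℝ}
    (hA : Measurable A) (hB : Measurable B) (hB₀ : Measurable B₀) (hAK : ∀ z, |A z| ≤ K)
    (hBK : ∀ z, |B z| ≤ K) (hB₀K : ∀ t, |B₀ t| ≤ K) (htr : TraceAt σ B B₀)
    (h : ∀ φ : ℝ × ℝ → ℝ, ContDiff ℝ ∞ φ → HasCompactSupport φ →
      tsupport φ ⊆ halfPlane ∩ {z | 0 < σ * z.2} → (∀ z, 0 ≤ φ z) →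
      0 ≤ ∫ z, (A z * partialT φ z + B z * partialX φ z))
    {φ : ℝ × ℝ → ℝ} {C : NNReal} (hφ : LipschitzWith C φ) (hc : HasCompactSupport φ)
    (hs : tsupport φ ⊆ halfPlane) (h0 : ∀ z, 0 ≤ φ z) :
    0 ≤ (∫ z in {z | 0 < σ * z.2}, (A z * partialT φ z + B z * partialX φ z)) +
      σ * ∫ t, B₀ t * φ (t, 0) := by
  have hσ0 : σ ≠ 0 := by rcases hσ with rfl | rfl <;> norm_num
  have hΩ : IsOpen (halfPlane ∩ {z : ℝ × ℝ | 0 < σ * z.2}) :=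
    (isOpen_Ioi.prod isOpen_univ).inter (isOpen_lt continuous_const (by fun_prop))
  have hK0 : 0 ≤ K := (abs_nonneg _).trans (hAK 0)
  have iG := (integrable_mul_partial hA hAK hφ hc (1, 0)).add
    (integrable_mul_partial hB hBK hφ hc (0, 1))
  -- Test with `φ` times the cut-off and let its width tend to zero: the bulk term converges to the
  -- half-plane integral, the strip term to the trace.
  refine ge_of_tendsto ((tendsto_integral_cut_mul (σ := σ) iG).add
    (tendsto_average_strip hσ hB hBK hB₀ hB₀K htr hφ.continuous hc hs)) ?_
  filter_upwards [self_mem_nhdsWithin] with ε hε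
  have hε : 0 < ε := hε
  obtain ⟨C', hC'⟩ := exists_lipschitzWith_mul hφ.locallyLipschitz (locallyLipschitz_cut σ ε) hc
  have hsub : tsupport (fun z => φ z * cut σ ε z) ⊆ halfPlane ∩ {z | 0 < σ * z.2} := by
    refine subset_inter ((tsupport_mul_subset_left).trans hs) ?_
    have hcl : IsClosed {z : ℝ × ℝ | ε ≤ σ * z.2} := isClosed_le continuous_const (by fun_prop)
    refine (closure_minimal ?_ hcl).trans fun z hz => hε.trans_le hz
    intro z hz
    by_contra hlt
    exact right_ne_zero_of_mul hz (cut_eq_zero hε (not_le.1 hlt).le)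
  have := nonneg_of_lipschitz_test (S := 0) hΩ hA.aestronglyMeasurable hB.aestronglyMeasurable
    aestronglyMeasurable_zero hAK hBK (by simpa using hK0) (by simpa using h) hC' hc.mul_right hsub
    (fun z => mul_nonneg (h0 z) (cut_nonneg _ _ _))
  simp only [Pi.zero_apply, zero_mul, integral_zero, add_zero] at this
  refine this.trans_eq ?_
  rw [← integral_add ?_ (integrable_strip_mul hB hBK hφ.continuous hc)]
  · refine integral_congr_ae ?_
    filter_upwards [ae_partial_mul_cut hσ0 hε hφ] with z hz
    rw [hz.2.2.1, hz.2.2.2]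
    simp only [Pi.add_apply, partialT, partialX]
    ring
  · exact iG.bdd_mul (c := 1) (continuous_cut σ ε).aestronglyMeasurable
      (Eventually.of_forall fun z => by
        rw [Real.norm_of_nonneg (cut_nonneg _ _ _)]; exact cut_le_one _ _ _)

lemma integral_sides_add {G : ℝ × ℝ → ℝ} (iG : Integrable G) :
    ∫ z, G z = (∫ z in {z : ℝ × ℝ | 0 < 1 * z.2}, G z) +
      ∫ z in {z : ℝ × ℝ | 0 < -1 * z.2}, G z := by
  have hm : MeasurableSet {z : ℝ × ℝ | 0 < 1 * z.2} :=
    measurableSet_lt measurable_const (measurable_const.mul measurable_snd)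
  rw [← integral_add_compl hm iG]
  congr 1
  refine setIntegral_congr_set ?_
  filter_upwards [ae_snd_mul_ne (one_ne_zero) 0] with z hz
  refine propext ?_
  change ¬ (0 < 1 * z.2) ↔ 0 < -1 * z.2
  constructor
  · intro h'; have := lt_of_le_of_ne (not_lt.1 h') hz; linarith
  · intro h'; linarith

/-- Localising an inequality with an interface term at the interface. -/
theorem interface_inequality {A B : ℝ × ℝ → ℝ} {Bl Br S : ℝ → ℝ} {K : ℝ}
    (hA : Measurable A) (hB : Measurable B) (hBl : Measurable Bl) (hBr : Measurable Br)
    (hS : Measurable S) (hAK : ∀ z, |A z| ≤ K) (hBK : ∀ z, |B z| ≤ K) (hBlK : ∀ t, |Bl t| ≤ K)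
    (hBrK : ∀ t, |Br t| ≤ K) (hSK : ∀ t, |S t| ≤ K)
    (htrl : TraceAt (-1) B Bl) (htrr : TraceAt 1 B Br)
    (h : ∀ φ : ℝ × ℝ → ℝ, ContDiff ℝ ∞ φ → HasCompactSupport φ → tsupport φ ⊆ halfPlane →
      (∀ z, 0 ≤ φ z) →
      0 ≤ (∫ z, (A z * partialT φ z + B z * partialX φ z)) + ∫ t, S t * φ (t, 0))
    {φ : ℝ × ℝ → ℝ} {C : NNReal} (hφ : LipschitzWith C φ) (hc : HasCompactSupport φ)
    (hs : tsupport φ ⊆ halfPlane) (h0 : ∀ z, 0 ≤ φ z) :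
    0 ≤ (∫ t, Bl t * φ (t, 0)) - (∫ t, Br t * φ (t, 0)) + ∫ t, S t * φ (t, 0) := by
  have hΩ : IsOpen halfPlane := isOpen_Ioi.prod isOpen_univ
  have iG := (integrable_mul_partial hA hAK hφ hc (1, 0)).add
    (integrable_mul_partial hB hBK hφ hc (0, 1))
  set G := (fun z => A z * fderiv ℝ φ z (1, 0)) + fun z => B z * fderiv ℝ φ z (0, 1) with hG
  have hsplit := integral_sides_add iG
  have T1 := (tendsto_integral_cut_mul (σ := 1) iG).add
    (tendsto_average_strip (Or.inl rfl) hB hBK hBr hBrK htrr hφ.continuous hc hs)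
  have T2 := (tendsto_integral_cut_mul (σ := -1) iG).add
    (tendsto_average_strip (Or.inr rfl) hB hBK hBl hBlK htrl hφ.continuous hc hs)
  -- The test function is `φ (1 - cut 1 ε - cut (-1) ε)`, equal to `φ` on the interface and
  -- supported in `|x| ≤ 2 ε`. The bulk contributions cancel in the limit; each strip leaves one
  -- trace, and the interface term is unaffected by `ε`.
  have T := (((tendsto_const_nhds (x := ∫ z, G z)).sub T1).sub T2).add
    (tendsto_const_nhds (x := ∫ t, S t * φ (t, 0)))
  have e : (∫ t, Bl t * φ (t, 0)) - (∫ t, Br t * φ (t, 0)) + ∫ t, S t * φ (t, 0) =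
    ((∫ z, G z) - ((∫ z in {z : ℝ × ℝ | 0 < 1 * z.2}, G z) + 1 * ∫ t, Br t * φ (t, 0)) -
      ((∫ z in {z : ℝ × ℝ | 0 < -1 * z.2}, G z) + -1 * ∫ t, Bl t * φ (t, 0))) +
      ∫ t, S t * φ (t, 0) := by rw [hsplit]; ring
  rw [e]
  refine ge_of_tendsto T ?_
  filter_upwards [self_mem_nhdsWithin] with ε hε
  have hε : 0 < ε := hε
  have hll := hφ.locallyLipschitz
  have hl1 := locallyLipschitz_mul hll (locallyLipschitz_cut 1 ε)
  have hl2 := locallyLipschitz_mul hll (locallyLipschitz_cut (-1) ε)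
  set ψ : ℝ × ℝ → ℝ := fun z => φ z - φ z * cut 1 ε z - φ z * cut (-1) ε z with hψ
  have hψ' : ∀ z, ψ z = φ z * (1 - cut 1 ε z - cut (-1) ε z) := fun z => by simp only [hψ]; ring
  have hψs : tsupport ψ ⊆ tsupport φ := closure_mono fun z hz => by
    rw [Function.mem_support, hψ'] at hz
    exact left_ne_zero_of_mul hz
  have hψc : HasCompactSupport ψ := hc.isCompact.of_isClosed_subset (isClosed_tsupport _) hψs
  obtain ⟨C', hC'⟩ : ∃ C', LipschitzWith C' ψ :=
    exists_lipschitzWith_of_hasCompactSupport ((hll.sub hl1).sub hl2) hψc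
  have hψ0 : ∀ z, 0 ≤ ψ z := by
    intro z
    rw [hψ']
    refine mul_nonneg (h0 z) ?_
    rcases le_total z.2 0 with hz | hz
    · rw [cut_eq_zero (σ := 1) hε (by linarith)]
      linarith [cut_le_one (-1) ε z]
    · rw [cut_eq_zero (σ := -1) hε (by linarith)]
      linarith [cut_le_one 1 ε z]
  have := nonneg_of_lipschitz_test (φ := ψ) hΩ hA.aestronglyMeasurable hB.aestronglyMeasurable
    hS.aestronglyMeasurable hAK hBK hSK h hC' hψc (hψs.trans hs) hψ0
  have e0 : ∀ t, ψ (t, 0) = φ (t, 0) := fun t => by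
    rw [hψ', cut_eq_zero hε (by simpa using hε.le), cut_eq_zero hε (by simpa using hε.le)]; ring
  simp only [e0] at this
  refine this.trans_eq ?_
  have icut : ∀ σ, Integrable fun z => cut σ ε z * G z := fun σ =>
    iG.bdd_mul (c := 1) (continuous_cut σ ε).aestronglyMeasurable
      (Eventually.of_forall fun z => by
        rw [Real.norm_of_nonneg (cut_nonneg _ _ _)]; exact cut_le_one _ _ _)
  have j1 : Integrable fun z => cut 1 ε z * G z +
      (strip 1 ε).indicator (fun _ => 1 / ε) z * (B z * φ z) :=
    (icut 1).add (integrable_strip_mul (σ := 1) (h := ε) hB hBK hφ.continuous hc)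
  have j2 : Integrable fun z => cut (-1) ε z * G z +
      (strip (-1) ε).indicator (fun _ => -1 / ε) z * (B z * φ z) :=
    (icut (-1)).add (integrable_strip_mul (σ := -1) (h := ε) hB hBK hφ.continuous hc)
  congr 1
  rw [← integral_add (icut 1) (integrable_strip_mul (σ := 1) hB hBK hφ.continuous hc),
    ← integral_add (icut (-1)) (integrable_strip_mul (σ := -1) hB hBK hφ.continuous hc),
    ← integral_sub iG j1]
  refine Eq.trans ?_ (integral_sub (iG.sub j1) j2)
  refine integral_congr_ae ?_
  filter_upwards [ae_partial_mul_cut one_ne_zero hε hφ,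
    ae_partial_mul_cut (neg_ne_zero.2 one_ne_zero) hε hφ] with z h1 h2
  have d := (h1.1.hasFDerivAt.sub h1.2.1.hasFDerivAt).sub h2.2.1.hasFDerivAt
  have hd : ∀ v, fderiv ℝ ψ z v = fderiv ℝ φ z v - fderiv ℝ (fun z => φ z * cut 1 ε z) z v -
      fderiv ℝ (fun z => φ z * cut (-1) ε z) z v := by
    intro v
    have : fderiv ℝ ψ z = _ := d.fderiv
    rw [this]
    rfl
  have hT1 := h1.2.2.1
  have hX1 := h1.2.2.2
  have hT2 := h2.2.2.1
  have hX2 := h2.2.2.2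
  simp only [partialT, partialX] at hT1 hX1 hT2 hX2
  simp only [partialT, partialX, hd, hT1, hT2, hX1, hX2, hG, Pi.add_apply]
  ring

/-! ### Algebra of the interface entropy conditions -/

section Algebra

variable {f g : ℝ → ℝ} {a b : ℝ}

lemma kflux_of_le {s k : ℝ} (h : k ≤ s) : kflux f s k = f s - f k := by
  rw [kflux, max_eq_left h, min_eq_right h]

lemma kflux_of_ge {s k : ℝ} (h : s ≤ k) : kflux f s k = f k - f s := by
  rw [kflux, max_eq_right h, min_eq_left h]

/-- The interface entropy conditions for the pair of traces `(ul, ur)` with interface value `p`. -/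
def InterfaceAdmissible (f g : ℝ → ℝ) (a b p ul ur : ℝ) : Prop :=
  ∀ ξ ∈ Icc a b, (ξ ≤ p → kflux f ur ξ - kflux g ul ξ + (f ξ - g ξ) ≤ 0) ∧
    (p ≤ ξ → kflux f ur ξ - kflux g ul ξ - (f ξ - g ξ) ≤ 0)

/-- At the end points `f` and `g` agree, so the interface term disappears whatever `p` is. Level `a`
gives `f ur ≤ g ul`, level `b` the reverse inequality. -/
lemma InterfaceAdmissible.rankine_hugoniot {p ul ur : ℝ} (h : InterfaceAdmissible f g a b p ul ur)
    (hl : ul ∈ Icc a b) (hr : ur ∈ Icc a b) (ha : f a = g a) (hb : f b = g b) : f ur = g ul := by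
  have hab : a ≤ b := hl.1.trans hl.2
  have h1 := h a (left_mem_Icc.2 hab)
  have h2 := h b (right_mem_Icc.2 hab)
  rw [kflux_of_le hr.1, kflux_of_le hl.1] at h1
  rw [kflux_of_ge hr.2, kflux_of_ge hl.2] at h2
  refine le_antisymm ?_ ?_
  · rcases le_total a p with h' | h'
    · linarith [h1.1 h']
    · linarith [h1.2 h']
  · rcases le_total b p with h' | h'
    · linarith [h2.1 h']
    · linarith [h2.2 h']

/-- For levels between `ul` and `ur`, the conditions and Rankine–Hugoniot bound the common flux of
`u` above by `g ξ` if `ξ ≤ p` and by `f ξ` if `p ≤ ξ`. For levels between `vr` and `vl`, the common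
flux of `v` is bounded below by `f ξ` if `ξ ≤ q` and by `g ξ` if `q ≤ ξ`. A level where both bounds
involve the same function chains them. The level `p` is such a level when it lies in both intervals;
otherwise an end point of the intersection works, Rankine–Hugoniot replacing the missing bound. If
one of the intervals is empty, the other alone suffices. -/
lemma InterfaceAdmissible.le_of_crossing {p q ul ur vl vr : ℝ}
    (hu : InterfaceAdmissible f g a b p ul ur) (hv : InterfaceAdmissible f g a b q vl vr)
    (hul : ul ∈ Icc a b) (hur : ur ∈ Icc a b) (hvl : vl ∈ Icc a b) (hvr : vr ∈ Icc a b)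
    (ha : f a = g a) (hb : f b = g b) (h1 : vr ≤ ur) (h2 : ul ≤ vl) : f ur ≤ f vr := by
  have Ru := hu.rankine_hugoniot hul hur ha hb
  have Rv := hv.rankine_hugoniot hvl hvr ha hb
  have U : ∀ ξ, ul ≤ ξ → ξ ≤ ur → (ξ ≤ p → f ur ≤ g ξ) ∧ (p ≤ ξ → f ur ≤ f ξ) := by
    intro ξ hξ1 hξ2
    have := hu ξ ⟨hul.1.trans hξ1, hξ2.trans hur.2⟩
    rw [kflux_of_le hξ2, kflux_of_ge hξ1] at this
    exact ⟨fun h => by linarith [this.1 h], fun h => by linarith [this.2 h]⟩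
  have V : ∀ ξ, vr ≤ ξ → ξ ≤ vl → (ξ ≤ q → f ξ ≤ f vr) ∧ (q ≤ ξ → g ξ ≤ f vr) := by
    intro ξ hξ1 hξ2
    have := hv ξ ⟨hvr.1.trans hξ1, hξ2.trans hvl.2⟩
    rw [kflux_of_ge hξ1, kflux_of_le hξ2] at this
    exact ⟨fun h => by linarith [this.1 h], fun h => by linarith [this.2 h]⟩
  rcases lt_or_ge ur ul with c1 | c1
  · rcases le_total ur q with h | h
    · exact (V ur h1 (by linarith)).1 h
    · rw [Ru]
      exact (V ul (by linarith) h2).2 (by linarith)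
  rcases lt_or_ge vl vr with c2 | c2
  · rcases le_total p vr with h | h
    · exact (U vr (by linarith) h1).2 h
    · rw [Rv]
      exact (U vl h2 (by linarith)).1 (by linarith)
  set m := max ul vr
  set M := min ur vl
  have hmM : m ≤ M := max_le (le_min c1 h2) (le_min h1 c2)
  have U' : ∀ ξ, m ≤ ξ → ξ ≤ M → (ξ ≤ p → f ur ≤ g ξ) ∧ (p ≤ ξ → f ur ≤ f ξ) := fun ξ h h' =>
    U ξ ((le_max_left _ _).trans h) (h'.trans (min_le_left _ _))
  have V' : ∀ ξ, m ≤ ξ → ξ ≤ M → (ξ ≤ q → f ξ ≤ f vr) ∧ (q ≤ ξ → g ξ ≤ f vr) := fun ξ h h' =>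
    V ξ ((le_max_right _ _).trans h) (h'.trans (min_le_right _ _))
  by_cases hp : p ∈ Icc m M
  · have u1 := U' p hp.1 hp.2
    have v1 := V' p hp.1 hp.2
    rcases le_total p q with h | h
    · exact (u1.2 le_rfl).trans (v1.1 h)
    · exact (u1.1 le_rfl).trans (v1.2 h)
  rcases lt_or_ge p m with hpm | hpm
  · have um := (U' m le_rfl hmM).2 hpm.le
    have vm := V' m le_rfl hmM
    rcases le_total m q with h | h
    · exact um.trans (vm.1 h)
    · rcases le_total ul vr with h' | h'
      · have : m = vr := max_eq_right h'
        rwa [this] at um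
      · have : m = ul := max_eq_left h'
        have := vm.2 h
        rw [‹m = ul›] at this
        rwa [Ru]
  · have hpM : M < p := not_le.1 fun h => hp ⟨hpm, h⟩
    have uM := (U' M hmM le_rfl).1 hpM.le
    have vM := V' M hmM le_rfl
    rcases le_total M q with h | h
    · rcases le_total ur vl with h' | h'
      · have : M = ur := min_eq_left h'
        have := vM.1 h
        rwa [‹M = ur›] at this
      · have : M = vl := min_eq_right h'
        rw [this] at uM
        rwa [Rv]
    · exact uM.trans (vM.2 h)

/-- The interface does not produce `L¹` distance. -/
lemma InterfaceAdmissible.kflux_le {p q ul ur vl vr : ℝ}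
    (hu : InterfaceAdmissible f g a b p ul ur) (hv : InterfaceAdmissible f g a b q vl vr)
    (hul : ul ∈ Icc a b) (hur : ur ∈ Icc a b) (hvl : vl ∈ Icc a b) (hvr : vr ∈ Icc a b)
    (ha : f a = g a) (hb : f b = g b) : kflux f ur vr ≤ kflux g ul vl := by
  have Ru := hu.rankine_hugoniot hul hur ha hb
  have Rv := hv.rankine_hugoniot hvl hvr ha hb
  rcases le_total vr ur with h1 | h1 <;> rcases le_total vl ul with h2 | h2
  · rw [kflux_of_le h1, kflux_of_le h2, Ru, Rv]
  · rw [kflux_of_le h1, kflux_of_ge h2]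
    linarith [hu.le_of_crossing hv hul hur hvl hvr ha hb h1 h2]
  · rw [kflux_of_ge h1, kflux_of_le h2]
    linarith [hv.le_of_crossing hu hvl hvr hul hur ha hb h1 h2]
  · rw [kflux_of_ge h1, kflux_of_ge h2, Ru, Rv]

/-- It is enough to check the interface conditions at rational levels and at the end points. -/
lemma interfaceAdmissible_of_countable (hf : Continuous f) (hg : Continuous g) {p ul ur : ℝ}
    (ha : f a = g a) (hb : f b = g b)
    (h : ∀ ξ ∈ (range ((↑) : ℚ → ℝ) ∪ {a, b}) ∩ Icc a b,
      0 ≤ kflux g ul ξ - kflux f ur ξ - Real.sign (p - ξ) * (f ξ - g ξ)) :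
    InterfaceAdmissible f g a b p ul ur := by
  have key : ∀ ξ ∈ Icc a b, (ξ = a ∨ ξ = b) → kflux f ur ξ - kflux g ul ξ + (f ξ - g ξ) ≤ 0 ∧
      kflux f ur ξ - kflux g ul ξ - (f ξ - g ξ) ≤ 0 := by
    intro ξ hξ h'
    have h0 : f ξ - g ξ = 0 := by rcases h' with rfl | rfl <;> linarith
    have := h ξ ⟨Or.inr h', hξ⟩
    rw [h0] at this ⊢
    constructor <;> linarith
  intro ξ hξ
  by_cases hend : ξ = a ∨ ξ = b
  · exact ⟨fun _ => (key ξ hξ hend).1, fun _ => (key ξ hξ hend).2⟩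
  rw [not_or] at hend
  have haξ : a < ξ := lt_of_le_of_ne hξ.1 (Ne.symm hend.1)
  have hξb : ξ < b := lt_of_le_of_ne hξ.2 hend.2
  have cN : Continuous fun ξ => kflux f ur ξ - kflux g ul ξ := by
    unfold kflux; fun_prop
  constructor
  · intro hp
    by_contra! hlt
    have cc : Continuous fun ξ => kflux f ur ξ - kflux g ul ξ + (f ξ - g ξ) := cN.add (hf.sub hg)
    obtain ⟨δ, hδ, hb'⟩ := Metric.isOpen_iff.1 (isOpen_lt continuous_const cc) ξ hlt
    -- The rational is chosen strictly below `ξ ≤ p`, so the sign at `r` is exactly `1`. This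
    -- recovers the condition at `ξ = p` itself, where the sign is `0`; the second half approaches
    -- from above for the same reason.
    obtain ⟨r, hr1, hr2⟩ := exists_rat_btwn (max_lt haξ (sub_lt_self ξ hδ))
    have h1 := hb' (show (r : ℝ) ∈ Metric.ball ξ δ by
      rw [Metric.mem_ball, Real.dist_eq, abs_lt]
      constructor <;> linarith [le_max_right a (ξ - δ)])
    have h2 := h r ⟨Or.inl ⟨r, rfl⟩, ⟨(le_max_left _ _).trans hr1.le, by linarith⟩⟩
    rw [Real.sign_of_pos (by linarith)] at h2
    have h1 : 0 < kflux f ur r - kflux g ul r + (f r - g r) := h1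
    linarith
  · intro hp
    by_contra! hlt
    have cc : Continuous fun ξ => kflux f ur ξ - kflux g ul ξ - (f ξ - g ξ) := cN.sub (hf.sub hg)
    obtain ⟨δ, hδ, hb'⟩ := Metric.isOpen_iff.1 (isOpen_lt continuous_const cc) ξ hlt
    obtain ⟨r, hr1, hr2⟩ := exists_rat_btwn (lt_min hξb (lt_add_of_pos_right ξ hδ))
    have h1 := hb' (show (r : ℝ) ∈ Metric.ball ξ δ by
      rw [Metric.mem_ball, Real.dist_eq, abs_lt]
      constructor <;> linarith [min_le_right b (ξ + δ)])
    have h2 := h r ⟨Or.inl ⟨r, rfl⟩, ⟨by linarith, hr2.le.trans (min_le_left _ _)⟩⟩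
    rw [Real.sign_of_neg (by linarith)] at h2
    have h1 : 0 < kflux f ur r - kflux g ul r - (f r - g r) := h1
    linarith

end Algebra

/-! ### Kato's inequality across the interface -/

lemma measurable_real_sign : Measurable Real.sign := by
  unfold Real.sign
  exact Measurable.ite measurableSet_Iio measurable_const
    (Measurable.ite measurableSet_Ioi measurable_const measurable_const)

lemma abs_real_sign_le (x : ℝ) : |Real.sign x| ≤ 1 := by
  rcases Real.sign_apply_eq x with h | h | h <;> rw [h] <;> norm_num

/-- The Kružkov flux for the discontinuous flux. -/
noncomputable def sflux (f g : ℝ → ℝ) (x s k : ℝ) : ℝ := if 0 < x then kflux f s k else kflux g s k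

/-- Measurable representatives of an admissible solution, its traces and its interface function,
for fluxes defined on the whole line. -/
structure RegularSolution (a b : ℝ) (f g : ℝ → ℝ) (u₀ : ℝ → ℝ) (u : ℝ × ℝ → ℝ)
    (ul ur p : ℝ → ℝ) : Prop where
  meas : Measurable u
  meas_l : Measurable ul
  meas_r : Measurable ur
  meas_p : Measurable p
  mem : ∀ z, u z ∈ Icc a b
  mem_l : ∀ t, ul t ∈ Icc a b
  mem_r : ∀ t, ur t ∈ Icc a b
  trace_l : TraceAt (-1) u ul
  trace_r : TraceAt 1 u ur
  weak : ∀ φ : ℝ × ℝ → ℝ, ContDiff ℝ ∞ φ → HasCompactSupport φ →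
    (∫ z in halfPlane, (u z * partialT φ z + flux f g z.2 (u z) * partialX φ z))
      + ∫ x : ℝ, u₀ x * φ (0, x) = 0
  entropy : ∀ ξ ∈ Icc a b, ∀ φ : ℝ × ℝ → ℝ, ContDiff ℝ ∞ φ → HasCompactSupport φ →
    tsupport φ ⊆ halfPlane → (∀ z, 0 ≤ φ z) →
    0 ≤ (∫ z, (|u z - ξ| * partialT φ z + sflux f g z.2 (u z) ξ * partialX φ z)) +
      ∫ t, -(Real.sign (p t - ξ) * (f ξ - g ξ)) * φ (t, 0)

section Lip

variable {f g : ℝ → ℝ} {L : NNReal} (hf : LipschitzWith L f) (hg : LipschitzWith L g)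
include hf hg

lemma measurable_sflux {E : Type*} [MeasurableSpace E] {x s k : E → ℝ} (hx : Measurable x)
    (hs : Measurable s) (hk : Measurable k) : Measurable fun z => sflux f g (x z) (s z) (k z) :=
  Measurable.ite (measurableSet_lt measurable_const hx)
    ((continuous_kflux hf).measurable.comp (hs.prodMk hk))
    ((continuous_kflux hg).measurable.comp (hs.prodMk hk))

lemma abs_sflux_le (x s k : ℝ) : |sflux f g x s k| ≤ L * |s - k| := by
  unfold sflux
  split_ifs
  · exact abs_kflux_le hf _ _
  · exact abs_kflux_le hg _ _

end Lip

/-- `L¹` traces pass through the jointly Lipschitz Kružkov flux. Only the values of `Q` on one side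
matter, which lets a single discontinuous flux have traces built from `f` on the right and from `g`
on the left. -/
lemma TraceAt.kflux {f : ℝ → ℝ} {L : NNReal} (hf : LipschitzWith L f) {a b σ : ℝ}
    {u v : ℝ × ℝ → ℝ} {u' v' : ℝ → ℝ} (hu : Measurable u) (hv : Measurable v)
    (hu' : Measurable u') (hv' : Measurable v') (mu : ∀ z, u z ∈ Icc a b) (mv : ∀ z, v z ∈ Icc a b)
    (mu' : ∀ t, u' t ∈ Icc a b) (mv' : ∀ t, v' t ∈ Icc a b)
    (tu : TraceAt σ u u') (tv : TraceAt σ v v') {Q : ℝ × ℝ → ℝ}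
    (hQ : ∀ t x, 0 < σ * x → Q (t, x) = kflux f (u (t, x)) (v (t, x))) :
    TraceAt σ Q fun t => kflux f (u' t) (v' t) := by
  intro θ hθ hc hs h0
  have iθ := hθ.integrable_of_hasCompactSupport (μ := volume) hc
  have T := ((tu θ hθ hc hs h0).add (tv θ hθ hc hs h0)).const_mul (2 * (L : ℝ))
  rw [add_zero, mul_zero] at T
  have hint : ∀ {w : ℝ × ℝ → ℝ} {w' : ℝ → ℝ}, Measurable w → Measurable w' →
      (∀ z, w z ∈ Icc a b) → (∀ t, w' t ∈ Icc a b) → ∀ x,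
      Integrable fun t => |w (t, x) - w' t| * θ t := by
    intro w w' hw hw' mw mw' x
    refine iθ.bdd_mul (c := b - a) ?_ (Eventually.of_forall fun t => ?_)
    · exact ((hw.comp (measurable_id.prodMk measurable_const)).sub hw').abs.aestronglyMeasurable
    · rw [Real.norm_eq_abs, abs_abs]
      exact abs_sub_le_of_mem_Icc (mw _) (mw' _)
  refine squeeze_zero' (Eventually.of_forall fun x => integral_nonneg fun t =>
    mul_nonneg (abs_nonneg _) (h0 t)) ?_ T
  have hev : ∀ᶠ x in side σ, 0 < σ * x :=
    (eventually_mem_nhdsWithin (a := (0 : ℝ)) (s := {x | 0 < σ * x})).filter_mono inf_le_left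
  filter_upwards [hev] with x hx
  rw [← integral_add (hint hu hu' mu mu' x) (hint hv hv' mv mv' x), ← integral_const_mul]
  refine integral_mono_of_nonneg (Eventually.of_forall fun t => mul_nonneg (abs_nonneg _) (h0 t))
    (((hint hu hu' mu mu' x).add (hint hv hv' mv mv' x)).const_mul _)
    (Eventually.of_forall fun t => ?_)
  simp only [hQ t x hx]
  have := mul_le_mul_of_nonneg_right
    (abs_kflux_sub_le hf (u (t, x)) (v (t, x)) (u' t) (v' t)) (h0 t)
  linarith

lemma traceAt_const (σ c : ℝ) : TraceAt σ (fun _ => c) fun _ => c := by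
  intro θ _ _ _ _
  simpa using tendsto_const_nhds

lemma isOpen_halfPlane : IsOpen halfPlane := isOpen_Ioi.prod isOpen_univ

/-- Extension of a test function on the time axis to the half plane. -/
lemma exists_test_extension {θ : ℝ → ℝ} (hθ : ContDiff ℝ ∞ θ) (hc : HasCompactSupport θ)
    (hs : tsupport θ ⊆ Ioi 0) (h0 : ∀ t, 0 ≤ θ t) :
    ∃ φ : ℝ × ℝ → ℝ, (∃ C, LipschitzWith C φ) ∧ HasCompactSupport φ ∧ tsupport φ ⊆ halfPlane ∧
      (∀ z, 0 ≤ φ z) ∧ ∀ t, φ (t, 0) = θ t := by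
  let η : ContDiffBump (0 : ℝ) := ⟨1, 2, one_pos, one_lt_two⟩
  set φ : ℝ × ℝ → ℝ := fun z => θ z.1 * η z.2 with hφ
  have hcd : ContDiff ℝ ∞ φ := (hθ.comp contDiff_fst).mul (η.contDiff.comp contDiff_snd)
  have hsub : tsupport φ ⊆ tsupport θ ×ˢ tsupport η := by
    refine closure_minimal (fun z hz => ?_) ((isClosed_tsupport _).prod (isClosed_tsupport _))
    exact ⟨subset_tsupport _ (left_ne_zero_of_mul hz), subset_tsupport _ (right_ne_zero_of_mul hz)⟩
  have hcs : HasCompactSupport φ := (hc.isCompact.prod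
    η.hasCompactSupport.isCompact).of_isClosed_subset (isClosed_tsupport _) hsub
  refine ⟨φ, ⟨_, (hcd.lipschitzWith_of_hasCompactSupport hcs (by simp)).choose_spec⟩, hcs,
    fun z hz => ⟨hs (hsub hz).1, mem_univ _⟩, fun z => mul_nonneg (h0 _) η.nonneg, fun t => ?_⟩
  have : η 0 = 1 := η.one_of_mem_closedBall (by simp [η])
  simp [hφ, this]

namespace RegularSolution

variable {a b : ℝ} {f g : ℝ → ℝ} {L : NNReal} {u₀ v₀ : ℝ → ℝ} {u v : ℝ × ℝ → ℝ}
  {ul ur p vl vr q : ℝ → ℝ}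

/-- Localised at the interface, the entropy inequality for one level is an inequality between
functions of `t`, tested against every `θ ≥ 0`, hence valid almost everywhere. Countably many levels
share one null set, and continuity in the level supplies the rest. -/
lemma interfaceAdmissible (hf : LipschitzWith L f) (hg : LipschitzWith L g) (ha : f a = g a)
    (hb : f b = g b) (hu : RegularSolution a b f g u₀ u ul ur p) :
    ∀ᵐ t : ℝ, 0 < t → InterfaceAdmissible f g a b (p t) (ul t) (ur t) := by
  set Q : Set ℝ := (range ((↑) : ℚ → ℝ) ∪ {a, b}) ∩ Icc a b
  have hQ : Q.Countable :=
    ((countable_range _).union ((countable_singleton b).insert a)).mono inter_subset_left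
  have key : ∀ ξ ∈ Q, ∀ᵐ t : ℝ, t ∈ Ioi (0 : ℝ) →
      0 ≤ kflux g (ul t) ξ - kflux f (ur t) ξ - Real.sign (p t - ξ) * (f ξ - g ξ) := by
    intro ξ hξ
    have hξ : ξ ∈ Icc a b := hξ.2
    have hab : 0 ≤ b - a := sub_nonneg.2 (hξ.1.trans hξ.2)
    set K : ℝ := (1 + L) * (b - a) + |f ξ - g ξ| with hK
    have hL : (0 : ℝ) ≤ L := L.2
    have hLab := mul_nonneg hL hab
    have habs := abs_nonneg (f ξ - g ξ)
    have bnd : ∀ s ∈ Icc a b, L * |s - ξ| ≤ K := fun s hs => by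
      have := mul_le_mul_of_nonneg_left (abs_sub_le_of_mem_Icc hs hξ) hL
      rw [hK]; nlinarith
    have mA : Measurable fun z => |u z - ξ| := (hu.meas.sub_const ξ).abs
    have mB : Measurable fun z : ℝ × ℝ => sflux f g z.2 (u z) ξ :=
      measurable_sflux hf hg measurable_snd hu.meas measurable_const
    have mBl : Measurable fun t => kflux g (ul t) ξ :=
      (continuous_kflux hg).measurable.comp (hu.meas_l.prodMk measurable_const)
    have mBr : Measurable fun t => kflux f (ur t) ξ :=
      (continuous_kflux hf).measurable.comp (hu.meas_r.prodMk measurable_const)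
    have mS : Measurable fun t => -(Real.sign (p t - ξ) * (f ξ - g ξ)) :=
      ((measurable_real_sign.comp (hu.meas_p.sub_const ξ)).mul_const _).neg
    have kA : ∀ z, |(|u z - ξ|)| ≤ K := fun z => by
      rw [abs_abs]
      have := abs_sub_le_of_mem_Icc (hu.mem z) hξ
      rw [hK]; nlinarith
    have kB : ∀ z : ℝ × ℝ, |sflux f g z.2 (u z) ξ| ≤ K := fun z =>
      (abs_sflux_le hf hg _ _ _).trans (bnd _ (hu.mem z))
    have kBl : ∀ t, |kflux g (ul t) ξ| ≤ K := fun t =>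
      (abs_kflux_le hg _ _).trans (bnd _ (hu.mem_l t))
    have kBr : ∀ t, |kflux f (ur t) ξ| ≤ K := fun t =>
      (abs_kflux_le hf _ _).trans (bnd _ (hu.mem_r t))
    have kS : ∀ t, |-(Real.sign (p t - ξ) * (f ξ - g ξ))| ≤ K := fun t => by
      rw [abs_neg, abs_mul]
      have := mul_le_mul_of_nonneg_right (abs_real_sign_le (p t - ξ)) habs
      rw [hK]; nlinarith
    have trl : TraceAt (-1) (fun z : ℝ × ℝ => sflux f g z.2 (u z) ξ) fun t => kflux g (ul t) ξ :=
      TraceAt.kflux hg hu.meas measurable_const hu.meas_l measurable_const hu.mem (fun _ => hξ)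
        hu.mem_l (fun _ => hξ) hu.trace_l (traceAt_const _ ξ)
        (fun t x hx => if_neg (by linarith))
    have trr : TraceAt 1 (fun z : ℝ × ℝ => sflux f g z.2 (u z) ξ) fun t => kflux f (ur t) ξ :=
      TraceAt.kflux hf hu.meas measurable_const hu.meas_r measurable_const hu.mem (fun _ => hξ)
        hu.mem_r (fun _ => hξ) hu.trace_r (traceAt_const _ ξ)
        (fun t x hx => if_pos (by linarith))
    have mG := (mBl.sub mBr).add mS
    have hloc : LocallyIntegrable
        (fun t => kflux g (ul t) ξ - kflux f (ur t) ξ - Real.sign (p t - ξ) * (f ξ - g ξ))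
        volume := by
      refine locallyIntegrable_of_abs_le (K := K + K + K) ?_ fun t => ?_
      · exact mG.aestronglyMeasurable
      · have h1 := kBl t
        have h2 := kBr t
        have h3 := kS t
        rw [abs_le] at h1 h2 h3 ⊢
        constructor <;> linarith
    refine ae_nonneg_of_mollify_nonneg isOpen_Ioi hloc fun θ hθ hc hs h0 => ?_
    obtain ⟨φ, ⟨C, hC⟩, hφc, hφs, hφ0, hφθ⟩ := exists_test_extension hθ hc hs h0
    have := interface_inequality mA mB mBl mBr mS kA kB kBl kBr kS trl trr
      (hu.entropy ξ hξ) hC hφc hφs hφ0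
    simp only [hφθ] at this
    have iθ := hθ.continuous.integrable_of_hasCompactSupport (μ := volume) hc
    have i1 := iθ.bdd_mul mBl.aestronglyMeasurable (Eventually.of_forall kBl)
    have i2 := iθ.bdd_mul mBr.aestronglyMeasurable (Eventually.of_forall kBr)
    have i3 := iθ.bdd_mul mS.aestronglyMeasurable (Eventually.of_forall kS)
    have i12 : Integrable fun t => kflux g (ul t) ξ * θ t - kflux f (ur t) ξ * θ t := i1.sub i2
    rw [← integral_sub i1 i2, ← integral_add i12 i3] at this
    refine this.trans_eq (integral_congr_ae (Eventually.of_forall fun t => ?_))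
    beta_reduce
    ring
  filter_upwards [(ae_ball_iff hQ).2 key] with t ht ht0
  exact interfaceAdmissible_of_countable hf.continuous hg.continuous ha hb
    fun ξ hξ => ht ξ hξ ht0

lemma kruzkovOn_right (hu : RegularSolution a b f g u₀ u ul ur p) :
    KruzkovOn (halfPlane ∩ {z | 0 < 1 * z.2}) f a b u := by
  intro ξ hξ φ hφ hc hs h0
  have h := hu.entropy ξ hξ φ hφ hc (hs.trans inter_subset_left) h0
  have hφ0 : ∀ t, φ (t, 0) = 0 := fun t =>
    image_eq_zero_of_notMem_tsupport fun h => by simpa using (hs h).2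
  simp only [hφ0, mul_zero, integral_zero, add_zero] at h
  refine h.trans_eq (integral_congr_ae (Eventually.of_forall fun z => ?_))
  by_cases hz : z ∈ halfPlane ∩ {z : ℝ × ℝ | 0 < 1 * z.2}
  · have : 0 < z.2 := by simpa using hz.2
    simp only [sflux, if_pos this]
  · simp [partialX, partialT, fderiv_eq_zero_of_notMem_tsupport hs hz]

lemma kruzkovOn_left (hu : RegularSolution a b f g u₀ u ul ur p) :
    KruzkovOn (halfPlane ∩ {z | 0 < -1 * z.2}) g a b u := by
  intro ξ hξ φ hφ hc hs h0
  have h := hu.entropy ξ hξ φ hφ hc (hs.trans inter_subset_left) h0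
  have hφ0 : ∀ t, φ (t, 0) = 0 := fun t =>
    image_eq_zero_of_notMem_tsupport fun h => by simpa using (hs h).2
  simp only [hφ0, mul_zero, integral_zero, add_zero] at h
  refine h.trans_eq (integral_congr_ae (Eventually.of_forall fun z => ?_))
  by_cases hz : z ∈ halfPlane ∩ {z : ℝ × ℝ | 0 < -1 * z.2}
  · have : ¬ 0 < z.2 := by have := hz.2; simp only [mem_ofPred_eq] at this; linarith
    simp only [sflux, if_neg this]
  · simp [partialX, partialT, fderiv_eq_zero_of_notMem_tsupport hs hz]

/-- Kato's inequality across the interface. -/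
theorem kato (hf : LipschitzWith L f) (hg : LipschitzWith L g) (ha : f a = g a) (hb : f b = g b)
    (hu : RegularSolution a b f g u₀ u ul ur p) (hv : RegularSolution a b f g v₀ v vl vr q)
    {φ : ℝ × ℝ → ℝ} {C : NNReal} (hφ : LipschitzWith C φ) (hc : HasCompactSupport φ)
    (hs : tsupport φ ⊆ halfPlane) (h0 : ∀ z, 0 ≤ φ z) :
    0 ≤ ∫ z, (|u z - v z| * partialT φ z + sflux f g z.2 (u z) (v z) * partialX φ z) := by
  have hab : 0 ≤ b - a := sub_nonneg.2 ((hu.mem 0).1.trans (hu.mem 0).2)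
  set K : ℝ := (1 + L) * (b - a) with hK
  have hL : (0 : ℝ) ≤ L := L.2
  have hLab := mul_nonneg hL hab
  have bnd : ∀ s ∈ Icc a b, ∀ k ∈ Icc a b, L * |s - k| ≤ K := fun s hs k hk => by
    have := mul_le_mul_of_nonneg_left (abs_sub_le_of_mem_Icc hs hk) hL
    rw [hK]; nlinarith
  have mA : Measurable fun z => |u z - v z| := (hu.meas.sub hv.meas).abs
  have kA : ∀ z, |(|u z - v z|)| ≤ K := fun z => by
    rw [abs_abs]
    have := abs_sub_le_of_mem_Icc (hu.mem z) (hv.mem z)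
    rw [hK]; nlinarith
  have mB : Measurable fun z : ℝ × ℝ => sflux f g z.2 (u z) (v z) :=
    measurable_sflux hf hg measurable_snd hu.meas hv.meas
  have kB : ∀ z : ℝ × ℝ, |sflux f g z.2 (u z) (v z)| ≤ K := fun z =>
    (abs_sflux_le hf hg _ _ _).trans (bnd _ (hu.mem z) _ (hv.mem z))
  have mBl : Measurable fun t => kflux g (ul t) (vl t) :=
    (continuous_kflux hg).measurable.comp (hu.meas_l.prodMk hv.meas_l)
  have mBr : Measurable fun t => kflux f (ur t) (vr t) :=
    (continuous_kflux hf).measurable.comp (hu.meas_r.prodMk hv.meas_r)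
  have kBl : ∀ t, |kflux g (ul t) (vl t)| ≤ K := fun t =>
    (abs_kflux_le hg _ _).trans (bnd _ (hu.mem_l t) _ (hv.mem_l t))
  have kBr : ∀ t, |kflux f (ur t) (vr t)| ≤ K := fun t =>
    (abs_kflux_le hf _ _).trans (bnd _ (hu.mem_r t) _ (hv.mem_r t))
  have trl : TraceAt (-1) (fun z : ℝ × ℝ => sflux f g z.2 (u z) (v z))
      fun t => kflux g (ul t) (vl t) :=
    TraceAt.kflux hg hu.meas hv.meas hu.meas_l hv.meas_l hu.mem hv.mem hu.mem_l hv.mem_l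
      hu.trace_l hv.trace_l (fun t x hx => if_neg (by linarith))
  have trr : TraceAt 1 (fun z : ℝ × ℝ => sflux f g z.2 (u z) (v z))
      fun t => kflux f (ur t) (vr t) :=
    TraceAt.kflux hf hu.meas hv.meas hu.meas_r hv.meas_r hu.mem hv.mem hu.mem_r hv.mem_r
      hu.trace_r hv.trace_r (fun t x hx => if_pos (by linarith))
  have openSide : ∀ σ : ℝ, IsOpen (halfPlane ∩ {z : ℝ × ℝ | 0 < σ * z.2}) := fun σ =>
    isOpen_halfPlane.inter (isOpen_lt continuous_const (by fun_prop))
  -- On each open side the flux is a single Lipschitz function and the doubling argument applies;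
  -- what remains is the pair of boundary terms at `x = 0`.
  have R := half_inequality (Or.inl rfl) mA mB mBr kA kB kBr trr (fun ψ h1 h2 h3 h4 => by
    have := kato_of_kruzkovOn (openSide 1) hf hu.meas hv.meas hu.mem hv.mem hu.kruzkovOn_right
      hv.kruzkovOn_right h1 h2 h3 h4
    refine this.trans_eq (integral_congr_ae (Eventually.of_forall fun z => ?_))
    by_cases hz : z ∈ halfPlane ∩ {z : ℝ × ℝ | 0 < 1 * z.2}
    · have : 0 < z.2 := by simpa using hz.2
      simp only [sflux, if_pos this]
    · simp [partialX, partialT, fderiv_eq_zero_of_notMem_tsupport h3 hz]) hφ hc hs h0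
  have Lf := half_inequality (Or.inr rfl) mA mB mBl kA kB kBl trl (fun ψ h1 h2 h3 h4 => by
    have := kato_of_kruzkovOn (openSide (-1)) hg hu.meas hv.meas hu.mem hv.mem hu.kruzkovOn_left
      hv.kruzkovOn_left h1 h2 h3 h4
    refine this.trans_eq (integral_congr_ae (Eventually.of_forall fun z => ?_))
    by_cases hz : z ∈ halfPlane ∩ {z : ℝ × ℝ | 0 < -1 * z.2}
    · have : ¬ 0 < z.2 := by have := hz.2; simp only [mem_ofPred_eq] at this; linarith
      simp only [sflux, if_neg this]
    · simp [partialX, partialT, fderiv_eq_zero_of_notMem_tsupport h3 hz]) hφ hc hs h0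
  have iG : Integrable fun z =>
      |u z - v z| * partialT φ z + sflux f g z.2 (u z) (v z) * partialX φ z :=
    (integrable_mul_partial mA kA hφ hc (1, 0)).add (integrable_mul_partial mB kB hφ hc (0, 1))
  have hsplit := integral_sides_add iG
  -- The balance of these boundary terms is where the interface conditions on the traces enter.
  have hint : ∫ t, kflux f (ur t) (vr t) * φ (t, 0) ≤ ∫ t, kflux g (ul t) (vl t) * φ (t, 0) := by
    obtain ⟨θ, hθ, hθc, -, -, hd⟩ := exists_dominating hφ.continuous hc hs
    have iφ := integrable_slice hφ.continuous hθ hθc hd 0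
    refine integral_mono_ae
      (iφ.bdd_mul mBr.aestronglyMeasurable (Eventually.of_forall kBr))
      (iφ.bdd_mul mBl.aestronglyMeasurable (Eventually.of_forall kBl)) ?_
    filter_upwards [hu.interfaceAdmissible hf hg ha hb, hv.interfaceAdmissible hf hg ha hb]
      with t h1 h2
    by_cases ht : 0 < t
    · exact mul_le_mul_of_nonneg_right ((h1 ht).kflux_le (h2 ht) (hu.mem_l t) (hu.mem_r t)
        (hv.mem_l t) (hv.mem_r t) ha hb) (h0 _)
    · have : φ (t, 0) = 0 := image_eq_zero_of_notMem_tsupport fun h => ht (hs h).1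
      simp [this]
  rw [hsplit]
  linarith

end RegularSolution

/-! ### Lipschitz potential of a bounded divergence-free field -/

lemma intervalIntegrable_of_abs_le {h : ℝ → ℝ} (hm : Measurable h) {K : ℝ} (hK : ∀ x, |h x| ≤ K)
    (x y : ℝ) : IntervalIntegrable h volume x y :=
  intervalIntegrable_iff.mpr <|
    ((locallyIntegrable_of_abs_le hm.aestronglyMeasurable hK).integrableOn_isCompact
      isCompact_uIcc).mono_set uIoc_subset_uIcc

lemma continuous_primitive_of_abs_le {h : ℝ → ℝ} (hm : Measurable h) {K : ℝ}
    (hK : ∀ x, |h x| ≤ K) (c : ℝ) : Continuous fun x => ∫ y in c..x, h y :=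
  intervalIntegral.continuous_primitive (fun x y => intervalIntegrable_of_abs_le hm hK x y) c

lemma hasDerivAt_slice_fst {φ : ℝ × ℝ → ℝ} {z : ℝ × ℝ} (h : DifferentiableAt ℝ φ z) :
    HasDerivAt (fun t => φ (t, z.2)) (partialT φ z) z.1 := by
  have h1 : HasDerivAt (fun t : ℝ => (t, z.2)) ((1 : ℝ), (0 : ℝ)) z.1 :=
    (hasDerivAt_id z.1).prodMk (hasDerivAt_const z.1 z.2)
  exact h.hasFDerivAt.comp_hasDerivAt z.1 h1

lemma hasDerivAt_slice_snd {φ : ℝ × ℝ → ℝ} {z : ℝ × ℝ} (h : DifferentiableAt ℝ φ z) :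
    HasDerivAt (fun x => φ (z.1, x)) (partialX φ z) z.2 := by
  have h1 : HasDerivAt (fun x : ℝ => (z.1, x)) ((0 : ℝ), (1 : ℝ)) z.2 :=
    (hasDerivAt_const z.2 z.1).prodMk (hasDerivAt_id z.2)
  exact h.hasFDerivAt.comp_hasDerivAt z.2 h1

/-- The divergence theorem on rectangles for smooth fields. -/
lemma integral_rectangle_of_div_free {W G : ℝ × ℝ → ℝ} (hW : ContDiff ℝ ∞ W)
    (hG : ContDiff ℝ ∞ G) (hdiv : ∀ z, partialT W z + partialX G z = 0) (τ t x₁ x₂ : ℝ) :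
    (∫ y in x₁..x₂, W (t, y)) - ∫ y in x₁..x₂, W (τ, y) =
      -((∫ s in τ..t, G (s, x₂)) - ∫ s in τ..t, G (s, x₁)) := by
  have cWT : Continuous (partialT W) := continuous_fderiv_apply_const hW _
  have cGX : Continuous (partialX G) := continuous_fderiv_apply_const hG _
  have e1 : ∀ y, W (t, y) - W (τ, y) = ∫ s in τ..t, partialT W (s, y) := fun y => by
    refine (intervalIntegral.integral_eq_sub_of_hasDerivAt (f := fun s => W (s, y))
      (fun s _ => ?_) ?_).symm
    · exact hasDerivAt_slice_fst (z := (s, y)) (hW.differentiable (by simp) _)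
    · exact Continuous.intervalIntegrable (by fun_prop) _ _
  have e2 : ∀ s, G (s, x₂) - G (s, x₁) = ∫ y in x₁..x₂, partialX G (s, y) := fun s => by
    refine (intervalIntegral.integral_eq_sub_of_hasDerivAt (f := fun y => G (s, y))
      (fun y _ => ?_) ?_).symm
    · exact hasDerivAt_slice_snd (z := (s, y)) (hG.differentiable (by simp) _)
    · exact Continuous.intervalIntegrable (by fun_prop) _ _
  have cW := hW.continuous
  have cG := hG.continuous
  rw [← intervalIntegral.integral_sub, ← intervalIntegral.integral_sub,
    ← intervalIntegral.integral_neg]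
  · simp_rw [e1, e2, ← intervalIntegral.integral_neg]
    rw [intervalIntegral_intervalIntegral_swap]
    · refine intervalIntegral.integral_congr fun s _ => intervalIntegral.integral_congr fun y _ => ?_
      have := hdiv (s, y)
      linarith
    · have hc : Continuous (Function.uncurry fun y s => partialT W (s, y)) := by fun_prop
      exact (hc.continuousOn.integrableOn_compact (isCompact_uIcc.prod isCompact_uIcc)).mono_set
        (prod_mono uIoc_subset_uIcc uIoc_subset_uIcc)
  all_goals exact Continuous.intervalIntegrable (by fun_prop) _ _

/-- The rectangle identity for bounded divergence-free fields. -/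
lemma ae_integral_rectangle {W G : ℝ × ℝ → ℝ} {K : ℝ} (hW : Measurable W) (hG : Measurable G)
    (hWK : ∀ z, |W z| ≤ K) (hGK : ∀ z, |G z| ≤ K)
    (hdiv : ∀ φ : ℝ × ℝ → ℝ, ContDiff ℝ ∞ φ → HasCompactSupport φ →
      ∫ z, (W z * partialT φ z + G z * partialX φ z) = 0) :
    ∃ S X : Set ℝ, (∀ᵐ t, t ∈ S) ∧ (∀ᵐ x, x ∈ X) ∧ ∀ τ ∈ S, ∀ t ∈ S, ∀ x₁ ∈ X, ∀ x₂ ∈ X,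
      (∫ y in x₁..x₂, W (t, y)) - ∫ y in x₁..x₂, W (τ, y) =
      -((∫ s in τ..t, G (s, x₂)) - ∫ s in τ..t, G (s, x₁)) := by
  have lW := locallyIntegrable_of_abs_le hW.aestronglyMeasurable hWK
  have lG := locallyIntegrable_of_abs_le hG.aestronglyMeasurable hGK
  -- The good rows and columns are those along which the mollified fields converge almost
  -- everywhere. The rectangle identity is exact for the mollified fields and passes to the limit on
  -- rectangles with such sides.
  refine ⟨{t | ∀ᵐ y, Tendsto (fun n => mollify n W (t, y)) atTop (𝓝 (W (t, y)))},
    {x | ∀ᵐ s, Tendsto (fun n => mollify n G (s, x)) atTop (𝓝 (G (s, x)))}, ?_, ?_, ?_⟩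
  · have := ae_tendsto_mollify lW
    rw [Measure.volume_eq_prod] at this
    exact Measure.ae_ae_of_ae_prod this
  · have := ae_tendsto_mollify lG
    rw [Measure.volume_eq_prod, ← Measure.prod_swap] at this
    exact Measure.ae_ae_of_ae_prod (ae_of_ae_map measurable_swap.aemeasurable this)
  intro τ hτ t ht x₁ hx₁ x₂ hx₂
  have id_n : ∀ n, (∫ y in x₁..x₂, mollify n W (t, y)) - ∫ y in x₁..x₂, mollify n W (τ, y) =
      -((∫ s in τ..t, mollify n G (s, x₂)) - ∫ s in τ..t, mollify n G (s, x₁)) := by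
    intro n
    refine integral_rectangle_of_div_free (contDiff_mollify n lW) (contDiff_mollify n lG)
      (fun z => ?_) τ t x₁ x₂
    have hc : HasCompactSupport (fun y : ℝ × ℝ => mollifier n (z - y)) :=
      (hasCompactSupport_mollifier n).comp_homeomorph (Homeomorph.subLeft z)
    have hcd : ContDiff ℝ ∞ (fun y : ℝ × ℝ => mollifier n (z - y)) :=
      (contDiff_mollifier n).comp (contDiff_const.sub contDiff_id)
    have h := hdiv _ hcd hc
    have hd : ∀ y, DifferentiableAt ℝ (mollifier n) (z - y) := fun y =>
      (contDiff_mollifier n).differentiable (by simp) _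
    have hi : ∀ (v : ℝ × ℝ) {F : ℝ × ℝ → ℝ}, Measurable F → (∀ z, |F z| ≤ K) →
        Integrable fun y => fderiv ℝ (mollifier n) (z - y) v * F y := by
      intro v F hF hFK
      have := integrable_bounded_mul_of_compactSupport hF hFK (c := fun y =>
        fderiv ℝ (mollifier n) (z - y) v)
        ((continuous_fderiv_apply_const (contDiff_mollifier n) v).comp
          (continuous_const.sub continuous_id))
        ((hasCompactSupport_fderiv_apply (hasCompactSupport_mollifier n) v).comp_homeomorph
          (Homeomorph.subLeft z))
      simpa only [mul_comm] using this
    rw [partialT, partialX, fderiv_mollify_apply n lW, fderiv_mollify_apply n lG,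
      ← integral_add (hi _ hW hWK) (hi _ hG hGK), ← neg_eq_zero, ← integral_neg]
    refine Eq.trans (integral_congr_ae (Eventually.of_forall fun y => ?_)) h
    simp only [partialT, partialX, fderiv_comp_const_sub_apply (hd y)]
    ring
  have lim : ∀ {F : ℝ × ℝ → ℝ} (γ : ℝ → ℝ × ℝ), Continuous γ → LocallyIntegrable F volume →
      (∀ z, |F z| ≤ K) → (∀ᵐ y, Tendsto (fun n => mollify n F (γ y)) atTop (𝓝 (F (γ y)))) →
      ∀ c d, Tendsto (fun n => ∫ y in c..d, mollify n F (γ y)) atTop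
        (𝓝 (∫ y in c..d, F (γ y))) := by
    intro F γ hγ lF hFK hae c d
    refine intervalIntegral.tendsto_integral_filter_of_dominated_convergence (fun _ => K) ?_ ?_ ?_ ?_
    · exact Eventually.of_forall fun n =>
        ((contDiff_mollify n lF).continuous.comp hγ).aestronglyMeasurable
    · exact Eventually.of_forall fun n => Eventually.of_forall fun y _ => abs_mollify_le n hFK _
    · exact intervalIntegrable_const
    · exact hae.mono fun y hy _ => hy
  have l1 := lim (fun y => (t, y)) (by fun_prop) lW hWK ht x₁ x₂
  have l2 := lim (fun y => (τ, y)) (by fun_prop) lW hWK hτ x₁ x₂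
  have l3 := lim (fun s => (s, x₂)) (by fun_prop) lG hGK hx₂ τ t
  have l4 := lim (fun s => (s, x₁)) (by fun_prop) lG hGK hx₁ τ t
  refine tendsto_nhds_unique (l1.sub l2) ?_
  simp_rw [id_n]
  exact (l3.sub l4).neg

lemma abs_intervalIntegral_le {h : ℝ → ℝ} {K : ℝ} (hK : ∀ x, |h x| ≤ K) (x y : ℝ) :
    |∫ s in x..y, h s| ≤ K * |y - x| := by
  have := intervalIntegral.norm_integral_le_of_norm_le_const (a := x) (b := y)
    (fun s _ => (Real.norm_eq_abs (h s)).le.trans (hK s))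
  simpa using this

/-- A bounded divergence-free field which is trivial for negative times has a Lipschitz
potential. -/
theorem exists_potential {W G : ℝ × ℝ → ℝ} {w₀ : ℝ → ℝ} {K : ℝ} (hW : Measurable W)
    (hG : Measurable G) (hw₀ : Measurable w₀) (hWK : ∀ z, |W z| ≤ K) (hGK : ∀ z, |G z| ≤ K)
    (hw₀K : ∀ x, |w₀ x| ≤ K) (hG0 : ∀ z : ℝ × ℝ, z.1 ≤ 0 → G z = 0)
    (hW0 : ∀ z : ℝ × ℝ, z.1 ≤ 0 → W z = w₀ z.2)
    (hdiv : ∀ φ : ℝ × ℝ → ℝ, ContDiff ℝ ∞ φ → HasCompactSupport φ →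
      ∫ z, (W z * partialT φ z + G z * partialX φ z) = 0) :
    ∃ (D : ℝ × ℝ → ℝ) (C : NNReal), LipschitzWith C D ∧
      (∀ x, D (0, x) = ∫ y in 0..x, w₀ y) ∧
      (∀ᵐ t, ∀ x₁ x₂, D (t, x₂) - D (t, x₁) = ∫ y in x₁..x₂, W (t, y)) ∧
      ∀ᵐ z, partialT D z = -G z ∧ partialX D z = W z := by
  obtain ⟨S, X, hS, hX, hrec⟩ := ae_integral_rectangle hW hG hWK hGK hdiv
  have hK : 0 ≤ K := (abs_nonneg _).trans (hw₀K 0)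
  have dS : Dense S := Measure.dense_of_ae hS
  have dX : Dense X := Measure.dense_of_ae hX
  have mWt : ∀ t, Measurable fun y => W (t, y) := fun t =>
    hW.comp (measurable_const.prodMk measurable_id)
  have mGx : ∀ x, Measurable fun s => G (s, x) := fun x =>
    hG.comp (measurable_id.prodMk measurable_const)
  -- Integrate along `t = 0` and then vertically. This is reliable only on good columns, so the
  -- potential is later obtained by extension from there.
  set D₁ : ℝ × ℝ → ℝ := fun z => (∫ y in 0..z.2, w₀ y) - ∫ s in 0..z.1, G (s, z.2) with hD₁
  have row : ∀ t ∈ S, ∀ x₁ ∈ X, ∀ x₂ ∈ X, D₁ (t, x₂) - D₁ (t, x₁) = ∫ y in x₁..x₂, W (t, y) := by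
    intro t ht x₁ hx₁ x₂ hx₂
    -- A good row at negative time exists by density; on it the field is the initial datum, and the
    -- vertical flux vanishes between it and time zero. The row `t = 0` itself need not be good.
    obtain ⟨τ, hτ, hτ0⟩ := dS.exists_lt (0 : ℝ)
    have h := hrec τ hτ t ht x₁ hx₁ x₂ hx₂
    have iw := fun c d => intervalIntegrable_of_abs_le hw₀ hw₀K c d
    have iG := fun x c d => intervalIntegrable_of_abs_le (mGx x) (fun s => hGK (s, x)) c d
    have e1 : ∫ y in x₁..x₂, W (τ, y) = (∫ y in 0..x₂, w₀ y) - ∫ y in 0..x₁, w₀ y := by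
      rw [intervalIntegral.integral_interval_sub_left (iw _ _) (iw _ _)]
      exact intervalIntegral.integral_congr fun y _ => hW0 (τ, y) hτ0.le
    have e2 : ∀ x, ∫ s in τ..t, G (s, x) = ∫ s in 0..t, G (s, x) := fun x => by
      rw [← intervalIntegral.integral_add_adjacent_intervals (iG x τ 0) (iG x 0 t)]
      have : ∫ s in τ..0, G (s, x) = ∫ s in τ..0, (0 : ℝ) :=
        intervalIntegral.integral_congr fun s hs => hG0 (s, x) (by
          rw [uIcc_of_le hτ0.le] at hs; exact hs.2)
      rw [this, intervalIntegral.integral_zero, zero_add]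
    rw [e1, e2, e2] at h
    simp only [hD₁]
    linarith
  have cD₁t : ∀ x, Continuous fun t => D₁ (t, x) := fun x => by
    have h : Continuous fun t => (∫ y in (0 : ℝ)..x, w₀ y) - ∫ s in (0 : ℝ)..t, G (s, x) :=
      continuous_const.sub (continuous_primitive_of_abs_le (mGx x) (fun s => hGK (s, x)) 0)
    exact h
  have lipt : ∀ t t' x, |D₁ (t, x) - D₁ (t', x)| ≤ K * |t - t'| := by
    intro t t' x
    have iG := fun c d => intervalIntegrable_of_abs_le (mGx x) (fun s => hGK (s, x)) c d
    have e : D₁ (t, x) - D₁ (t', x) = ∫ s in t..t', G (s, x) := by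
      rw [← intervalIntegral.integral_interval_sub_left (iG 0 t') (iG 0 t)]
      simp only [hD₁]
      ring
    rw [e, abs_sub_comm t]
    exact abs_intervalIntegral_le (fun s => hGK (s, x)) t t'
  have lipx : ∀ x₁ ∈ X, ∀ x₂ ∈ X, ∀ t, |D₁ (t, x₂) - D₁ (t, x₁)| ≤ K * |x₂ - x₁| := by
    intro x₁ hx₁ x₂ hx₂ t
    have hcl : IsClosed {t | |D₁ (t, x₂) - D₁ (t, x₁)| ≤ K * |x₂ - x₁|} :=
      isClosed_le ((cD₁t x₂).sub (cD₁t x₁)).abs continuous_const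
    refine hcl.closure_subset_iff.2 (fun t ht => ?_) (dS t)
    rw [mem_ofPred_eq, row t ht x₁ hx₁ x₂ hx₂]
    exact abs_intervalIntegral_le (fun y => hWK (t, y)) x₁ x₂
  -- The bound `K` in each variable, with the sup distance on the plane, gives `2 * K`. The
  -- Lipschitz extension from the dense set of good columns then has all its rows continuous.
  have hlip : LipschitzOnWith ⟨2 * K, by positivity⟩ D₁ (univ ×ˢ X) := by
    refine LipschitzOnWith.of_dist_le_mul fun z hz z' hz' => ?_
    have h1 := lipt z.1 z'.1 z.2
    have h2 := lipx z'.2 hz'.2 z.2 hz.2 z'.1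
    have h3 : dist (D₁ z) (D₁ z') ≤ |D₁ (z.1, z.2) - D₁ (z'.1, z.2)| +
      |D₁ (z'.1, z.2) - D₁ (z'.1, z'.2)| := abs_sub_le _ _ _
    have h4 : |z.1 - z'.1| ≤ dist z z' := by rw [Prod.dist_eq]; exact le_max_left _ _
    have h5 : |z.2 - z'.2| ≤ dist z z' := by rw [Prod.dist_eq]; exact le_max_right _ _
    change _ ≤ 2 * K * dist z z'
    nlinarith
  obtain ⟨D, hD, hDeq⟩ := hlip.extend_real
  have hDX : ∀ t, ∀ x ∈ X, D (t, x) = D₁ (t, x) := fun t x hx => (hDeq ⟨mem_univ _, hx⟩).symm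
  have cD := hD.continuous
  have crow : ∀ t c, Continuous fun x => ∫ y in c..x, W (t, y) := fun t c =>
    continuous_primitive_of_abs_le (mWt t) (fun y => hWK (t, y)) c
  have hrow : ∀ t ∈ S, ∀ x₁ x₂, D (t, x₂) - D (t, x₁) = ∫ y in x₁..x₂, W (t, y) := by
    intro t ht
    have h1 : ∀ x₁ ∈ X, ∀ x₂, D (t, x₂) - D (t, x₁) = ∫ y in x₁..x₂, W (t, y) := by
      intro x₁ hx₁ x₂
      refine congrFun (Continuous.ext_on dX (f := fun x₂ => D (t, x₂) - D (t, x₁)) (by fun_prop) (crow t x₁) fun x₂ hx₂ => ?_) x₂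
      beta_reduce
      rw [hDX t x₂ hx₂, hDX t x₁ hx₁, row t ht x₁ hx₁ x₂ hx₂]
    obtain ⟨c, hc⟩ := dX.nonempty
    intro x₁ x₂
    have iW := fun d e => intervalIntegrable_of_abs_le (mWt t) (fun y => hWK (t, y)) d e
    rw [← intervalIntegral.integral_interval_sub_left (iW c x₂) (iW c x₁), ← h1 c hc, ← h1 c hc]
    ring
  have hdiff := hD.ae_differentiableAt (μ := (volume : Measure (ℝ × ℝ)))
  have mdiff : MeasurableSet {z | DifferentiableAt ℝ D z} := measurableSet_of_differentiableAt ℝ D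
  have mT : Measurable (partialT D) := measurable_fderiv_apply_const ℝ D _
  have mX : Measurable (partialX D) := measurable_fderiv_apply_const ℝ D _
  refine ⟨D, _, hD, ?_, hS.mono hrow, ?_⟩
  · intro x
    refine congrFun (Continuous.ext_on dX (f := fun x => D (0, x)) (by fun_prop)
      (continuous_primitive_of_abs_le hw₀ hw₀K 0) fun x hx => ?_) x
    simp [hDX 0 x hx, hD₁]
  -- Each partial derivative is identified by Lebesgue differentiation on slices, then transferred
  -- to almost every point by Fubini. Restricting to differentiability points makes the slice
  -- derivative agree with the Fréchet derivative.
  · have hx : ∀ᵐ z : ℝ × ℝ, DifferentiableAt ℝ D z → partialX D z = W z := by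
      have hm : MeasurableSet {z | DifferentiableAt ℝ D z → partialX D z = W z} := by
        have : {z | DifferentiableAt ℝ D z → partialX D z = W z} =
            {z | DifferentiableAt ℝ D z}ᶜ ∪ {z | partialX D z = W z} := by
          ext z; simp [imp_iff_not_or]
        rw [this]
        exact mdiff.compl.union (measurableSet_eq_fun mX hW)
      rw [Measure.volume_eq_prod, Measure.ae_prod_iff_ae_ae hm]
      filter_upwards [hS] with t ht
      filter_upwards [LocallyIntegrable.ae_hasDerivAt_integral (locallyIntegrable_of_abs_le (mWt t).aestronglyMeasurable
        (fun y => hWK (t, y)))] with x hx hd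
      refine (hasDerivAt_slice_snd hd).unique ?_
      have e : (fun x => D (t, x)) = fun x => D (t, 0) + ∫ y in 0..x, W (t, y) := by
        ext x; rw [← hrow t ht]; ring
      change HasDerivAt (fun x => D (t, x)) _ _
      rw [e]
      exact (hx 0).const_add _
    have ht : ∀ᵐ z : ℝ × ℝ, DifferentiableAt ℝ D z → partialT D z = -G z := by
      have hm : MeasurableSet {z | DifferentiableAt ℝ D z → partialT D z = -G z} := by
        have : {z | DifferentiableAt ℝ D z → partialT D z = -G z} =
            {z | DifferentiableAt ℝ D z}ᶜ ∪ {z | partialT D z = -G z} := by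
          ext z; simp [imp_iff_not_or]
        rw [this]
        exact mdiff.compl.union (measurableSet_eq_fun mT hG.neg)
      rw [Measure.volume_eq_prod, Measure.ae_prod_iff_ae_ae hm, Measure.ae_ae_comm hm]
      filter_upwards [hX] with x hx
      filter_upwards [LocallyIntegrable.ae_hasDerivAt_integral (locallyIntegrable_of_abs_le (mGx x).aestronglyMeasurable
        (fun y => hGK (y, x)))] with t ht hd
      refine (hasDerivAt_slice_fst hd).unique ?_
      have e : (fun t => D (t, x)) = fun t => (∫ y in 0..x, w₀ y) - ∫ s in 0..t, G (s, x) := by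
        ext t; rw [hDX t x hx]
      change HasDerivAt (fun t => D (t, x)) _ _
      rw [e]
      exact (ht 0).const_sub _
    filter_upwards [hdiff, hx, ht] with z h1 h2 h3 using ⟨h3 h1, h2 h1⟩

/-! ### The maximum principle on backward cones -/

lemma ae_ae_slice_fst {p : ℝ × ℝ → Prop} (h : ∀ᵐ z, p z) : ∀ᵐ y : ℝ, ∀ᵐ τ : ℝ, p (τ, y) := by
  rw [Measure.volume_eq_prod, ← Measure.prod_swap] at h
  exact Measure.ae_ae_of_ae_prod (ae_of_ae_map measurable_swap.aemeasurable h)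

/-- The squared positive part. -/
noncomputable def posSq (s : ℝ) : ℝ := max s 0 * max s 0

lemma posSq_nonneg (s : ℝ) : 0 ≤ posSq s := mul_self_nonneg _

lemma posSq_of_nonpos {s : ℝ} (hs : s ≤ 0) : posSq s = 0 := by simp [posSq, hs]

lemma posSq_pos {s : ℝ} (hs : 0 < s) : 0 < posSq s := by
  rw [posSq, max_eq_left hs.le]; positivity

/-- Squaring removes the corner of the positive part: the chain rule holds wherever the inner
function is differentiable, with no exceptional level set. -/
lemma hasDerivAt_posSq (s : ℝ) : HasDerivAt posSq (2 * max s 0) s := by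
  have c : Continuous fun s : ℝ => max s 0 := by fun_prop
  have hne : ∀ y : ℝ, y ≠ 0 → HasDerivAt posSq (2 * max y 0) y := by
    intro y hy
    rcases lt_or_gt_of_ne hy with hy | hy
    · rw [max_eq_right hy.le, mul_zero]
      refine (hasDerivAt_const y (0 : ℝ)).congr_of_eventuallyEq ?_
      filter_upwards [Iio_mem_nhds hy] with z hz using posSq_of_nonpos (le_of_lt hz)
    · rw [max_eq_left hy.le]
      have : HasDerivAt (fun z : ℝ => z * z) (2 * y) y := by
        convert! (hasDerivAt_id y).mul (hasDerivAt_id y) using 1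
        simp [two_mul]
      refine this.congr_of_eventuallyEq ?_
      filter_upwards [Ioi_mem_nhds hy] with z hz
      rw [posSq, max_eq_left (le_of_lt hz)]
  rcases eq_or_ne s 0 with rfl | hs
  · exact hasDerivAt_of_hasDerivAt_of_ne (g := fun y : ℝ => 2 * max y 0) hne
      (by unfold posSq; fun_prop) (by fun_prop)
  · exact hne s hs

lemma locallyLipschitz_posSq_comp {h : ℝ × ℝ → ℝ} (hh : LocallyLipschitz h) :
    LocallyLipschitz fun z => posSq (h z) :=
  locallyLipschitz_mul (hh.max_const 0) (hh.max_const 0)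

lemma hasFDerivAt_posSq_comp {h : ℝ × ℝ → ℝ} {z : ℝ × ℝ} (hh : DifferentiableAt ℝ h z) :
    HasFDerivAt (fun z => posSq (h z)) ((2 * max (h z) 0) • fderiv ℝ h z) z :=
  (hasDerivAt_posSq (h z)).comp_hasFDerivAt z hh.hasFDerivAt

lemma fderiv_posSq_comp_apply {h : ℝ × ℝ → ℝ} {z : ℝ × ℝ} (hh : DifferentiableAt ℝ h z)
    (v : ℝ × ℝ) :
    fderiv ℝ (fun z => posSq (h z)) z v = 2 * max (h z) 0 * fderiv ℝ h z v := by
  rw [(hasFDerivAt_posSq_comp hh).fderiv]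
  simp

/-- A smooth cut-off in time. -/
lemma exists_time_cutoff (c : ℝ) {δ : ℝ} (hδ : 0 < δ) : ∃ κ : ℝ → ℝ, ContDiff ℝ ∞ κ ∧
    (∀ τ, 0 ≤ κ τ) ∧ (∀ τ ≤ c, κ τ = 0) ∧ (∀ τ, c + δ ≤ τ → κ τ = 1) ∧
    (∀ τ < c, deriv κ τ = 0) ∧ ∀ τ, c + δ < τ → deriv κ τ = 0 := by
  have h0 : ∀ τ ≤ c, Real.smoothTransition ((τ - c) / δ) = 0 := fun τ hτ =>
    Real.smoothTransition.zero_of_nonpos (div_nonpos_of_nonpos_of_nonneg (by linarith) hδ.le)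
  have h1 : ∀ τ, c + δ ≤ τ → Real.smoothTransition ((τ - c) / δ) = 1 := fun τ hτ =>
    Real.smoothTransition.one_of_one_le ((one_le_div hδ).2 (by linarith))
  refine ⟨fun τ => Real.smoothTransition ((τ - c) / δ), ?_, fun τ => Real.smoothTransition.nonneg _,
    h0, h1, fun τ hτ => ?_, fun τ hτ => ?_⟩
  · exact Real.smoothTransition.contDiff.comp ((contDiff_id.sub contDiff_const).div_const _)
  · refine ((hasDerivAt_const τ (0 : ℝ)).congr_of_eventuallyEq ?_).deriv
    filter_upwards [Iio_mem_nhds hτ] with z hz using h0 z (le_of_lt hz)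
  · refine ((hasDerivAt_const τ (1 : ℝ)).congr_of_eventuallyEq ?_).deriv
    filter_upwards [Ioi_mem_nhds hτ] with z hz using h1 z (le_of_lt hz)

/-- The height function of a backward cone with axis `x`. -/
noncomputable def coneFun (C t x : ℝ) (z : ℝ × ℝ) : ℝ := C * (t - z.1) - |z.2 - x|

lemma locallyLipschitz_coneFun (C t x : ℝ) : LocallyLipschitz (coneFun C t x) := by
  have h1 : LocallyLipschitz fun z : ℝ × ℝ => C * (t - z.1) :=
    (by fun_prop : ContDiff ℝ 1 fun z : ℝ × ℝ => C * (t - z.1)).locallyLipschitz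
  have h2 : LocallyLipschitz fun z : ℝ × ℝ => z.2 - x :=
    (by fun_prop : ContDiff ℝ 1 fun z : ℝ × ℝ => z.2 - x).locallyLipschitz
  exact h1.sub (lipschitzWith_one_norm.locallyLipschitz.comp h2)

lemma coneFun_derivatives {C t x : ℝ} {z : ℝ × ℝ} (hz : z.2 ≠ x) :
    DifferentiableAt ℝ (coneFun C t x) z ∧ partialT (coneFun C t x) z = -C ∧
      |partialX (coneFun C t x) z| ≤ 1 := by
  have hd : DifferentiableAt ℝ (coneFun C t x) z := by
    unfold coneFun
    have : DifferentiableAt ℝ (fun z : ℝ × ℝ => |z.2 - x|) z :=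
      DifferentiableAt.abs (by fun_prop) (sub_ne_zero.2 hz)
    exact DifferentiableAt.sub (by fun_prop) this
  refine ⟨hd, ?_, ?_⟩
  · refine (hasDerivAt_slice_fst hd).unique ?_
    have h : HasDerivAt (fun τ : ℝ => C * (t - τ) - |z.2 - x|) (C * (0 - 1)) z.1 :=
      (((hasDerivAt_const z.1 t).sub (hasDerivAt_id z.1)).const_mul C).sub_const _
    simpa [coneFun] using h
  · rw [← (hasDerivAt_slice_snd hd).deriv]
    have hl : LipschitzWith 1 fun y => coneFun C t x (z.1, y) := by
      refine LipschitzWith.of_dist_le_mul fun y y' => ?_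
      simp only [coneFun, Real.dist_eq, NNReal.coe_one, one_mul]
      have := abs_abs_sub_abs_le_abs_sub (y' - x) (y - x)
      rw [show C * (t - z.1) - |y - x| - (C * (t - z.1) - |y' - x|) = |y' - x| - |y - x| by ring]
      refine this.trans_eq ?_
      rw [abs_sub_comm y]
      congr 1
      ring
    simpa using norm_deriv_le_of_lipschitz (x₀ := z.2) hl

/-- Maximum principle on backward cones for the potential of the difference of two solutions. -/
theorem le_of_le_on_base {ρ Q D : ℝ × ℝ → ℝ} {K L : ℝ} {M₁ : NNReal} (hρm : Measurable ρ)
    (hQm : Measurable Q) (hρK : ∀ z, |ρ z| ≤ K) (hQK : ∀ z, |Q z| ≤ K) (hρ0 : ∀ z, 0 ≤ ρ z)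
    (hQ : ∀ z, |Q z| ≤ L * ρ z) (hL : 0 ≤ L) (hD : LipschitzWith M₁ D)
    (hDe : ∀ᵐ z : ℝ × ℝ, 0 < z.1 → ρ z * partialT D z + Q z * partialX D z = 0)
    (hDt : ∀ᵐ z : ℝ × ℝ, 0 < z.1 → ρ z = 0 → partialT D z = 0)
    (kato : ∀ (φ : ℝ × ℝ → ℝ) (C : NNReal), LipschitzWith C φ → HasCompactSupport φ →
      tsupport φ ⊆ halfPlane → (∀ z, 0 ≤ φ z) →
      0 ≤ ∫ z, (ρ z * partialT φ z + Q z * partialX φ z))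
    {s t x M : ℝ} (hs : 0 ≤ s) (hst : s < t)
    (hbase : ∀ y, |y - x| ≤ (L + 1) * (t - s) → D (s, y) ≤ M) : D (t, x) ≤ M := by
  refine le_of_forall_pos_le_add fun η hη => ?_
  -- Since `|Q| ≤ L ρ`, the slope `L + 1` leaves a surplus `-ρ` when the cone weight is
  -- differentiated along `(ρ, Q)`.
  set C := L + 1 with hC
  have hC0 : 0 < C := by positivity
  set m := M + η with hm
  -- Within time `2 * δ` of the base, `D` rises by at most `η`, so it stays below `m = M + η` inside
  -- the cone.
  set δ := η / (2 * (M₁ + 1)) with hδ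
  have hM1 : (0 : ℝ) ≤ M₁ := M₁.2
  have hδ0 : 0 < δ := by positivity
  have hδη : M₁ * (2 * δ) ≤ η := by
    rw [hδ, show (M₁ : ℝ) * (2 * (η / (2 * (M₁ + 1)))) = η * (M₁ / (M₁ + 1)) by field_simp]
    exact mul_le_of_le_one_right hη.le ((div_le_one (by positivity)).2 (by linarith))
  set Y := coneFun C t x with hY
  have lY : LocallyLipschitz Y := locallyLipschitz_coneFun C t x
  have near : ∀ z : ℝ × ℝ, s ≤ z.1 → z.1 ≤ s + 2 * δ → 0 < Y z → D z ≤ m := by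
    intro z h1 h2 h3
    simp only [hY, coneFun] at h3
    have hb := hbase z.2 (by nlinarith)
    have hl := hD.dist_le_mul z (s, z.2)
    have hd : dist z (s, z.2) = z.1 - s := by
      rw [Prod.dist_eq, Real.dist_eq, dist_self, abs_of_nonneg (by linarith),
        max_eq_left (by linarith)]
    rw [hd, Real.dist_eq] at hl
    have := le_abs_self (D z - D (s, z.2))
    nlinarith
  obtain ⟨κ, κd, κ0, κz, κ1, κd0, κd1⟩ := exists_time_cutoff (s + δ) hδ0
  have κdiff : ∀ z : ℝ × ℝ, HasFDerivAt (fun z : ℝ × ℝ => κ z.1)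
      (deriv κ z.1 • ContinuousLinearMap.fst ℝ ℝ ℝ) z := fun z =>
    ((κd.differentiable (by simp) z.1).hasDerivAt).comp_hasFDerivAt z hasFDerivAt_fst
  have lκ : LocallyLipschitz fun z : ℝ × ℝ => κ z.1 :=
    ((κd.comp contDiff_fst).of_le (by simp) : ContDiff ℝ 1 fun z : ℝ × ℝ => κ z.1).locallyLipschitz
  have lE : LocallyLipschitz fun z => D z - m :=
    hD.locallyLipschitz.sub (LipschitzWith.const m).locallyLipschitz
  -- The time factor switches on between `s + δ` and `s + 2δ`. The support thus stays in `t > 0`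
  -- even for `s = 0`, and the switching costs nothing because `(D - m)₊` vanishes in the cone
  -- there.
  set φ : ℝ × ℝ → ℝ := fun z => (κ z.1 * posSq (Y z)) * posSq (D z - m) with hφ
  have lφ : LocallyLipschitz φ :=
    locallyLipschitz_mul (locallyLipschitz_mul lκ (locallyLipschitz_posSq_comp lY))
      (locallyLipschitz_posSq_comp lE)
  have φ0 : ∀ z, 0 ≤ φ z := fun z =>
    mul_nonneg (mul_nonneg (κ0 _) (posSq_nonneg _)) (posSq_nonneg _)
  set B : Set (ℝ × ℝ) := Icc (s + δ) t ×ˢ Icc (x - C * (t - s)) (x + C * (t - s)) with hB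
  have hout : ∀ z ∉ B, φ z = 0 := by
    intro z hz
    by_contra hne
    have h1 : s + δ < z.1 := by
      by_contra h; exact hne (by simp [hφ, κz _ (not_lt.1 h)])
    have h2 : 0 < Y z := by
      by_contra h; exact hne (by simp [hφ, posSq_of_nonpos (not_lt.1 h)])
    simp only [hY, coneFun] at h2
    have h3 := abs_nonneg (z.2 - x)
    have h4 : z.1 ≤ t := by
      by_contra h
      nlinarith
    have h5 : |z.2 - x| ≤ C * (t - s) := by nlinarith
    rw [abs_le] at h5
    exact hz ⟨⟨h1.le, h4⟩, by linarith [h5.1], by linarith [h5.2]⟩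
  have cφ : HasCompactSupport φ := HasCompactSupport.intro (isCompact_Icc.prod isCompact_Icc) hout
  have sφ : tsupport φ ⊆ halfPlane := by
    refine (closure_minimal (fun z hz => by_contra fun h => (Function.mem_support.1 hz) (hout z h))
      (isClosed_Icc.prod isClosed_Icc)).trans fun z hz => ⟨?_, mem_univ _⟩
    exact lt_of_lt_of_le (by linarith) hz.1.1
  obtain ⟨Cφ, hCφ⟩ := exists_lipschitzWith_of_hasCompactSupport lφ cφ
  have hk := kato φ Cφ hCφ cφ sφ φ0
  have hdd := hD.ae_differentiableAt (μ := (volume : Measure (ℝ × ℝ)))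
  have hpt : ∀ᵐ z : ℝ × ℝ, ρ z * partialT φ z + Q z * partialX φ z ≤
      -(ρ z * (κ z.1 * (2 * max (Y z) 0) * posSq (D z - m))) := by
    filter_upwards [hDe, hdd, ae_snd_mul_ne one_ne_zero x] with z h1 h2 h3
    rw [one_mul] at h3
    obtain ⟨d1, d2, d3⟩ := coneFun_derivatives (C := C) (t := t) h3
    have dE : DifferentiableAt ℝ (fun z => D z - m) z := h2.sub_const m
    have fE : ∀ v, fderiv ℝ (fun z => D z - m) z v = fderiv ℝ D z v := fun v => by
      rw [fderiv_sub_const]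
    have key : ∀ v, fderiv ℝ φ z v = κ z.1 * posSq (Y z) * (2 * max (D z - m) 0 * fderiv ℝ D z v) +
        (κ z.1 * (2 * max (Y z) 0 * fderiv ℝ Y z v) + deriv κ z.1 * v.1 * posSq (Y z)) *
          posSq (D z - m) := fun v => by
      have d4 : DifferentiableAt ℝ (fun z : ℝ × ℝ => κ z.1 * posSq (Y z)) z :=
        (κdiff z).differentiableAt.mul (hasFDerivAt_posSq_comp d1).differentiableAt
      rw [hφ, fderiv_mul_apply_eq d4 (hasFDerivAt_posSq_comp dE).differentiableAt,
        fderiv_mul_apply_eq (κdiff z).differentiableAt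
        (hasFDerivAt_posSq_comp d1).differentiableAt, fderiv_posSq_comp_apply dE,
        fderiv_posSq_comp_apply d1, fE, (κdiff z).fderiv]
      simp [hY]
    have hκ' : deriv κ z.1 * posSq (Y z) * posSq (D z - m) = 0 := by
      rcases lt_or_ge z.1 (s + δ) with h | h
      · rw [κd0 _ h]; ring
      rcases lt_or_ge (s + δ + δ) z.1 with h' | h'
      · rw [κd1 _ h']; ring
      rcases le_or_gt (Y z) 0 with h4 | h4
      · rw [posSq_of_nonpos h4]; ring
      · rw [posSq_of_nonpos (sub_nonpos.2 (near z (by linarith) (by linarith) h4))]; ring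
    have hκD : κ z.1 * (ρ z * partialT D z + Q z * partialX D z) = 0 := by
      rcases le_or_gt z.1 0 with h | h
      · rw [κz _ (by linarith), zero_mul]
      · rw [h1 h, mul_zero]
    unfold partialT partialX at *
    rw [key, key, d2]
    set N := κ z.1 * (2 * max (Y z) 0) * posSq (D z - m) with hN
    have hN0 : 0 ≤ N := mul_nonneg (mul_nonneg (κ0 _) (by positivity)) (posSq_nonneg _)
    have hQb : Q z * fderiv ℝ Y z (0, 1) ≤ L * ρ z := by
      refine (le_abs_self _).trans ?_
      rw [abs_mul]
      exact (mul_le_of_le_one_right (abs_nonneg _) d3).trans (hQ z)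
    -- Pure algebra: the derivatives of `D` enter only through `ρ D_t + Q D_x = 0`, and those of the
    -- time factor meet zero. What survives is the derivative of the cone weight.
    have e : ∀ a b c d k k' p q P' E' : ℝ, k * (ρ z * a + Q z * b) = 0 → k' * p * q = 0 →
        ρ z * (k * p * (E' * a) + (k * (P' * c) + k' * 1 * p) * q) +
        Q z * (k * p * (E' * b) + (k * (P' * d) + k' * 0 * p) * q) =
        (k * P' * q) * (ρ z * c + Q z * d) := by
      intro a b c d k k' p q P' E' e1 e2
      linear_combination (p * E') * e1 + ρ z * e2
    rw [e _ _ _ _ _ _ _ _ _ _ hκD hκ']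
    have : N * (ρ z * -C + Q z * fderiv ℝ Y z (0, 1)) ≤ N * (-ρ z) :=
      mul_le_mul_of_nonneg_left (by rw [hC]; linarith) hN0
    linarith
  -- Kato's inequality makes the integral of this nonpositive function nonnegative, so the function
  -- vanishes almost everywhere.
  have hzero : ∀ᵐ z : ℝ × ℝ, ρ z * partialT φ z + Q z * partialX φ z = 0 := by
    have hn : ∀ᵐ z : ℝ × ℝ, 0 ≤ -(ρ z * partialT φ z + Q z * partialX φ z) := by
      filter_upwards [hpt] with z hz
      have : 0 ≤ ρ z * (κ z.1 * (2 * max (Y z) 0) * posSq (D z - m)) :=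
        mul_nonneg (hρ0 z) (mul_nonneg (mul_nonneg (κ0 _) (by positivity)) (posSq_nonneg _))
      linarith
    have hi : Integrable fun z => ρ z * partialT φ z + Q z * partialX φ z :=
      (integrable_mul_partial hρm hρK hCφ cφ _).add (integrable_mul_partial hQm hQK hCφ cφ _)
    have h0 : ∫ z, -(ρ z * partialT φ z + Q z * partialX φ z) = 0 := by
      refine le_antisymm ?_ (integral_nonneg_of_ae hn)
      rw [integral_neg]
      linarith
    filter_upwards [(integral_eq_zero_iff_of_nonneg_ae hn hi.neg).1 h0] with z hz
    exact neg_eq_zero.1 hz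
  -- Inside the cone, where `D > m`, the surplus forces `ρ = 0`, and there `D_t = 0`.
  have hae : ∀ᵐ z : ℝ × ℝ, DifferentiableAt ℝ D z ∧
      (s + 2 * δ ≤ z.1 → 0 < Y z → max (D z - m) 0 * partialT D z = 0) := by
    filter_upwards [hpt, hzero, hDt, hdd] with z h1 h2 h3 h4
    refine ⟨h4, fun h5 h6 => ?_⟩
    rw [h2, κ1 _ (by linarith), max_eq_left h6.le] at h1
    rcases le_or_gt (D z - m) 0 with h7 | h7
    · rw [max_eq_right h7, zero_mul]
    · have hp := posSq_pos h7
      have : ρ z = 0 := by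
        by_contra hne
        have hρ := lt_of_le_of_ne (hρ0 z) (Ne.symm hne)
        have : 0 < ρ z * (1 * (2 * Y z) * posSq (D z - m)) := by positivity
        linarith
      rw [h3 (by linarith) this, mul_zero]
  -- On almost every vertical line `((D - m)₊)²` is locally Lipschitz, has zero derivative inside
  -- the cone and starts from zero. The portion of the line below a cone point stays in the cone.
  have hgood : ∀ᵐ y, ∀ τ, s ≤ τ → 0 < Y (τ, y) → D (τ, y) ≤ m := by
    filter_upwards [ae_ae_slice_fst hae] with y hy τ hτs hτ
    rcases le_or_gt τ (s + 2 * δ) with h | h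
    · exact near (τ, y) hτs h hτ
    have hmono : ∀ σ ≤ τ, 0 < Y (σ, y) := fun σ hσ => by
      simp only [hY, coneFun] at hτ ⊢
      nlinarith
    have lD : LocallyLipschitz fun σ => D (σ, y) - m :=
      lE.comp (LipschitzWith.prodMk_right y).locallyLipschitz
    have le : LocallyLipschitz fun σ => posSq (D (σ, y) - m) :=
      locallyLipschitz_mul (lD.max_const 0) (lD.max_const 0)
    obtain ⟨K', hK'⟩ := LocallyLipschitzOn.exists_lipschitzOnWith_of_compact
      (isCompact_uIcc (a := s + 2 * δ) (b := τ)) (le.locallyLipschitzOn)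
    have hint := hK'.absolutelyContinuousOnInterval.integral_deriv_eq_sub
    have hz : ∫ σ in (s + 2 * δ)..τ, deriv (fun σ => posSq (D (σ, y) - m)) σ = 0 := by
      refine (intervalIntegral.integral_congr_ae ?_).trans intervalIntegral.integral_zero
      filter_upwards [hy] with σ hσ hmem
      rw [uIoc_of_le h.le] at hmem
      have hd := (hasDerivAt_posSq (D (σ, y) - m)).comp σ
        ((hasDerivAt_slice_fst hσ.1).sub_const m)
      refine hd.deriv.trans ?_
      rw [mul_assoc, hσ.2 hmem.1.le (hmono σ hmem.2), mul_zero]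
    rw [hz, posSq_of_nonpos (sub_nonpos.2 (near (s + 2 * δ, y) (by simp; linarith) le_rfl
      (hmono _ h.le)))] at hint
    by_contra hlt
    have := posSq_pos (sub_pos.2 (not_le.1 hlt))
    linarith
  -- The apex is not interior to the cone: descend slightly in time, then move to a nearby good
  -- vertical line, by continuity of `D`.
  by_contra hlt
  have hlt := not_le.1 hlt
  have c1 : Continuous fun τ => D (τ, x) := hD.continuous.comp (by fun_prop)
  have hev : ∀ᶠ τ in 𝓝[<] t, s < τ ∧ m < D (τ, x) :=
    (Eventually.and (Ioi_mem_nhds hst) (c1.continuousAt.eventually (Ioi_mem_nhds hlt))).filter_mono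
      nhdsWithin_le_nhds
  obtain ⟨τ, ⟨h1, h2⟩, h3⟩ := (hev.and self_mem_nhdsWithin).exists
  have h3 : τ < t := h3
  have c2 : Continuous fun y => D (τ, y) := hD.continuous.comp (by fun_prop)
  have c3 : Continuous fun y => Y (τ, y) := lY.continuous.comp (by fun_prop)
  obtain ⟨y, ⟨hy1, hy2⟩, hy⟩ := (Measure.dense_of_ae hgood).inter_open_nonempty
    ({y | m < D (τ, y)} ∩ {y | 0 < Y (τ, y)})
    ((isOpen_lt continuous_const c2).inter (isOpen_lt continuous_const c3))
    ⟨x, h2, by simp only [hY, coneFun, mem_ofPred_eq, sub_self, abs_zero, sub_zero]; nlinarith⟩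
  exact absurd (hy τ h1.le hy2) (not_le.2 hy1)

/-! ### Following level sets back to time zero -/

lemma exists_gap_of_finite {T : Set ℝ} (hT : T.Finite) :
    ∃ ε > 0, ∀ a ∈ T, ∀ b ∈ T, a ≠ b → ε < |a - b| := by
  have h : ∀ᶠ ε in 𝓝[>] (0 : ℝ), ∀ a ∈ T, ∀ b ∈ T, a ≠ b → ε < |a - b| := by
    refine (eventually_all_finite hT).2 fun a _ => (eventually_all_finite hT).2 fun b _ => ?_
    by_cases hab : a = b
    · exact Eventually.of_forall fun ε h => absurd hab h
    · have h := Iio_mem_nhds (abs_pos.2 (sub_ne_zero.2 hab))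
      filter_upwards [nhdsWithin_le_nhds h] with ε h _ using h
  obtain ⟨ε, h1, h2⟩ := (h.and self_mem_nhdsWithin).exists
  exact ⟨ε, h2, h1⟩

section Backward

variable {D : ℝ × ℝ → ℝ} {M₁ : NNReal} {C : ℝ} (hD : LipschitzWith M₁ D) (hC : 0 ≤ C)
include hD hC

/-- By the two comparison principles `D(t, x)` lies between the extrema of `D(s, ·)` on the base of
the cone; the intermediate value theorem does the rest. -/
lemma exists_eq_on_base
    (hmax : ∀ s t x M, 0 ≤ s → s < t → (∀ y, |y - x| ≤ C * (t - s) → D (s, y) ≤ M) → D (t, x) ≤ M)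
    (hmin : ∀ s t x M, 0 ≤ s → s < t → (∀ y, |y - x| ≤ C * (t - s) → M ≤ D (s, y)) → M ≤ D (t, x))
    {s t : ℝ} (hs : 0 ≤ s) (hst : s < t) (x : ℝ) :
    ∃ y, |y - x| ≤ C * (t - s) ∧ D (s, y) = D (t, x) := by
  have hr : 0 ≤ C * (t - s) := mul_nonneg hC (by linarith)
  set I : Set ℝ := Icc (x - C * (t - s)) (x + C * (t - s)) with hI
  have memI : ∀ y, y ∈ I ↔ |y - x| ≤ C * (t - s) := fun y => by
    rw [hI, abs_le, mem_Icc]; constructor <;> rintro ⟨h1, h2⟩ <;> constructor <;> linarith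
  have c : ContinuousOn (fun y => D (s, y)) I := (hD.continuous.comp (by fun_prop)).continuousOn
  have hne : I.Nonempty := ⟨x, by rw [memI]; simpa using hr⟩
  obtain ⟨p, hp, hpm⟩ := isCompact_Icc.exists_isMaxOn hne c
  obtain ⟨q, hq, hqm⟩ := isCompact_Icc.exists_isMinOn hne c
  have h1 := hmax s t x (D (s, p)) hs hst fun y hy => hpm ((memI y).2 hy)
  have h2 := hmin s t x (D (s, q)) hs hst fun y hy => hqm ((memI y).2 hy)
  obtain ⟨y, hy, hyD⟩ := isPreconnected_Icc.intermediate_value hq hp c ⟨h2, h1⟩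
  exact ⟨y, (memI y).1 hy, hyD⟩

variable (hivt : ∀ s t x, 0 ≤ s → s < t → ∃ y, |y - x| ≤ C * (t - s) ∧ D (s, y) = D (t, x))
include hivt

/-- Choose the leftmost admissible preimage, in the window of radius `r` about each point. If two
preimages of one value were reversed, the smaller would lie in the other's window and contradict its
minimality. For distinct values a reversal has size at most `2 r`, so the Lipschitz bound
contradicts the gap between the values. -/
lemma exists_monotone_step {s t : ℝ} (hs : 0 ≤ s) (hst : s < t) {X : ℕ → ℝ} (hX : Monotone X)
    (hgap : ∀ i j, D (t, X i) ≠ D (t, X j) → M₁ * (2 * (C * (t - s))) < |D (t, X i) - D (t, X j)|) :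
    ∃ X' : ℕ → ℝ, Monotone X' ∧ ∀ i, |X' i - X i| ≤ C * (t - s) ∧ D (s, X' i) = D (t, X i) := by
  set r := C * (t - s) with hr
  have cD : Continuous fun y => D (s, y) := hD.continuous.comp (by fun_prop)
  have hex : ∀ i, ∃ y, IsLeast {y | y ∈ Icc (X i - r) (X i + r) ∧ D (s, y) = D (t, X i)} y := by
    intro i
    refine IsCompact.exists_isLeast ?_ ?_
    · exact isCompact_Icc.inter_right (isClosed_eq cD continuous_const)
    · obtain ⟨y, hy, hyD⟩ := hivt s t (X i) hs hst
      rw [abs_le] at hy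
      exact ⟨y, ⟨by linarith [hy.1], by linarith [hy.2]⟩, hyD⟩
  choose X' hX' using hex
  refine ⟨X', fun i j hij => ?_, fun i => ?_⟩
  · obtain ⟨⟨⟨hi1, hi2⟩, hi3⟩, hi4⟩ := hX' i
    obtain ⟨⟨⟨hj1, hj2⟩, hj3⟩, -⟩ := hX' j
    have hXij := hX hij
    by_contra hlt
    have hlt := not_le.1 hlt
    by_cases he : D (t, X i) = D (t, X j)
    · exact absurd (hi4 ⟨⟨by linarith, by linarith⟩, hj3.trans he.symm⟩) (not_le.2 hlt)
    · have h1 := hgap i j he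
      have h2 := hD.dist_le_mul (s, X' i) (s, X' j)
      rw [Prod.dist_eq, dist_self, max_eq_right dist_nonneg, Real.dist_eq, Real.dist_eq, hi3, hj3,
        abs_of_nonneg (by linarith : 0 ≤ X' i - X' j)] at h2
      have h3 : (M₁ : ℝ) * (X' i - X' j) ≤ M₁ * (2 * r) :=
        mul_le_mul_of_nonneg_left (by linarith) M₁.2
      linarith
  · obtain ⟨⟨⟨hi1, hi2⟩, hi3⟩, -⟩ := hX' i
    exact ⟨abs_le.2 ⟨by linarith, by linarith⟩, hi3⟩

/-- Monotone families of points can be transported back to time zero along level sets. -/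
lemma exists_monotone_zero {t : ℝ} (ht : 0 < t) {X : ℕ → ℝ} (hX : Monotone X)
    (hfin : (range X).Finite) :
    ∃ X' : ℕ → ℝ, Monotone X' ∧ ∀ i, |X' i - X i| ≤ C * t ∧ D (0, X' i) = D (t, X i) := by
  obtain ⟨ε, hε, hgap⟩ := exists_gap_of_finite (hfin.image fun x => D (t, x))
  have hgap' : ∀ i j, D (t, X i) ≠ D (t, X j) → ε < |D (t, X i) - D (t, X j)| := fun i j h =>
    hgap _ (mem_image_of_mem _ (mem_range_self i)) _ (mem_image_of_mem _ (mem_range_self j)) h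
  -- The steps are short enough that `D` varies less than the gap `ε` over twice a window radius.
  -- The values of `D` are preserved at each step, so the same gap serves throughout.
  obtain ⟨N, hN⟩ := exists_nat_gt (M₁ * (2 * (C * t)) / ε)
  have hN0 : (0 : ℝ) < N := lt_of_le_of_lt (by positivity) hN
  set h := t / N with hh
  have hh0 : 0 < h := div_pos ht hN0
  have hNh : N * h = t := by rw [hh]; field_simp
  have hsmall : M₁ * (2 * (C * h)) < ε := by
    rw [div_lt_iff₀ hε] at hN
    rw [hh, show (M₁ : ℝ) * (2 * (C * (t / N))) = M₁ * (2 * (C * t)) / N by ring,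
      div_lt_iff₀ hN0]
    linarith
  have main : ∀ k : ℕ, k ≤ N → ∃ X' : ℕ → ℝ, Monotone X' ∧
      ∀ i, |X' i - X i| ≤ C * (k * h) ∧ D (t - k * h, X' i) = D (t, X i) := by
    intro k
    induction k with
    | zero => exact fun _ => ⟨X, hX, fun i => by simp⟩
    | succ k ih =>
      intro hk
      obtain ⟨X₁, hX₁, h₁⟩ := ih (by lia)
      have hk' : ((k : ℝ) + 1) ≤ N := by exact_mod_cast hk
      have e : t - k * h - (t - (k + 1) * h) = h := by ring
      obtain ⟨X₂, hX₂, h₂⟩ := exists_monotone_step hD hC hivt (s := t - (k + 1) * h)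
        (t := t - k * h) (by nlinarith) (by linarith) hX₁ (fun i j hij => by
          rw [(h₁ i).2, (h₁ j).2] at hij ⊢
          rw [e]
          exact hsmall.trans (hgap' i j hij))
      refine ⟨X₂, hX₂, fun i => ⟨?_, ?_⟩⟩
      · have a1 := (h₂ i).1
        have a2 := (h₁ i).1
        rw [e] at a1
        have a3 := abs_sub_le (X₂ i) (X₁ i) (X i)
        push_cast
        linarith
      · rw [← (h₁ i).2, ← (h₂ i).2]
        push_cast
        rfl
  obtain ⟨X', hX', h'⟩ := main N le_rfl
  simp only [hNh, sub_self] at h'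
  exact ⟨X', hX', h'⟩

/-- The transported points keep their order, so their increments at time zero are integrals of `w₀`
over adjacent intervals and do not overlap. -/
lemma sum_abs_sub_le {w₀ : ℝ → ℝ} {K : ℝ} (hw₀ : Measurable w₀) (hw₀K : ∀ x, |w₀ x| ≤ K)
    (hD0 : ∀ x, D (0, x) = ∫ y in 0..x, w₀ y) {t R : ℝ} (ht : 0 < t) {X : ℕ → ℝ}
    (hX : Monotone X) (hXR : ∀ i, X i ∈ Icc (-R) R) (n : ℕ) :
    ∑ i ∈ Finset.range n, |D (t, X (i + 1)) - D (t, X i)| ≤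
      ∫ x in -(R + C * t)..R + C * t, |w₀ x| := by
  -- Freezing the sequence after index `n` makes its range finite, as the gap argument requires,
  -- without changing the sum.
  have hfin : (range fun i => X (min i n)).Finite :=
    ((finite_Iic n).image X).subset (by
      rintro _ ⟨i, rfl⟩
      exact ⟨min i n, min_le_right i n, rfl⟩)
  obtain ⟨X', hX', h'⟩ := exists_monotone_zero hD hC hivt ht
    (hX.comp (fun i j hij => min_le_min_right n hij)) hfin
  have iw := fun c d => intervalIntegrable_of_abs_le hw₀ hw₀K c d
  have iw' := fun c d => (iw c d).abs
  have hb : ∀ i, X' i ∈ Icc (-(R + C * t)) (R + C * t) := fun i => by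
    have h1 := abs_le.1 (h' i).1
    have h2 := hXR (min i n)
    simp only [Function.comp] at h1
    exact ⟨by linarith [h1.1, h2.1], by linarith [h1.2, h2.2]⟩
  calc ∑ i ∈ Finset.range n, |D (t, X (i + 1)) - D (t, X i)|
      ≤ ∑ i ∈ Finset.range n, ∫ x in X' i..X' (i + 1), |w₀ x| := by
        refine Finset.sum_le_sum fun i hi => ?_
        have hi := Finset.mem_range.1 hi
        have e1 := (h' i).2
        have e2 := (h' (i + 1)).2
        simp only [Function.comp, min_eq_left hi.le, min_eq_left (Nat.succ_le_of_lt hi)] at e1 e2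
        rw [← e1, ← e2, hD0, hD0, intervalIntegral.integral_interval_sub_left (iw _ _) (iw _ _)]
        exact intervalIntegral.abs_integral_le_integral_abs (hX' i.le_succ)
    _ = ∫ x in X' 0..X' n, |w₀ x| :=
        intervalIntegral.sum_integral_adjacent_intervals fun k _ => iw' _ _
    _ ≤ ∫ x in -(R + C * t)..R + C * t, |w₀ x| :=
        intervalIntegral.integral_mono_interval (hb 0).1 (hX' (Nat.zero_le n)) (hb n).2
          (Eventually.of_forall fun x => abs_nonneg _) (iw' _ _)

end Backward

/-! ### Variation and the `L¹` norm -/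

/-- The `L¹` norm of the density of a primitive is bounded by its variation. -/
lemma integral_abs_le_of_variation_le {G w : ℝ → ℝ} {K B R : ℝ} (hR : 0 ≤ R) (hw : Measurable w)
    (hwK : ∀ x, |w x| ≤ K) (hG : ∀ x y, G y - G x = ∫ s in x..y, w s)
    (hB : ∀ X : ℕ → ℝ, Monotone X → (∀ i, X i ∈ Icc (-R) R) → ∀ n,
      ∑ i ∈ Finset.range n, |G (X (i + 1)) - G (X i)| ≤ B) :
    ∫ x in -R..R, |w x| ≤ B := by
  have hK : 0 ≤ K := (abs_nonneg _).trans (hwK 0)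
  have hB0 : 0 ≤ B := by
    simpa using hB (fun _ => 0) monotone_const (fun _ => ⟨by linarith, hR⟩) 0
  have lG : LipschitzWith ⟨K, hK⟩ G := LipschitzWith.of_dist_le_mul fun x y => by
    rw [Real.dist_eq, hG]
    exact abs_intervalIntegral_le hwK y x
  have hloc : LocallyBoundedVariationOn G univ := lG.locallyBoundedVariationOn univ
  set V := variationOnFromTo G univ (-R) with hV
  have hVG : ∀ x y, x ≤ y → |G y - G x| ≤ V y - V x := by
    intro x y hxy
    have e : V y - V x = variationOnFromTo G univ x y := by
      rw [hV, ← variationOnFromTo.add hloc (mem_univ (-R)) (mem_univ x) (mem_univ y)]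
      ring
    rw [e, variationOnFromTo.eq_of_le _ _ hxy]
    have hfin : eVariationOn G (univ ∩ Icc x y) ≠ ⊤ := hloc x y (mem_univ _) (mem_univ _)
    have := eVariationOn.edist_le G (s := univ ∩ Icc x y) (x := y) (y := x)
      ⟨mem_univ _, hxy, le_rfl⟩ ⟨mem_univ _, le_rfl, hxy⟩
    rw [edist_dist, Real.dist_eq] at this
    exact (ENNReal.ofReal_le_iff_le_toReal hfin).1 this
  have mV : Monotone V := fun x y hxy => by
    have := hVG x y hxy
    linarith [abs_nonneg (G y - G x)]
  have m1 : Monotone fun x => V x - G x := fun x y hxy => by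
    have := (le_abs_self _).trans (hVG x y hxy)
    simp only
    linarith
  have m2 : Monotone fun x => V x + G x := fun x y hxy => by
    have := (neg_le_abs _).trans (hVG x y hxy)
    simp only
    linarith
  have hVR : V R - V (-R) ≤ B := by
    have e : V (-R) = 0 := variationOnFromTo.self _ _ _
    rw [e, sub_zero, hV, variationOnFromTo.eq_of_le _ _ (by linarith : -R ≤ R)]
    refine ENNReal.toReal_le_of_le_ofReal hB0 (iSup_le ?_)
    rintro ⟨n, X, hX, hXm⟩
    simp only [edist_dist, Real.dist_eq]
    rw [← ENNReal.ofReal_sum_of_nonneg fun i _ => abs_nonneg _]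
    exact ENNReal.ofReal_le_ofReal (hB X hX (fun i => (hXm i).2) n)
  -- With `V` the variation function, both `V - G` and `V + G` are increasing, so `V'` dominates
  -- `±w` wherever the derivatives exist. The integral of the derivative of an increasing function
  -- is at most its increment, which is all that is needed.
  have hder : ∀ᵐ x, |w x| ≤ deriv V x := by
    filter_upwards [mV.ae_differentiableAt, LocallyIntegrable.ae_hasDerivAt_integral
      (locallyIntegrable_of_abs_le hw.aestronglyMeasurable hwK)] with x h1 h2
    have hGd : HasDerivAt G (w x) x := by
      have e : G = fun x => G 0 + ∫ s in 0..x, w s := by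
        ext x; rw [← hG]; ring
      rw [e]
      exact (h2 0).const_add _
    have d1 : 0 ≤ deriv V x - w x := by
      rw [← (h1.hasDerivAt.sub hGd).deriv]
      exact m1.deriv_nonneg
    have d2 : 0 ≤ deriv V x + w x := by
      rw [← (h1.hasDerivAt.add hGd).deriv]
      exact m2.deriv_nonneg
    exact abs_le.2 ⟨by linarith, by linarith⟩
  have h1 := (mV.monotoneOn (uIcc (-R) R)).intervalIntegral_deriv_mem_uIcc
  rw [uIcc_of_le (by linarith [mV (by linarith : -R ≤ R)])] at h1
  refine le_trans ?_ (h1.2.trans hVR)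
  refine intervalIntegral.integral_mono_ae (by linarith)
    (intervalIntegrable_of_abs_le hw hwK _ _).abs ?_ hder
  exact (mV.monotoneOn _).intervalIntegrable_deriv

/-! ### The potential of the difference of two solutions -/

lemma measurable_heaviside : Measurable heaviside :=
  Measurable.ite measurableSet_Ioi measurable_const measurable_const

lemma flux_of_pos {f g : ℝ → ℝ} {x : ℝ} (hx : 0 < x) (s : ℝ) : flux f g x s = f s := by
  simp [flux, heaviside, hx, hx.le]

lemma flux_of_neg {f g : ℝ → ℝ} {x : ℝ} (hx : x < 0) (s : ℝ) : flux f g x s = g s := by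
  simp [flux, heaviside, hx, hx.le]

lemma flux_zero {f g : ℝ → ℝ} (s : ℝ) : flux f g 0 s = 0 := by simp [flux, heaviside]

/-- This is the algebraic source of `ρ D_t + Q D_x = 0`: the gradient of the potential is orthogonal
to the Kružkov field. -/
lemma sflux_mul_sub {f g : ℝ → ℝ} {x : ℝ} (hx : x ≠ 0) (s k : ℝ) :
    sflux f g x s k * (s - k) = |s - k| * (flux f g x s - flux f g x k) := by
  rcases lt_or_gt_of_ne hx with hx | hx
  · rw [sflux, if_neg hx.not_gt, flux_of_neg hx, flux_of_neg hx, kflux_mul_sub]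
  · rw [sflux, if_pos hx, flux_of_pos hx, flux_of_pos hx, kflux_mul_sub]

section Lip

variable {f g : ℝ → ℝ} {L : NNReal} (hf : LipschitzWith L f) (hg : LipschitzWith L g)
include hf hg

lemma abs_flux_sub_le (x s k : ℝ) : |flux f g x s - flux f g x k| ≤ L * |s - k| := by
  rcases lt_trichotomy x 0 with hx | rfl | hx
  · rw [flux_of_neg hx, flux_of_neg hx]; exact hg.dist_le_mul s k
  · rw [flux_zero, flux_zero, sub_self, abs_zero]; positivity
  · rw [flux_of_pos hx, flux_of_pos hx]; exact hf.dist_le_mul s k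

lemma measurable_flux {u : ℝ × ℝ → ℝ} (hu : Measurable u) :
    Measurable fun z : ℝ × ℝ => flux f g z.2 (u z) := by
  unfold flux
  exact ((measurable_heaviside.comp measurable_snd).mul (hf.continuous.measurable.comp hu)).add
    ((measurable_heaviside.comp measurable_snd.neg).mul (hg.continuous.measurable.comp hu))

lemma abs_flux_le {a b x s : ℝ} (hs : s ∈ Icc a b) :
    |flux f g x s| ≤ |f a| + |g a| + L * (b - a) := by
  have h1 := abs_flux_sub_le hf hg x s a
  have h2 : (L : ℝ) * |s - a| ≤ L * (b - a) := mul_le_mul_of_nonneg_left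
    (abs_sub_le_of_mem_Icc hs ⟨le_rfl, hs.1.trans hs.2⟩) L.2
  have h3 : |flux f g x a| ≤ |f a| + |g a| := by
    rcases lt_trichotomy x 0 with hx | rfl | hx
    · rw [flux_of_neg hx]; linarith [abs_nonneg (f a)]
    · rw [flux_zero, abs_zero]; positivity
    · rw [flux_of_pos hx]; linarith [abs_nonneg (g a)]
  have := abs_sub_abs_le_abs_sub (flux f g x s) (flux f g x a)
  linarith

end Lip

/-- The initial term of the weak formulation is an integral over negative times of the datum
extended constantly in `t`. Thus the initial condition is absorbed into a divergence-free field on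
the plane. -/
lemma integral_nonpos_time {w₀ : ℝ → ℝ} {K : ℝ} (hw₀ : Measurable w₀) (hw₀K : ∀ x, |w₀ x| ≤ K)
    {φ : ℝ × ℝ → ℝ} (hφ : ContDiff ℝ ∞ φ) (hc : HasCompactSupport φ) :
    ∫ z in halfPlaneᶜ, w₀ z.2 * partialT φ z = ∫ x, w₀ x * φ (0, x) := by
  obtain ⟨C, hC⟩ := hφ.lipschitzWith_of_hasCompactSupport hc (by simp)
  have hi : Integrable fun z : ℝ × ℝ => w₀ z.2 * partialT φ z :=
    integrable_mul_partial (hw₀.comp measurable_snd) (fun z => hw₀K z.2) hC hc (1, 0)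
  have e : halfPlaneᶜ = Iic (0 : ℝ) ×ˢ (univ : Set ℝ) := by
    ext z; simp [halfPlane]
  have hr := hi.restrict (s := halfPlaneᶜ)
  rw [e, Measure.volume_eq_prod, ← Measure.prod_restrict] at hr ⊢
  rw [integral_prod_symm _ hr, Measure.restrict_univ]
  refine integral_congr_ae (Eventually.of_forall fun x => ?_)
  change ∫ t in Iic 0, w₀ x * partialT φ (t, x) = w₀ x * φ (0, x)
  rw [integral_const_mul]
  congr 1
  have hcx : HasCompactSupport fun t => φ (t, x) := hc.comp_isClosedEmbedding
    (Isometry.of_dist_eq fun t t' => by simp [Prod.dist_eq] : Isometry fun t : ℝ => (t, x)).isClosedEmbedding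
  have hd : ∀ t, deriv (fun t => φ (t, x)) t = partialT φ (t, x) := fun t =>
    (hasDerivAt_slice_fst (z := (t, x)) (hφ.differentiable (by simp) _)).deriv
  have hcd : ContDiff ℝ 1 fun t => φ (t, x) :=
    (hφ.comp (contDiff_id.prodMk contDiff_const)).of_le (by simp)
  simpa only [hd] using hcx.integral_Iic_deriv_eq hcd 0

namespace RegularSolution

variable {a b : ℝ} {f g u₀ v₀ : ℝ → ℝ} {u v : ℝ × ℝ → ℝ} {ul ur p vl vr q : ℝ → ℝ} {L : NNReal}

/-- The difference of two solutions, extended by the initial data to negative times. -/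
lemma div_free (hf : LipschitzWith L f) (hg : LipschitzWith L g)
    (hu : RegularSolution a b f g u₀ u ul ur p) (hv : RegularSolution a b f g v₀ v vl vr q)
    (hu₀ : Measurable u₀) (hv₀ : Measurable v₀) (mu₀ : ∀ x, u₀ x ∈ Icc a b)
    (mv₀ : ∀ x, v₀ x ∈ Icc a b) {φ : ℝ × ℝ → ℝ} (hφ : ContDiff ℝ ∞ φ) (hc : HasCompactSupport φ) :
    ∫ z : ℝ × ℝ, ((if 0 < z.1 then u z - v z else u₀ z.2 - v₀ z.2) * partialT φ z +
      (if 0 < z.1 then flux f g z.2 (u z) - flux f g z.2 (v z) else 0) * partialX φ z) = 0 := by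
  obtain ⟨C, hC⟩ := hφ.lipschitzWith_of_hasCompactSupport hc (by simp)
  have hL : (0 : ℝ) ≤ L := L.2
  have hab : a ≤ b := (mu₀ 0).1.trans (mu₀ 0).2
  have h1 : 0 ≤ b - a := by linarith
  have h2 : 0 ≤ L * (b - a) := by positivity
  have kW : ∀ z : ℝ × ℝ, |if 0 < z.1 then u z - v z else u₀ z.2 - v₀ z.2| ≤ b - a := fun z => by
    split_ifs
    · exact abs_sub_le_of_mem_Icc (hu.mem z) (hv.mem z)
    · exact abs_sub_le_of_mem_Icc (mu₀ z.2) (mv₀ z.2)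
  have kG : ∀ z : ℝ × ℝ, |if 0 < z.1 then flux f g z.2 (u z) - flux f g z.2 (v z) else 0| ≤
      L * (b - a) := fun z => by
    split_ifs
    · exact (abs_flux_sub_le hf hg _ _ _).trans
        (mul_le_mul_of_nonneg_left (abs_sub_le_of_mem_Icc (hu.mem z) (hv.mem z)) hL)
    · rwa [abs_zero]
  have mF : MeasurableSet {z : ℝ × ℝ | 0 < z.1} := measurableSet_lt measurable_const measurable_fst
  have mW : Measurable fun z : ℝ × ℝ => if 0 < z.1 then u z - v z else u₀ z.2 - v₀ z.2 :=
    Measurable.ite mF (hu.meas.sub hv.meas)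
      ((hu₀.comp measurable_snd).sub (hv₀.comp measurable_snd))
  have mG : Measurable fun z : ℝ × ℝ =>
      if 0 < z.1 then flux f g z.2 (u z) - flux f g z.2 (v z) else 0 :=
    Measurable.ite mF ((measurable_flux hf hg hu.meas).sub (measurable_flux hf hg hv.meas))
      measurable_const
  have mH : MeasurableSet halfPlane := isOpen_halfPlane.measurableSet
  have hi : ∀ {w : ℝ × ℝ → ℝ}, Measurable w → (∀ z, w z ∈ Icc a b) →
      Integrable fun z => w z * partialT φ z + flux f g z.2 (w z) * partialX φ z :=
    fun hw hwm => (integrable_mul_partial hw (fun z => abs_le_of_mem_Icc (hwm z)) hC hc _).add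
      (integrable_mul_partial (measurable_flux hf hg hw) (fun z => abs_flux_le hf hg (hwm z)) hC
        hc _)
  have hi₀ : ∀ {w : ℝ → ℝ}, Measurable w → (∀ x, w x ∈ Icc a b) →
      Integrable fun x => w x * φ (0, x) := fun hw hwm =>
    integrable_bounded_mul_of_compactSupport hw (fun x => abs_le_of_mem_Icc (hwm x))
      (hφ.continuous.comp (by fun_prop)) (hc.comp_isClosedEmbedding
      (Isometry.of_dist_eq fun t t' => by simp [Prod.dist_eq] :
        Isometry fun x : ℝ => ((0 : ℝ), x)).isClosedEmbedding)
  have hi₁ : Integrable fun z : ℝ × ℝ =>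
      (if 0 < z.1 then u z - v z else u₀ z.2 - v₀ z.2) * partialT φ z +
      (if 0 < z.1 then flux f g z.2 (u z) - flux f g z.2 (v z) else 0) * partialX φ z :=
    (integrable_mul_partial mW kW hC hc _).add (integrable_mul_partial mG kG hC hc _)
  rw [← integral_add_compl mH hi₁]
  have e1 : ∫ z in halfPlane, ((if 0 < z.1 then u z - v z else u₀ z.2 - v₀ z.2) * partialT φ z +
      (if 0 < z.1 then flux f g z.2 (u z) - flux f g z.2 (v z) else 0) * partialX φ z) =
      (∫ z in halfPlane, (u z * partialT φ z + flux f g z.2 (u z) * partialX φ z)) -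
      ∫ z in halfPlane, (v z * partialT φ z + flux f g z.2 (v z) * partialX φ z) := by
    rw [← integral_sub (hi hu.meas hu.mem).restrict (hi hv.meas hv.mem).restrict]
    refine setIntegral_congr_fun mH fun z hz => ?_
    have hz : 0 < z.1 := hz.1
    simp only [if_pos hz]
    ring
  have e2 : ∫ z in halfPlaneᶜ, ((if 0 < z.1 then u z - v z else u₀ z.2 - v₀ z.2) * partialT φ z +
      (if 0 < z.1 then flux f g z.2 (u z) - flux f g z.2 (v z) else 0) * partialX φ z) =
      ∫ x, (u₀ x - v₀ x) * φ (0, x) := by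
    rw [← integral_nonpos_time (w₀ := fun x => u₀ x - v₀ x) (hu₀.sub hv₀)
      (fun x => abs_sub_le_of_mem_Icc (mu₀ x) (mv₀ x)) hφ hc]
    refine setIntegral_congr_fun mH.compl fun z hz => ?_
    have hz : ¬ 0 < z.1 := fun h => hz ⟨h, mem_univ _⟩
    simp only [if_neg hz, zero_mul, add_zero]
  have e3 : ∫ x, (u₀ x - v₀ x) * φ (0, x) = (∫ x, u₀ x * φ (0, x)) - ∫ x, v₀ x * φ (0, x) := by
    rw [← integral_sub (hi₀ hu₀ mu₀) (hi₀ hv₀ mv₀)]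
    simp only [sub_mul]
  have w1 := hu.weak φ hφ hc
  have w2 := hv.weak φ hφ hc
  rw [e1, e2, e3]
  linarith

/-- The `L¹` contraction estimate with finite speed of propagation. -/
theorem ae_integral_abs_sub_le (hf : LipschitzWith L f) (hg : LipschitzWith L g) (ha : f a = g a)
    (hb : f b = g b) (hu : RegularSolution a b f g u₀ u ul ur p)
    (hv : RegularSolution a b f g v₀ v vl vr q)
    (hu₀ : Measurable u₀) (hv₀ : Measurable v₀) (mu₀ : ∀ x, u₀ x ∈ Icc a b)
    (mv₀ : ∀ x, v₀ x ∈ Icc a b) :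
    ∀ᵐ t : ℝ, 0 < t → ∀ R, 0 ≤ R → ∫ x in -R..R, |u (t, x) - v (t, x)| ≤
      ∫ x in -(R + (L + 1) * t)..R + (L + 1) * t, |u₀ x - v₀ x| := by
  have hL : (0 : ℝ) ≤ L := L.2
  have hab : a ≤ b := (mu₀ 0).1.trans (mu₀ 0).2
  set K : ℝ := (b - a) + L * (b - a) with hK
  have h1 : 0 ≤ b - a := by linarith
  have h2 : 0 ≤ L * (b - a) := by positivity
  have kuv : ∀ z, |u z - v z| ≤ b - a := fun z => abs_sub_le_of_mem_Icc (hu.mem z) (hv.mem z)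
  have kuv₀ : ∀ x, |u₀ x - v₀ x| ≤ b - a := fun x => abs_sub_le_of_mem_Icc (mu₀ x) (mv₀ x)
  set W : ℝ × ℝ → ℝ := fun z => if 0 < z.1 then u z - v z else u₀ z.2 - v₀ z.2 with hW
  set G : ℝ × ℝ → ℝ := fun z =>
    if 0 < z.1 then flux f g z.2 (u z) - flux f g z.2 (v z) else 0 with hG
  have kW : ∀ z, |W z| ≤ K := fun z => by
    simp only [hW]
    split_ifs
    · linarith [kuv z]
    · linarith [kuv₀ z.2]
  have kG : ∀ z, |G z| ≤ K := fun z => by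
    simp only [hG]
    split_ifs
    · have := (abs_flux_sub_le hf hg z.2 (u z) (v z)).trans (mul_le_mul_of_nonneg_left (kuv z) hL)
      linarith
    · rw [abs_zero]; linarith
  have mF : MeasurableSet {z : ℝ × ℝ | 0 < z.1} := measurableSet_lt measurable_const measurable_fst
  have mW : Measurable W := Measurable.ite mF (hu.meas.sub hv.meas)
    ((hu₀.comp measurable_snd).sub (hv₀.comp measurable_snd))
  have mG : Measurable G := Measurable.ite mF
    ((measurable_flux hf hg hu.meas).sub (measurable_flux hf hg hv.meas)) measurable_const
  obtain ⟨D, M₁, hD, hD0, hrow, hDgrad⟩ := exists_potential (w₀ := fun x => u₀ x - v₀ x) mW mG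
    (hu₀.sub hv₀) kW kG (fun x => by linarith [kuv₀ x]) (fun z hz => if_neg hz.not_gt)
    (fun z hz => if_neg hz.not_gt)
    (fun φ h1 h2 => div_free hf hg hu hv hu₀ hv₀ mu₀ mv₀ h1 h2)
  set ρ : ℝ × ℝ → ℝ := fun z => |u z - v z| with hρ
  set Q : ℝ × ℝ → ℝ := fun z => sflux f g z.2 (u z) (v z) with hQ
  have mρ : Measurable ρ := (hu.meas.sub hv.meas).abs
  have mQ : Measurable Q := measurable_sflux hf hg measurable_snd hu.meas hv.meas
  have kρ : ∀ z, |ρ z| ≤ K := fun z => by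
    simp only [hρ, abs_abs]
    linarith [kuv z]
  have kQ : ∀ z, |Q z| ≤ L * ρ z := fun z => abs_sflux_le hf hg _ _ _
  have kQ' : ∀ z, |Q z| ≤ K := fun z => by
    have := (kQ z).trans (mul_le_mul_of_nonneg_left (kuv z) hL)
    linarith
  have hDe : ∀ᵐ z : ℝ × ℝ, 0 < z.1 → ρ z * partialT D z + Q z * partialX D z = 0 := by
    filter_upwards [hDgrad, ae_snd_mul_ne one_ne_zero 0] with z hz hz2 h0
    have := sflux_mul_sub (f := f) (g := g) (by simpa using hz2) (u z) (v z)
    rw [hz.1, hz.2]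
    simp only [hG, hW, hρ, hQ, if_pos h0]
    linarith
  -- Where `ρ = 0` the transport identity is void, but the two solutions coincide there and so do
  -- their fluxes.
  have hDt : ∀ᵐ z : ℝ × ℝ, 0 < z.1 → ρ z = 0 → partialT D z = 0 := by
    filter_upwards [hDgrad] with z hz h0 hz0
    have : u z = v z := sub_eq_zero.1 (abs_eq_zero.1 hz0)
    rw [hz.1]
    simp only [hG, if_pos h0, this, sub_self, neg_zero]
  have hk : ∀ (φ : ℝ × ℝ → ℝ) (C : NNReal), LipschitzWith C φ → HasCompactSupport φ →
      tsupport φ ⊆ halfPlane → (∀ z, 0 ≤ φ z) →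
      0 ≤ ∫ z, (ρ z * partialT φ z + Q z * partialX φ z) := fun φ C h1 h2 h3 h4 =>
    kato hf hg ha hb hu hv h1 h2 h3 h4
  have pTn : ∀ z, partialT (fun z => -D z) z = -partialT D z := fun z => by
    simp [partialT, fderiv_fun_neg]
  have pXn : ∀ z, partialX (fun z => -D z) z = -partialX D z := fun z => by
    simp [partialX, fderiv_fun_neg]
  have hmax : ∀ s t x M : ℝ, 0 ≤ s → s < t →
      (∀ y, |y - x| ≤ (L + 1) * (t - s) → D (s, y) ≤ M) → D (t, x) ≤ M := fun s t x M h1 h2 h3 =>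
    le_of_le_on_base mρ mQ kρ kQ' (fun z => abs_nonneg _) kQ hL hD hDe hDt hk h1 h2 h3
  have hmin : ∀ s t x M : ℝ, 0 ≤ s → s < t →
      (∀ y, |y - x| ≤ (L + 1) * (t - s) → M ≤ D (s, y)) → M ≤ D (t, x) := by
    intro s t x M h1 h2 h3
    refine neg_le_neg_iff.1 (le_of_le_on_base (D := fun z => -D z) mρ mQ kρ kQ'
      (fun z => abs_nonneg _) kQ hL hD.neg ?_ ?_ hk h1 h2 fun y hy => neg_le_neg (h3 y hy))
    · filter_upwards [hDe] with z hz h0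
      rw [pTn, pXn]
      linarith [hz h0]
    · filter_upwards [hDt] with z hz h0 h00
      rw [pTn, hz h0 h00, neg_zero]
  have hC : (0 : ℝ) ≤ L + 1 := by positivity
  have hivt := fun (s t x : ℝ) (hs : 0 ≤ s) (hst : s < t) => exists_eq_on_base hD hC hmax hmin hs hst x
  filter_upwards [hrow] with t hrt ht R hR
  have hWt : ∀ x, W (t, x) = u (t, x) - v (t, x) := fun x => if_pos ht
  have := integral_abs_le_of_variation_le hR (mW.comp (measurable_const.prodMk measurable_id))
    (fun x => kW (t, x)) hrt fun X hX hXR n => sum_abs_sub_le (w₀ := fun x => u₀ x - v₀ x) hD hC hivt (hu₀.sub hv₀)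
      (fun x => (kuv₀ x).trans (by linarith : b - a ≤ K)) hD0 ht hX hXR n
  simpa only [Function.comp, id, hWt] using this

end RegularSolution

/-! ### Reduction to measurable representatives and Lipschitz fluxes -/

/-- The projection of the real line onto `[a, b]`. -/
noncomputable def clamp (a b s : ℝ) : ℝ := max a (min b s)

lemma clamp_mem {a b : ℝ} (hab : a ≤ b) (s : ℝ) : clamp a b s ∈ Icc a b :=
  ⟨le_max_left _ _, max_le hab (min_le_left _ _)⟩

lemma clamp_of_mem {a b s : ℝ} (hs : s ∈ Icc a b) : clamp a b s = s := by
  rw [clamp, min_eq_right hs.2, max_eq_right hs.1]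

lemma lipschitzWith_clamp (a b : ℝ) : LipschitzWith 1 (clamp a b) :=
  (LipschitzWith.id.const_min b).const_max a

lemma measurable_clamp (a b : ℝ) : Measurable (clamp a b) :=
  (lipschitzWith_clamp a b).continuous.measurable

/-- The fluxes are Lipschitz only on bounded sets. Freezing them outside `[a, b]` makes them
globally Lipschitz, with a constant depending only on their restriction to `[a, b]`. -/
lemma exists_lipschitzWith_comp_clamp {a b : ℝ} (hab : a ≤ b) {f : ℝ → ℝ} (hf : ContDiff ℝ 1 f) :
    ∃ L : NNReal, LipschitzWith L (f ∘ clamp a b) := by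
  obtain ⟨L, hL⟩ := LocallyLipschitzOn.exists_lipschitzOnWith_of_compact
    (isCompact_Icc (a := a) (b := b)) hf.locallyLipschitz.locallyLipschitzOn
  refine ⟨L, LipschitzWith.of_dist_le_mul fun s k => ?_⟩
  have h1 := hL.dist_le_mul _ (clamp_mem hab s) _ (clamp_mem hab k)
  have h2 := (lipschitzWith_clamp a b).dist_le_mul s k
  rw [NNReal.coe_one, one_mul] at h2
  exact h1.trans (mul_le_mul_of_nonneg_left h2 L.2)

lemma exists_measurable_clamp {E : Type*} [MeasurableSpace E] {μ : Measure E} {a b : ℝ}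
    (hab : a ≤ b) {u : E → ℝ} (hu : AEMeasurable u μ) (hm : ∀ᵐ z ∂μ, u z ∈ Icc a b) :
    ∃ w : E → ℝ, Measurable w ∧ (∀ z, w z ∈ Icc a b) ∧ ∀ᵐ z ∂μ, u z = w z := by
  refine ⟨fun z => clamp a b (hu.mk u z), (measurable_clamp a b).comp hu.measurable_mk,
    fun z => clamp_mem hab _, ?_⟩
  filter_upwards [hm, hu.ae_eq_mk] with z h1 h2
  rw [← h2, clamp_of_mem h1]

lemma flux_comp_clamp {a b : ℝ} (f g : ℝ → ℝ) (x : ℝ) {s : ℝ} (hs : s ∈ Icc a b) :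
    flux (f ∘ clamp a b) (g ∘ clamp a b) x s = flux f g x s := by
  simp [flux, clamp_of_mem hs]

lemma sign_mul_flux_sub {f g : ℝ → ℝ} {x : ℝ} (hx : x ≠ 0) (s k : ℝ) :
    Real.sign (s - k) * (flux f g x s - flux f g x k) = sflux f g x s k := by
  rcases lt_or_gt_of_ne hx with hx | hx
  · rw [sflux, if_neg hx.not_gt, flux_of_neg hx, flux_of_neg hx, kflux_eq_sign_mul]
  · rw [sflux, if_pos hx, flux_of_pos hx, flux_of_pos hx, kflux_eq_sign_mul]

lemma aemeasurable_of_isStrongTrace {l : Filter ℝ} {u : ℝ × ℝ → ℝ} {w : ℝ → ℝ}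
    (h : IsStrongTrace l u w) : AEMeasurable w (volume.restrict (Ioi (0 : ℝ))) := by
  have e : Ioi (0 : ℝ) = ⋃ n : ℕ, Icc (1 / ((n : ℝ) + 1)) n := by
    ext t
    simp only [mem_Ioi, mem_iUnion, mem_Icc]
    constructor
    · intro ht
      obtain ⟨n, hn⟩ := exists_nat_one_div_lt ht
      obtain ⟨m, hm⟩ := exists_nat_ge t
      refine ⟨max n m, ?_, hm.trans (by exact_mod_cast le_max_right n m)⟩
      refine le_trans (one_div_le_one_div_of_le (by positivity) ?_) hn.le
      have : (n : ℝ) ≤ (max n m : ℕ) := by exact_mod_cast le_max_left n m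
      linarith
    · rintro ⟨n, hn, -⟩
      exact lt_of_lt_of_le (by positivity) hn
  rw [e, aemeasurable_iUnion_iff]
  intro n
  refine (h.memLp_top_loc _ isCompact_Icc fun t ht => ?_).aestronglyMeasurable.aemeasurable
  exact lt_of_lt_of_le (by positivity) ht.1

/-- The projection onto `[a, b]` is 1-Lipschitz and fixes the values of the solution, so projecting
the trace does not increase its distance to the solution. -/
lemma exists_traceAt_of_isStrongTrace {a b σ : ℝ} (hab : a ≤ b) {l : Filter ℝ} {u w : ℝ × ℝ → ℝ}
    {γ : ℝ → ℝ} (hl : side σ ≤ l ⊓ ae volume) (h : IsStrongTrace l u γ) (hw : Measurable w)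
    (hwm : ∀ z, w z ∈ Icc a b) (huw : ∀ᵐ z ∂(volume.restrict halfPlane), u z = w z) :
    ∃ γ' : ℝ → ℝ, Measurable γ' ∧ (∀ t, γ' t ∈ Icc a b) ∧ TraceAt σ w γ' := by
  have hγ := aemeasurable_of_isStrongTrace h
  refine ⟨fun t => clamp a b (hγ.mk γ t), (measurable_clamp a b).comp hγ.measurable_mk,
    fun t => clamp_mem hab _, fun θ hθ hc hs h0 => ?_⟩
  have hlim := (h.tendsto θ hθ hc hs).mono_left hl
  have hx : ∀ᵐ x : ℝ, ∀ᵐ t : ℝ, t ∈ Ioi (0 : ℝ) → u (t, x) = w (t, x) := by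
    have := (ae_restrict_iff' isOpen_halfPlane.measurableSet).1 huw
    filter_upwards [ae_ae_slice_fst this] with x hx
    filter_upwards [hx] with t ht h0 using ht ⟨h0, mem_univ _⟩
  have hγ' := (ae_restrict_iff' measurableSet_Ioi).1 hγ.ae_eq_mk
  refine squeeze_zero' (Eventually.of_forall fun x =>
    integral_nonneg fun t => mul_nonneg (abs_nonneg _) (h0 t)) ?_ hlim
  have hside : side σ ≤ ae volume := inf_le_right
  filter_upwards [hside hx] with x hx
  have hx : ∀ᵐ t : ℝ, t ∈ Ioi (0 : ℝ) → u (t, x) = w (t, x) := hx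
  have hθ0 : ∀ t, t ∉ Ioi (0 : ℝ) → θ t = 0 := fun t ht =>
    image_eq_zero_of_notMem_tsupport fun h => ht (hs h)
  rw [setIntegral_eq_integral_of_forall_compl_eq_zero fun t ht => by rw [hθ0 t ht, mul_zero]]
  refine integral_mono_of_nonneg (Eventually.of_forall fun t =>
    mul_nonneg (abs_nonneg _) (h0 t)) ?_ ?_
  · have hsub : Function.support (fun t => |u (t, x) - γ t| * θ t) ⊆ tsupport θ := fun t ht =>
      subset_tsupport θ fun h => ht (by simp [h])
    rw [← integrableOn_iff_integrable_of_support_subset hsub]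
    have : IsFiniteMeasure (volume.restrict (tsupport θ)) :=
      ⟨by simpa using hc.isCompact.measure_lt_top⟩
    have i1 : IntegrableOn γ (tsupport θ) :=
      (h.memLp_top_loc _ hc.isCompact hs).integrable le_top
    have i2 : IntegrableOn (fun t => w (t, x)) (tsupport θ) :=
      (locallyIntegrable_of_abs_le (hw.comp
        (measurable_id.prodMk measurable_const)).aestronglyMeasurable
        fun t => abs_le_of_mem_Icc (hwm (t, x))).integrableOn_isCompact hc.isCompact
    have i3 : IntegrableOn (fun t => u (t, x)) (tsupport θ) := by
      refine i2.congr ?_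
      rw [EventuallyEq, ae_restrict_iff' (isClosed_tsupport θ).measurableSet]
      filter_upwards [hx] with t ht h0 using (ht (hs h0)).symm
    obtain ⟨M, hM⟩ := hθ.bounded_above_of_compact_support hc
    exact (i3.sub i1).abs.mul_bdd hθ.aestronglyMeasurable (Eventually.of_forall hM)
  · filter_upwards [hx, hγ'] with t h1 h2
    by_cases ht : t ∈ Ioi (0 : ℝ)
    · refine mul_le_mul_of_nonneg_right ?_ (h0 t)
      rw [← h2 ht, ← clamp_of_mem (hwm (t, x)), ← h1 ht]
      simpa [Real.dist_eq] using (lipschitzWith_clamp a b).dist_le_mul (u (t, x)) (γ t)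
    · simp [hθ0 t ht]

theorem exists_regularSolution {a b : ℝ} (hab : a ≤ b) {f g u₀ w₀ : ℝ → ℝ} {u : ℝ × ℝ → ℝ}
    (h : IsEntropyAdmissible a b f g u₀ u) (ht : HasStrongTraces u) (h₀ : ∀ᵐ x, u₀ x = w₀ x) :
    ∃ (w : ℝ × ℝ → ℝ) (ul ur p : ℝ → ℝ),
      RegularSolution a b (f ∘ clamp a b) (g ∘ clamp a b) w₀ w ul ur p ∧
      ∀ᵐ z ∂(volume.restrict halfPlane), u z = w z := by
  obtain ⟨w, mw, hw, huw⟩ := exists_measurable_clamp hab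
    h.memLp_top.aestronglyMeasurable.aemeasurable h.mem_Icc
  obtain ⟨⟨γl, hγl⟩, ⟨γr, hγr⟩⟩ := ht
  have sl : side (-1) ≤ 𝓝[<] (0 : ℝ) ⊓ ae volume := by
    have : {x : ℝ | 0 < -1 * x} = Iio 0 := by ext x; simp
    rw [side, this]
  have sr : side 1 ≤ 𝓝[>] (0 : ℝ) ⊓ ae volume := by
    have : {x : ℝ | 0 < 1 * x} = Ioi 0 := by ext x; simp
    rw [side, this]
  obtain ⟨ul, m1, m2, m3⟩ := exists_traceAt_of_isStrongTrace hab sl hγl mw hw huw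
  obtain ⟨ur, n1, n2, n3⟩ := exists_traceAt_of_isStrongTrace hab sr hγr mw hw huw
  obtain ⟨p, hp, -, hE⟩ := h.exists_interface
  refine ⟨w, ul, ur, hp.mk p, ⟨mw, m1, n1, hp.measurable_mk, hw, m2, n2, m3, n3, ?_, ?_⟩, huw⟩
  · intro φ hφ hc
    refine Eq.trans (congrArg₂ (· + ·) (integral_congr_ae ?_) (integral_congr_ae ?_))
      (h.integral_eq_zero φ hφ hc)
    · filter_upwards [huw] with z hz
      rw [flux_comp_clamp f g z.2 (hw z), hz]
    · filter_upwards [h₀] with x hx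
      rw [hx]
  · intro ξ hξ φ hφ hc hs h0
    have hent := hE ξ φ hφ hc hs h0
    have e1 : ∫ z in halfPlane, (|u z - ξ| * partialT φ z +
        Real.sign (u z - ξ) * (flux f g z.2 (u z) - flux f g z.2 ξ) * partialX φ z) =
        ∫ z, (|w z - ξ| * partialT φ z +
          sflux (f ∘ clamp a b) (g ∘ clamp a b) z.2 (w z) ξ * partialX φ z) := by
      refine Eq.trans (integral_congr_ae ?_)
        (setIntegral_eq_integral_of_forall_compl_eq_zero (s := halfPlane) fun z hz => by
          simp [partialT, partialX, fderiv_eq_zero_of_notMem_tsupport hs hz])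
      filter_upwards [huw, ae_restrict_of_ae (ae_snd_mul_ne one_ne_zero 0)] with z hz hz2
      rw [← sign_mul_flux_sub (by simpa using hz2), flux_comp_clamp f g z.2 (hw z),
        flux_comp_clamp f g z.2 hξ, hz]
    have e2 : ∫ t in Ioi (0 : ℝ), Real.sign (p t - ξ) * (f ξ - g ξ) * φ (t, 0) =
        -∫ t, -(Real.sign (hp.mk p t - ξ) * ((f ∘ clamp a b) ξ - (g ∘ clamp a b) ξ)) *
          φ (t, 0) := by
      rw [← integral_neg]
      refine Eq.trans (integral_congr_ae ?_)
        (setIntegral_eq_integral_of_forall_compl_eq_zero (s := Ioi (0 : ℝ)) fun t ht => by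
          have : φ (t, 0) = 0 := image_eq_zero_of_notMem_tsupport fun h => ht (hs h).1
          simp [this])
      filter_upwards [hp.ae_eq_mk] with t h1
      simp only [Function.comp, clamp_of_mem hξ, ← h1]
      ring
    rw [e1, e2] at hent
    linarith

lemma setIntegral_ball_eq (h : ℝ → ℝ) {R : ℝ} (hR : 0 ≤ R) :
    ∫ x in Metric.ball (0 : ℝ) R, h x = ∫ x in -R..R, h x := by
  rw [Real.ball_eq_Ioo, zero_sub, zero_add, intervalIntegral.integral_of_le (by linarith),
    integral_Ioc_eq_integral_Ioo]

end DiscontinuousFlux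

/-! ### The stability estimate -/

open DiscontinuousFlux in
theorem mainTheorem3 (a b : ℝ) (hab : a ≤ b) (f g : ℝ → ℝ)
    (hf : ContDiff ℝ 1 f) (hg : ContDiff ℝ 1 g) (hfga : f a = g a) (hfgb : f b = g b) :
    ∃ C : ℝ, 0 < C ∧ ∀ R T : ℝ, 0 < R → 0 < T →
      ∀ (u₀ v₀ : ℝ → ℝ) (u v : ℝ × ℝ → ℝ),
        DiscontinuousFlux.IsInitialDatum a b u₀ →
        DiscontinuousFlux.IsInitialDatum a b v₀ →
        DiscontinuousFlux.IsEntropyAdmissible a b f g u₀ u →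
        DiscontinuousFlux.IsEntropyAdmissible a b f g v₀ v →
        DiscontinuousFlux.HasStrongTraces u →
        DiscontinuousFlux.HasStrongTraces v →
        ∫ t in Ioo (0 : ℝ) T, ∫ x in Metric.ball (0 : ℝ) R, |u (t, x) - v (t, x)|
          ≤ T * ∫ x in Metric.ball (0 : ℝ) (R + C * T), |u₀ x - v₀ x| := by
  obtain ⟨L₁, hL₁⟩ := exists_lipschitzWith_comp_clamp hab hf
  obtain ⟨L₂, hL₂⟩ := exists_lipschitzWith_comp_clamp hab hg
  have hf' := hL₁.weaken (le_max_left L₁ L₂)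
  have hg' := hL₂.weaken (le_max_right L₁ L₂)
  set L := max L₁ L₂
  have hC : (0 : ℝ) < L + 1 := by positivity
  -- `L` is a common Lipschitz constant of the frozen fluxes, fixed before the data and the
  -- solutions; the extra `1` is the surplus speed of the cones.
  refine ⟨L + 1, hC, fun R T hR hT u₀ v₀ u v hu₀ hv₀ hu hv htu htv => ?_⟩
  obtain ⟨w₀, mw₀, hw₀, hw₀e⟩ := exists_measurable_clamp hab
    hu₀.aestronglyMeasurable.aemeasurable hu₀.mem_Icc
  obtain ⟨z₀, mz₀, hz₀, hz₀e⟩ := exists_measurable_clamp hab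
    hv₀.aestronglyMeasurable.aemeasurable hv₀.mem_Icc
  obtain ⟨w, wl, wr, p, hw, hwe⟩ := exists_regularSolution hab hu htu hw₀e
  obtain ⟨z, zl, zr, q, hz, hze⟩ := exists_regularSolution hab hv htv hz₀e
  have hend : ∀ c, a = c ∨ b = c → f c = g c →
      (f ∘ clamp a b) c = (g ∘ clamp a b) c := fun c hc h => by
    have : c ∈ Icc a b := by rcases hc with rfl | rfl <;> simp [hab]
    simp [clamp_of_mem this, h]
  have key := hw.ae_integral_abs_sub_le hf' hg' (hend a (Or.inl rfl) hfga)
    (hend b (Or.inr rfl) hfgb) hz mw₀ mz₀ hw₀ hz₀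
  set B := ∫ x in Metric.ball (0 : ℝ) (R + (L + 1) * T), |u₀ x - v₀ x| with hB
  have hBe : B = ∫ x in -(R + (L + 1) * T)..R + (L + 1) * T, |w₀ x - z₀ x| := by
    rw [← setIntegral_ball_eq _ (by positivity)]
    refine integral_congr_ae (ae_restrict_of_ae ?_)
    filter_upwards [hw₀e, hz₀e] with x h1 h2
    rw [h1, h2]
  have hslice : ∀ᵐ t : ℝ, ∀ᵐ x : ℝ, 0 < t → u (t, x) - v (t, x) = w (t, x) - z (t, x) := by
    have h1 := (ae_restrict_iff' isOpen_halfPlane.measurableSet).1 hwe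
    have h2 := (ae_restrict_iff' isOpen_halfPlane.measurableSet).1 hze
    refine Measure.ae_ae_of_ae_prod (μ := volume) (ν := volume)
      (p := fun y : ℝ × ℝ => 0 < y.1 → u y - v y = w y - z y) ?_
    filter_upwards [h1, h2] with y h1 h2 h0
    rw [h1 ⟨h0, mem_univ _⟩, h2 ⟨h0, mem_univ _⟩]
  have hTB : T * B = ∫ _t in Ioo (0 : ℝ) T, B := by simp [hT.le]
  rw [hTB]
  -- For almost every `t < T` the interval at time `t` is contained in that at time `T`, so `B`
  -- bounds the inner integral; integrating over `(0, T)` gives the factor `T`.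
  refine integral_mono_of_nonneg (Eventually.of_forall fun t =>
    integral_nonneg fun x => abs_nonneg _) (integrable_const B) ?_
  rw [EventuallyLE, ae_restrict_iff' measurableSet_Ioo]
  filter_upwards [key, hslice] with t h1 h2 ht
  have e : ∫ x in Metric.ball (0 : ℝ) R, |u (t, x) - v (t, x)| =
      ∫ x in -R..R, |w (t, x) - z (t, x)| := by
    rw [← setIntegral_ball_eq _ hR.le]
    refine integral_congr_ae (ae_restrict_of_ae ?_)
    filter_upwards [h2] with x hx
    rw [hx ht.1]
  rw [e, hBe]
  refine (h1 ht.1 R hR.le).trans ?_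
  have hm : R + (L + 1) * t ≤ R + (L + 1) * T := by nlinarith [ht.2]
  have hp : 0 ≤ R + (L + 1) * t := by have := ht.1; positivity
  exact intervalIntegral.integral_mono_interval (neg_le_neg hm) (by linarith) hm
    (Eventually.of_forall fun x => abs_nonneg _)
    (intervalIntegrable_of_abs_le (mw₀.sub mz₀)
      (fun x => abs_sub_le_of_mem_Icc (hw₀ x) (hz₀ x)) _ _).abs
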